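/- **Model.** Let $n\ge 2$, $q,s\in[0,1]$ and let $\pi^*$ be a permutation of $[n]$. In the correlated Erdős–Rényi model $\mathcal G(n,q;s)$, $A$ is the adjacency matrix of an Erdős–Rényi graph $\mathcal G(n,q)$ and, conditionally on $A$, the entries $B_{\pi^*(i)\pi^*(j)}$, $i<j$, are independent, Bernoulli with parameter $s$ if $A_{ij}=1$ and with parameter $q(1-s)/(1-q)$ if $A_{ij}=0$. **Distance statistic.** Let $N_A(i)$ be the set of neighbours of $i$ in $A$, $N_A[i]=N_A(i)\cup\{i\}$, $a_i=|N_A(i)|$, and for $j\in N_A(i)$ let $$a^{(i)}_j=\frac{1}{\sqrt{(n-a_i-1)q(1-q)}}\sum_{\ell\notin N_A[i]}(A_{\ell j}-q).$$ Let $\mu_i=\frac1{a_i}\sum_{j\in N_A(i)}\delta_{a^{(i)}_j}$ and $\bar\mu_i=\mu_i-\mathrm{Binom}^c(n-a_i-1,q)$, where $\mathrm{Binom}^c(k,q)$ is the law of $(X-kq)/\sqrt{kq(1-q)}$ for $X\sim\mathrm{Binom}(k,q)$ (with $x/0=0$, and $\mu_i=0$ if $a_i=0$). Define $\bar\nu_k$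 in the same way from $B$. For an integer $L\ge1$ let $I_1,\dots,I_L$ be the uniform partition of $[-1/2,1/2]$ into $L$ intervals of length $1/L$, and let $$Z_{ik}=\sum_{\ell=1}^L|\bar\mu_i(I_\ell)-\bar\nu_k(I_\ell)|.$$ **Algorithm.** Given the graphs $A,B$ on $[n]$, the integer $L$ and $q$, compute all $Z_{ik}$ and let $\mathcal S$ be the set of indices of the $n$ smallest ones (ties broken in any way). If $\mathcal S=\{(i,\hat\pi(i)):i\in[n]\}$ for a permutation $\hat\pi$, output $\hat\pi$; otherwise output "error". **Computational model.** Running times are numbers of steps on a real RAM: indirectly addressed arrays of natural numbers (with addition, truncated subtraction and comparison) and of real numbers (with exact arithmetic, square roots and comparison, but no rounding), unit cost per operation. Graphs are given by their degrees and by adjacency lists in any order. **Theorem.** There are one program $P$ and an exponent $\kappa$ such that the following holds. (a) There is a constant $K$ such that, for all $n\ge1$, $L\ge1$, $0<q<1$ and all graphs $A,B$ on $[n]$, $P$ halts with an output of the algorithm (for some way of breaking ties) after at most $$K\,\bigl(|E(A)|\,d_{\max}(A)+|E(B)|\,d_{\max}(B)+n^2\bigr)(L+\log n)^\kappa$$ steps,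 where $|E(\cdot)|$ is the number of edges and $d_{\max}(\cdot)$ the maximal degree. (b) There are a constant $q_0>0$ and, for every sufficiently large constant $L_0$, constants $\sigma_0,C_0>0$ and $K$ such that the following holds for all $n\ge2$, all $q\in[0,1]$, all $\sigma\ge0$ with $s:=1-\sigma^2\in[0,1]$, and all permutations $\pi^*$ of $[n]$. If $$q\le q_0,\qquad \sigma\le\frac{\sigma_0}{\log n},\qquad nq\ge C_0\log^2n,\qquad L=\lceil L_0\log n\rceil,$$ and $(A,B)$ is drawn from $\mathcal G(n,q;s)$ with latent permutation $\pi^*$, then with probability at least $1-K/n$ the output of the algorithm is $\hat\pi=\pi^*$ (however ties are broken), and $P$ produces it after at most $K(nd^2+n^2)(\log n)^\kappa$ steps, where $d=nq$. That is, with probability $1-O(1/n)$ the algorithm outputs exactly $\pi^*$, in time $\tilde O(nd^2+n^2)$. -/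

import Mathlib

open MeasureTheory ProbabilityTheory

/-! ### The correlated Erdős–Rényi model -/

/-- The number `q (1 - s) / (1 - q)`, the probability that a non-edge of `A` becomes an edge of `B`.
The projection to `[0, 1]` has no effect when `q (1 - s) ≤ 1 - q`, in particular when `q ≤ 1 / 2`. -/
noncomputable def flipProb (q s : unitInterval) : unitInterval :=
  Set.projIcc (0 : ℝ) 1 zero_le_one ((q : ℝ) * (1 - s) / (1 - q))

/-- `B` in terms of `A`, `S`, `T`: `B_{π(i) π(j)} = S_{ij}` if `A_{ij} = 1`, and
`B_{π(i) π(j)} = T_{ij}` if `A_{ij} = 0`. -/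
def noisyCopy {n : ℕ} (π : Equiv.Perm (Fin n)) (A S T : SimpleGraph (Fin n)) :
    SimpleGraph (Fin n) :=
  ((A ⊓ S) ⊔ (T \ A)).comap π.symm

/-- The law of `(A, B)` in the correlated Erdős–Rényi model `𝒢(n, q; s)` with latent permutation
`π`: `A` is a `G(n, q)` random graph and, given `A`, the indicators `B_{π(i) π(j)}`, `i < j`, are
independent, Bernoulli of parameter `s` if `A_{ij} = 1` and of parameter `q (1 - s) / (1 - q)`
if `A_{ij} = 0`. -/
noncomputable def correlatedER (n : ℕ) (q s : unitInterval) (π : Equiv.Perm (Fin n)) :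
    Measure (SimpleGraph (Fin n) × SimpleGraph (Fin n)) :=
  ((SimpleGraph.binomialRandom (Fin n) q).prod
    ((SimpleGraph.binomialRandom (Fin n) s).prod
      (SimpleGraph.binomialRandom (Fin n) (flipProb q s)))).map
    (fun w => (w.1, noisyCopy π w.1 w.2.1 w.2.2))

/-! ### Degree profiles and the distance statistic -/

section Profiles

variable {n : ℕ}

open Classical in
/-- The open neighbourhood of `i`. -/
noncomputable def nbrs (G : SimpleGraph (Fin n)) (i : Fin n) : Finset (Fin n) :=
  Finset.univ.filter (fun j => G.Adj i j)

/-- The degree of `i`. -/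
noncomputable def deg (G : SimpleGraph (Fin n)) (i : Fin n) : ℕ := (nbrs G i).card

/-- The number of edges. -/
noncomputable def numEdges (G : SimpleGraph (Fin n)) : ℕ := G.edgeSet.ncard

/-- The maximal degree. -/
noncomputable def maxDeg (G : SimpleGraph (Fin n)) : ℕ := Finset.univ.sup (deg G)

open Classical in
/-- The standardized outdegree of `j`, outside the closed neighbourhood of `i`. -/
noncomputable def stdOutdeg (G : SimpleGraph (Fin n)) (q : unitInterval) (i j : Fin n) : ℝ :=
  1 / Real.sqrt (((n : ℝ) - deg G i - 1) * q * (1 - q)) *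
    ∑ l ∈ (insert i (nbrs G i))ᶜ, ((if G.Adj l j then (1 : ℝ) else 0) - q)

/-- The degree profile of `i`: the empirical distribution of the standardized outdegrees of the
neighbours of `i` (the zero measure if `i` is isolated). -/
noncomputable def profile (G : SimpleGraph (Fin n)) (q : unitInterval) (i : Fin n) : Measure ℝ :=
  (1 / (deg G i : NNReal)) • ∑ j ∈ nbrs G i, Measure.dirac (stdOutdeg G q i j)

/-- The standardized binomial distribution: the law of `(X - k q) / √(k q (1 - q))` for a binomial
random variable `X` with parameters `k` and `q`. -/
noncomputable def stdBinomial (k : ℕ) (q : unitInterval) : Measure ℝ :=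
  (ProbabilityTheory.binomial k q).map
    (fun x : ℕ => ((x : ℝ) - k * q) / Real.sqrt ((k : ℝ) * q * (1 - q)))

instance profile_isFiniteMeasure (G : SimpleGraph (Fin n)) (q : unitInterval) (i : Fin n) :
    IsFiniteMeasure (profile G q i) := by
  unfold profile; infer_instance

instance stdBinomial_isFiniteMeasure (k : ℕ) (q : unitInterval) :
    IsFiniteMeasure (stdBinomial k q) := by
  unfold stdBinomial; infer_instance

/-- The centered degree profile of `i`. -/
noncomputable def centeredProfile (G : SimpleGraph (Fin n)) (q : unitInterval) (i : Fin n) :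
    SignedMeasure ℝ :=
  (profile G q i).toSignedMeasure - (stdBinomial (n - deg G i - 1) q).toSignedMeasure

/-- The uniform partition of `[-1/2, 1/2]` into `L` intervals of length `1 / L`, indexed by
`0, …, L - 1`; the last interval is closed, the others are closed on the left and open on the
right. -/
noncomputable def bin (L : ℕ) (l : Fin L) : Set ℝ :=
  if (l : ℕ) + 1 = L then Set.Icc (-1 / 2 + (l : ℝ) / L) (1 / 2)
  else Set.Ico (-1 / 2 + (l : ℝ) / L) (-1 / 2 + ((l : ℝ) + 1) / L)

/-- The distance statistic `Z i k`: the `ℓ¹` distance between the discretized centered degree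
profiles of `i` in `A` and of `k` in `B`. -/
noncomputable def distStat (A B : SimpleGraph (Fin n)) (L : ℕ) (q : unitInterval) (i k : Fin n) :
    ℝ :=
  ∑ l : Fin L, |centeredProfile A q i (bin L l) - centeredProfile B q k (bin L l)|

/-! ### The degree-profile matching algorithm -/

/-- `S` consists of the indices of `n` smallest elements of the array `Z` (ties may be broken
in any way). -/
def IsSmallest (Z : Fin n → Fin n → ℝ) (S : Finset (Fin n × Fin n)) : Prop :=
  S.card = n ∧ ∀ p ∈ S, ∀ r ∉ S, Z p.1 p.2 ≤ Z r.1 r.2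

/-- `o` is an output of the degree-profile matching algorithm on the graphs `A` and `B`, with `L`
bins and edge probability `q`, for some way of breaking ties among the distance statistics.
The value `some ρ` is the output of the permutation `ρ`, and `none` is the output "error". -/
def IsMatchingOutput (A B : SimpleGraph (Fin n)) (L : ℕ) (q : unitInterval)
    (o : Option (Equiv.Perm (Fin n))) : Prop :=
  ∃ S : Finset (Fin n × Fin n), IsSmallest (distStat A B L q) S ∧
    ∀ ρ : Equiv.Perm (Fin n), o = some ρ ↔ ∀ i k : Fin n, (i, k) ∈ S ↔ k = ρ i

end Profiles

/-! ### Real RAM with a step count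

A program uses finitely many arrays (named by the numbers that occur in it) of natural numbers and
finitely many arrays of real numbers; a scalar variable is a cell of an array. Natural numbers can
be used as addresses and admit addition, truncated subtraction and comparison. Real numbers admit
exact arithmetic, square roots and comparison, but no rounding. Every elementary operation costs
one step. -/

namespace RealRAM

/-- The memory: cell `i` of the array of naturals `a` is `nat a i`, cell `i` of the array of reals
`a` is `real a i`. -/
structure Mem where
  nat : ℕ → ℕ → ℕ
  real : ℕ → ℕ → ℝ

/-- Expressions of type natural number. -/
inductive NExp where
  | lit (c : ℕ)
  | get (a : ℕ) (i : NExp)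
  | plus (e f : NExp)
  | monus (e f : NExp)

/-- Expressions of type real number. -/
inductive RExp where
  | ofNat (e : NExp)
  | get (a : ℕ) (i : NExp)
  | plus (x y : RExp)
  | minus (x y : RExp)
  | times (x y : RExp)
  | over (x y : RExp)
  | root (x : RExp)

/-- Comparisons. -/
inductive Test where
  | natLt (e f : NExp)
  | realLt (x y : RExp)

/-- Programs. -/
inductive Cmd where
  | skip
  | setNat (a : ℕ) (i e : NExp)
  | setReal (a : ℕ) (i : NExp) (x : RExp)
  | seq (c d : Cmd)
  | ite (b : Test) (c d : Cmd)
  | loop (b : Test) (c : Cmd)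

def NExp.eval (m : Mem) : NExp → ℕ
  | .lit c => c
  | .get a i => m.nat a (i.eval m)
  | .plus e f => e.eval m + f.eval m
  | .monus e f => e.eval m - f.eval m

/-- Division by zero gives zero, and so does the square root of a negative number. -/
noncomputable def RExp.eval (m : Mem) : RExp → ℝ
  | .ofNat e => (e.eval m : ℝ)
  | .get a i => m.real a (i.eval m)
  | .plus x y => x.eval m + y.eval m
  | .minus x y => x.eval m - y.eval m
  | .times x y => x.eval m * y.eval m
  | .over x y => x.eval m / y.eval m
  | .root x => Real.sqrt (x.eval m)

def Test.Holds (m : Mem) : Test → Prop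
  | .natLt e f => e.eval m < f.eval m
  | .realLt x y => x.eval m < y.eval m

/-- Number of steps to evaluate an expression. -/
def NExp.cost : NExp → ℕ
  | .lit _ => 1
  | .get _ i => 1 + i.cost
  | .plus e f => 1 + e.cost + f.cost
  | .monus e f => 1 + e.cost + f.cost

/-- Number of steps to evaluate an expression. -/
def RExp.cost : RExp → ℕ
  | .ofNat e => 1 + e.cost
  | .get _ i => 1 + i.cost
  | .plus x y => 1 + x.cost + y.cost
  | .minus x y => 1 + x.cost + y.cost
  | .times x y => 1 + x.cost + y.cost
  | .over x y => 1 + x.cost + y.cost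
  | .root x => 1 + x.cost

/-- Number of steps to evaluate a comparison. -/
def Test.cost : Test → ℕ
  | .natLt e f => 1 + e.cost + f.cost
  | .realLt x y => 1 + x.cost + y.cost

def Mem.writeNat (m : Mem) (a i v : ℕ) : Mem :=
  { m with nat := Function.update m.nat a (Function.update (m.nat a) i v) }

def Mem.writeReal (m : Mem) (a i : ℕ) (v : ℝ) : Mem :=
  { m with real := Function.update m.real a (Function.update (m.real a) i v) }

/-- `Run c m m' t`: started in memory `m`, the program `c` halts after `t` steps in memory `m'`. -/
inductive Run : Cmd → Mem → Mem → ℕ → Prop where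
  | skip (m : Mem) : Run .skip m m 1
  | setNat (m : Mem) (a : ℕ) (i e : NExp) :
      Run (.setNat a i e) m (m.writeNat a (i.eval m) (e.eval m)) (1 + i.cost + e.cost)
  | setReal (m : Mem) (a : ℕ) (i : NExp) (x : RExp) :
      Run (.setReal a i x) m (m.writeReal a (i.eval m) (x.eval m)) (1 + i.cost + x.cost)
  | seq {c d : Cmd} {m m' m'' : Mem} {t t' : ℕ} :
      Run c m m' t → Run d m' m'' t' → Run (.seq c d) m m'' (t + t')
  | ite_true {b : Test} {c d : Cmd} {m m' : Mem} {t : ℕ} :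
      b.Holds m → Run c m m' t → Run (.ite b c d) m m' (1 + b.cost + t)
  | ite_false {b : Test} {c d : Cmd} {m m' : Mem} {t : ℕ} :
      ¬ b.Holds m → Run d m m' t → Run (.ite b c d) m m' (1 + b.cost + t)
  | loop_true {b : Test} {c : Cmd} {m m' m'' : Mem} {t t' : ℕ} :
      b.Holds m → Run c m m' t → Run (.loop b c) m' m'' t' →
        Run (.loop b c) m m'' (1 + b.cost + t + t')
  | loop_false {b : Test} {c : Cmd} {m : Mem} :
      ¬ b.Holds m → Run (.loop b c) m m (1 + b.cost)

/-- `adj` is an adjacency list of `G` (the neighbours of a vertex are listed in any order). -/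
def IsAdjList {n : ℕ} (G : SimpleGraph (Fin n)) (adj : Fin n → List (Fin n)) : Prop :=
  ∀ i, (adj i).Nodup ∧ ∀ j, j ∈ adj i ↔ G.Adj i j

/-- The input: `n` and `L` in array `0`; the degrees in `A` in array `1` and the concatenated
neighbour lists of `A` in array `2`; the same for `B` in arrays `3` and `4`; the real number `q` in
array `0` of reals. All other cells are zero. -/
noncomputable def inputMem {n : ℕ} (adjA adjB : Fin n → List (Fin n)) (L : ℕ) (q : ℝ) : Mem where
  nat a i :=
    match a with
    | 0 => if i = 0 then n else if i = 1 then L else 0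
    | 1 => if h : i < n then (adjA ⟨i, h⟩).length else 0
    | 2 => ((List.ofFn adjA).flatten.map Fin.val).getD i 0
    | 3 => if h : i < n then (adjB ⟨i, h⟩).length else 0
    | 4 => ((List.ofFn adjB).flatten.map Fin.val).getD i 0
    | _ => 0
  real a i := if a = 0 ∧ i = 0 then q else 0

/-- The output is in array `5` (`1`: a permutation, `0`: error) and array `6` (the permutation). -/
def HasOutput {n : ℕ} (m : Mem) : Option (Equiv.Perm (Fin n)) → Prop
  | some ρ => m.nat 5 0 = 1 ∧ ∀ i : Fin n, m.nat 6 i = ρ i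
  | none => m.nat 5 0 = 0

/-- Started in memory `m`, the program `P` halts with output `o` after at most `T` steps. -/
def Computes {n : ℕ} (P : Cmd) (m : Mem) (o : Option (Equiv.Perm (Fin n))) (T : ℝ) : Prop :=
  ∃ m' t, Run P m m' t ∧ HasOutput m' o ∧ (t : ℝ) ≤ T

end RealRAM

/-! ### Averages over independent coordinates -/

/-- `w` is a probability vector. -/
structure IsWeight {V : Type*} [Fintype V] (w : V → ℝ) : Prop where
  nonneg : ∀ v, 0 ≤ w v
  sum_eq : ∑ v, w v = 1

set_option linter.unusedSectionVars false

section Averaging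

variable {ι V : Type*} [Fintype ι] [DecidableEq ι] [Fintype V]

/-- The expectation of `f` when the coordinates are independent with law `w`. -/
noncomputable def expect (w : V → ℝ) (f : (ι → V) → ℝ) : ℝ := ∑ η : ι → V, (∏ e, w (η e)) * f η

/-- The expectation of `f` when the coordinates in `U` are resampled and the others are those
of `ω`. -/
noncomputable def avg (w : V → ℝ) (U : Finset ι) (f : (ι → V) → ℝ) (ω : ι → V) : ℝ :=
  expect w (fun η => f (U.piecewise η ω))

open Classical in
/-- The indicator of a property. -/
noncomputable def ind {α : Type*} (p : α → Prop) (x : α) : ℝ := if p x then 1 else 0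

lemma ind_nonneg {α : Type*} (p : α → Prop) (x : α) : 0 ≤ ind p x := by
  unfold ind; split_ifs <;> norm_num

lemma ind_le_one {α : Type*} (p : α → Prop) (x : α) : ind p x ≤ 1 := by
  unfold ind; split_ifs <;> norm_num

lemma ind_of {α : Type*} {p : α → Prop} {x : α} (h : p x) : ind p x = 1 := by simp [ind, h]

lemma ind_of_not {α : Type*} {p : α → Prop} {x : α} (h : ¬ p x) : ind p x = 0 := by simp [ind, h]

lemma ind_sq {α : Type*} (p : α → Prop) (x : α) : ind p x ^ 2 = ind p x := by
  unfold ind; split_ifs <;> norm_num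

lemma ind_mono {α β : Type*} {p : α → Prop} {r : β → Prop} {x : α} {y : β} (h : p x → r y) :
    ind p x ≤ ind r y := by
  by_cases hp : p x
  · rw [ind_of hp, ind_of (h hp)]
  · rw [ind_of_not hp]; exact ind_nonneg _ _

lemma ind_congr {α β : Type*} {p : α → Prop} {r : β → Prop} {x : α} {y : β} (h : p x ↔ r y) :
    ind p x = ind r y :=
  le_antisymm (ind_mono h.1) (ind_mono h.2)

variable {w : V → ℝ}

lemma IsWeight.prod_nonneg (hw : IsWeight w) (η : ι → V) : 0 ≤ ∏ e, w (η e) :=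
  Finset.prod_nonneg fun _ _ => hw.nonneg _

lemma IsWeight.sum_prod (hw : IsWeight w) : ∑ η : ι → V, ∏ e, w (η e) = 1 := by
  have := (Finset.prod_univ_sum (fun _ : ι => (Finset.univ : Finset V)) (fun _ v => w v)).symm
  simpa [hw.sum_eq] using this

lemma expect_const (hw : IsWeight w) (c : ℝ) : expect w (fun _ : ι → V => c) = c := by
  simp [expect, ← Finset.sum_mul, hw.sum_prod]

lemma expect_add (f g : (ι → V) → ℝ) :
    expect w (fun ω => f ω + g ω) = expect w f + expect w g := by
  simp [expect, mul_add, Finset.sum_add_distrib]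

lemma expect_mul_left (c : ℝ) (f : (ι → V) → ℝ) :
    expect w (fun ω => c * f ω) = c * expect w f := by
  simp only [expect, Finset.mul_sum]
  exact Finset.sum_congr rfl fun _ _ => by ring

lemma expect_sum {κ : Type*} (s : Finset κ) (f : κ → (ι → V) → ℝ) :
    expect w (fun ω => ∑ k ∈ s, f k ω) = ∑ k ∈ s, expect w (f k) := by
  simp only [expect, Finset.mul_sum]
  exact Finset.sum_comm

lemma expect_mono (hw : IsWeight w) {f g : (ι → V) → ℝ} (h : ∀ ω, f ω ≤ g ω) :
    expect w f ≤ expect w g :=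
  Finset.sum_le_sum fun η _ => mul_le_mul_of_nonneg_left (h η) (hw.prod_nonneg η)

/-- Resampling a fixed set of coordinates does not change expectations. -/
lemma expect_expect_piecewise (hw : IsWeight w) (U : Finset ι) (F : (ι → V) → ℝ) :
    expect w (fun η => expect w (fun θ => F (U.piecewise θ η))) = expect w F := by
  simp only [expect, Finset.mul_sum]
  rw [← Fintype.sum_prod_type' (fun η θ : ι → V =>
    (∏ e, w (η e)) * ((∏ e, w (θ e)) * F (U.piecewise θ η)))]
  let φ : (ι → V) × (ι → V) → (ι → V) × (ι → V) :=
    fun p => (U.piecewise p.2 p.1, U.piecewise p.1 p.2)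
  have hφ : Function.Involutive φ := by
    rintro ⟨a, b⟩
    simp only [φ, Prod.mk.injEq]
    constructor <;> (funext e; by_cases he : e ∈ U <;> simp [he])
  have key : ∀ p : (ι → V) × (ι → V),
      (∏ e, w ((φ p).1 e)) * (∏ e, w ((φ p).2 e)) = (∏ e, w (p.1 e)) * ∏ e, w (p.2 e) := by
    intro p
    rw [← Finset.prod_mul_distrib, ← Finset.prod_mul_distrib]
    refine Finset.prod_congr rfl fun e _ => ?_
    by_cases he : e ∈ U <;> simp [φ, he, mul_comm]
  calc ∑ p : (ι → V) × (ι → V),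
        (∏ e, w (p.1 e)) * ((∏ e, w (p.2 e)) * F (U.piecewise p.2 p.1))
      = ∑ p : (ι → V) × (ι → V), (∏ e, w ((φ p).1 e)) * ((∏ e, w ((φ p).2 e)) * F (φ p).1) := by
        refine Finset.sum_congr rfl fun p _ => ?_
        rw [← mul_assoc, ← mul_assoc, key]
    _ = ∑ p : (ι → V) × (ι → V), (∏ e, w (p.1 e)) * ((∏ e, w (p.2 e)) * F p.1) :=
        (Equiv.sum_comp (Function.Involutive.toPerm φ hφ) (fun p : (ι → V) × (ι → V) =>
          (∏ e, w (p.1 e)) * ((∏ e, w (p.2 e)) * F p.1)))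
    _ = ∑ η : ι → V, (∏ e, w (η e)) * F η := by
        rw [Fintype.sum_prod_type]
        refine Finset.sum_congr rfl fun η _ => ?_
        dsimp only
        rw [← Finset.mul_sum, ← Finset.sum_mul, hw.sum_prod, one_mul]

lemma expect_avg (hw : IsWeight w) (U : Finset ι) (f : (ι → V) → ℝ) :
    expect w (avg w U f) = expect w f :=
  expect_expect_piecewise hw U f

lemma avg_const (hw : IsWeight w) (U : Finset ι) (c : ℝ) (ω : ι → V) :
    avg w U (fun _ => c) ω = c := expect_const hw c

lemma avg_empty (hw : IsWeight w) (f : (ι → V) → ℝ) (ω : ι → V) : avg w ∅ f ω = f ω := by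
  simpa [avg] using expect_const hw (f ω)

lemma avg_add (U : Finset ι) (f g : (ι → V) → ℝ) (ω : ι → V) :
    avg w U (fun ω => f ω + g ω) ω = avg w U f ω + avg w U g ω := expect_add _ _

lemma avg_mul_left (U : Finset ι) (c : ℝ) (f : (ι → V) → ℝ) (ω : ι → V) :
    avg w U (fun ω => c * f ω) ω = c * avg w U f ω := expect_mul_left _ _

lemma avg_neg (U : Finset ι) (f : (ι → V) → ℝ) (ω : ι → V) :
    avg w U (fun ω => - f ω) ω = - avg w U f ω := by
  simpa using avg_mul_left (w := w) U (-1) f ω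

lemma avg_sub (U : Finset ι) (f g : (ι → V) → ℝ) (ω : ι → V) :
    avg w U (fun ω => f ω - g ω) ω = avg w U f ω - avg w U g ω := by
  simp only [sub_eq_add_neg, avg_add, avg_neg]

lemma avg_sum {κ : Type*} (s : Finset κ) (U : Finset ι) (f : κ → (ι → V) → ℝ) (ω : ι → V) :
    avg w U (fun ω => ∑ k ∈ s, f k ω) ω = ∑ k ∈ s, avg w U (f k) ω := expect_sum _ _

lemma avg_mono (hw : IsWeight w) {U : Finset ι} {f g : (ι → V) → ℝ} {ω : ι → V}
    (h : ∀ ω', (∀ e ∉ U, ω' e = ω e) → f ω' ≤ g ω') : avg w U f ω ≤ avg w U g ω :=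
  expect_mono hw fun η => h _ fun e he => by simp [he]

lemma avg_congr {U : Finset ι} {f g : (ι → V) → ℝ} {ω : ι → V}
    (h : ∀ ω', (∀ e ∉ U, ω' e = ω e) → f ω' = g ω') : avg w U f ω = avg w U g ω := by
  unfold avg
  congr 1
  funext η
  exact h _ fun e he => by simp [he]

lemma avg_le_const (hw : IsWeight w) {U : Finset ι} {f : (ι → V) → ℝ} {ω : ι → V} {c : ℝ}
    (h : ∀ ω', (∀ e ∉ U, ω' e = ω e) → f ω' ≤ c) : avg w U f ω ≤ c :=
  (avg_mono hw h).trans_eq (avg_const hw U c ω)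

lemma avg_nonneg (hw : IsWeight w) {U : Finset ι} {f : (ι → V) → ℝ} {ω : ι → V}
    (h : ∀ ω', 0 ≤ f ω') : 0 ≤ avg w U f ω :=
  (avg_const hw U 0 ω).symm.le.trans (avg_mono hw fun ω' _ => h ω')

lemma avg_eq_of_agree {U : Finset ι} {f : (ι → V) → ℝ} {ω ω' : ι → V}
    (h : ∀ e ∉ U, ω' e = ω e) : avg w U f ω' = avg w U f ω := by
  unfold avg
  congr 1
  funext η
  congr 1
  funext e
  by_cases he : e ∈ U
  · simp [he]
  · simp [he, h e he]

lemma avg_avg (hw : IsWeight w) (U W : Finset ι) (f : (ι → V) → ℝ) (ω : ι → V) :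
    avg w U (avg w W f) ω = avg w (U ∪ W) f ω := by
  unfold avg
  rw [← expect_expect_piecewise hw W (fun η => f ((U ∪ W).piecewise η ω))]
  congr 1
  funext η
  congr 1
  funext θ
  congr 1
  funext e
  by_cases hW : e ∈ W
  · simp [hW]
  · by_cases hU : e ∈ U <;> simp [hU, hW]

lemma avg_of_dependsOn (hw : IsWeight w) {U : Finset ι} {f : (ι → V) → ℝ} {S : Set ι}
    (hf : DependsOn f S) (hU : ∀ e ∈ U, e ∉ S) (ω : ι → V) : avg w U f ω = f ω := by
  rw [← avg_const hw U (f ω) ω]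
  refine avg_congr fun ω' h => hf fun e he => h e fun h' => hU e h' he

lemma avg_inter (hw : IsWeight w) {U W : Finset ι} {f : (ι → V) → ℝ} {S : Set ι}
    (hf : DependsOn f S) (hWU : W ⊆ U) (h : ∀ e ∈ U, e ∈ S → e ∈ W) (ω : ι → V) :
    avg w U f ω = avg w W f ω := by
  have : U = W ∪ (U \ W) := by simp [hWU]
  rw [this, ← avg_avg hw]
  refine avg_congr fun ω' _ => avg_of_dependsOn hw hf (fun e he heS => ?_) ω'
  rw [Finset.mem_sdiff] at he
  exact he.2 (h e he.1 heS)

lemma avg_mul_of_agree {U : Finset ι} {f g : (ι → V) → ℝ} {ω : ι → V}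
    (h : ∀ ω', (∀ e ∉ U, ω' e = ω e) → g ω' = g ω) :
    avg w U (fun ω => g ω * f ω) ω = g ω * avg w U f ω := by
  rw [← avg_mul_left]
  exact avg_congr fun ω' h' => by rw [h ω' h']

open Classical in
/-- Functions of disjoint sets of coordinates are independent. -/
lemma avg_mul (hw : IsWeight w) {U : Finset ι} {f g : (ι → V) → ℝ} {S T : Set ι}
    (hf : DependsOn f S) (hg : DependsOn g T) (hST : Disjoint S T) (ω : ι → V) :
    avg w U (fun ω => f ω * g ω) ω = avg w U f ω * avg w U g ω := by
  set W := U.filter (· ∈ S) with hWdef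
  have hWU : W ⊆ U := Finset.filter_subset _ _
  have hU : U = W ∪ (U \ W) := by simp [hWU]
  have hgU : ∀ ω, avg w (U \ W) g ω = avg w U g ω := fun ω =>
    (avg_inter hw hg Finset.sdiff_subset (fun e he heT => Finset.mem_sdiff.2 ⟨he, fun heW =>
      Set.disjoint_left.1 hST (Finset.mem_filter.1 heW).2 heT⟩) ω).symm
  calc avg w U (fun ω => f ω * g ω) ω
      = avg w W (avg w (U \ W) (fun ω => f ω * g ω)) ω := by
        rw [avg_avg hw, ← hU]
    _ = avg w W (fun ω' => avg w U g ω * f ω') ω := by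
        refine avg_congr fun ω' h' => ?_
        rw [avg_mul_of_agree (g := f), hgU, mul_comm]
        · congr 1
          exact avg_eq_of_agree fun e he => h' e fun h => he (hWU h)
        · intro ω'' h''
          refine hf fun e he => h'' e ?_
          simp [hWdef, he]
    _ = avg w U g ω * avg w W f ω := avg_mul_left _ _ _ _
    _ = avg w U f ω * avg w U g ω := by
        rw [mul_comm]
        congr 1
        exact (avg_inter hw hf hWU (fun e he heS => Finset.mem_filter.2 ⟨he, heS⟩) ω).symm

open Classical in
/-- Resampling a set of coordinates that is determined by the other coordinates does not change
expectations. -/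
lemma expect_resample (hw : IsWeight w) (U : (ι → V) → Finset ι)
    (hU : ∀ ω ω', (∀ e ∉ U ω, ω' e = ω e) → U ω' = U ω) (f : (ι → V) → ℝ) :
    expect w f = expect w (fun ω => avg w (U ω) f ω) := by
  have h1 : ∀ g : (ι → V) → ℝ, expect w g = ∑ W : Finset ι, expect w (fun ω => if U ω = W then g ω else 0) := by
    intro g
    rw [← expect_sum]
    simp
  rw [h1 f, h1 (fun ω => avg w (U ω) f ω)]
  refine Finset.sum_congr rfl fun W _ => ?_
  rw [← expect_avg hw W]
  congr 1
  funext ω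
  split_ifs with h
  · subst h
    refine avg_congr fun ω' h' => ?_
    rw [if_pos (hU ω ω' h')]
  · refine Eq.trans ?_ (avg_const hw W 0 ω)
    refine avg_congr (g := fun _ => 0) fun ω' h' => if_neg fun hW => h ?_
    subst hW
    exact hU ω' ω fun e he => (h' e he).symm

/-- A bound on conditional expectations, on an event which is determined by the coordinates that
are not resampled, bounds the expectation. -/
lemma expect_le_of_resample (hw : IsWeight w) (U : (ι → V) → Finset ι)
    (hU : ∀ ω ω', (∀ e ∉ U ω, ω' e = ω e) → U ω' = U ω) {p : (ι → V) → Prop} {c : ℝ}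
    (hp : ∀ ω, avg w (U ω) (ind p) ω ≤ c) : expect w (ind p) ≤ c := by
  rw [expect_resample hw U hU]
  exact (expect_mono hw hp).trans_eq (expect_const hw c)

/-! ### Concentration -/

lemma sum_mul_exp_le {α : Type*} {s : Finset α} {p x : α → ℝ} {c : ℝ} (hp : ∀ i ∈ s, 0 ≤ p i)
    (hs : ∑ i ∈ s, p i = 1) (hx : ∀ i ∈ s, ∀ j ∈ s, |x i - x j| ≤ c) :
    ∑ i ∈ s, p i * Real.exp (x i) ≤ Real.exp (∑ i ∈ s, p i * x i + c ^ 2 / 2) := by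
  set m := ∑ i ∈ s, p i * x i with hm
  set S := ∑ i ∈ s, p i * Real.exp (x i)
  set T := ∑ i ∈ s, p i * Real.exp (-x i)
  have hS0 : 0 ≤ S := Finset.sum_nonneg fun i hi => mul_nonneg (hp i hi) (Real.exp_pos _).le
  have hT : Real.exp (-m) ≤ T := by
    have h1 : ∑ i ∈ s, p i * (Real.exp (-m) * (1 - (x i - m))) ≤ T := by
      refine Finset.sum_le_sum fun i hi => mul_le_mul_of_nonneg_left ?_ (hp i hi)
      have : Real.exp (-x i) = Real.exp (-m) * Real.exp (-(x i - m)) := by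
        rw [← Real.exp_add]; congr 1; ring
      rw [this]
      refine mul_le_mul_of_nonneg_left ?_ (Real.exp_pos _).le
      have := Real.add_one_le_exp (-(x i - m))
      linarith
    refine le_trans (le_of_eq ?_) h1
    have : ∀ i ∈ s, p i * (Real.exp (-m) * (1 - (x i - m)))
        = Real.exp (-m) * (1 + m) * p i - Real.exp (-m) * (p i * x i) := fun i _ => by ring
    rw [Finset.sum_congr rfl this, Finset.sum_sub_distrib, ← Finset.mul_sum, ← Finset.mul_sum,
      hs, ← hm]
    ring
  have hST : S * T ≤ Real.exp (c ^ 2 / 2) := by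
    have e1 : S * T = ∑ i ∈ s, ∑ j ∈ s, p i * p j * Real.exp (x i - x j) := by
      rw [Finset.sum_mul_sum]
      refine Finset.sum_congr rfl fun i _ => Finset.sum_congr rfl fun j _ => ?_
      rw [sub_eq_add_neg, Real.exp_add]; ring
    have e2 : S * T = ∑ i ∈ s, ∑ j ∈ s, p i * p j * Real.exp (-(x i - x j)) := by
      rw [e1, Finset.sum_comm]
      refine Finset.sum_congr rfl fun i _ => Finset.sum_congr rfl fun j _ => ?_
      rw [neg_sub]; ring
    have e3 : S * T = ∑ i ∈ s, ∑ j ∈ s, p i * p j * Real.cosh (x i - x j) := by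
      have : S * T = (S * T + S * T) / 2 := by ring
      rw [this]
      nth_rewrite 1 [e1]
      rw [e2, ← Finset.sum_add_distrib, Finset.sum_div]
      refine Finset.sum_congr rfl fun i _ => ?_
      rw [← Finset.sum_add_distrib, Finset.sum_div]
      refine Finset.sum_congr rfl fun j _ => ?_
      rw [Real.cosh_eq]; ring
    rw [e3]
    calc ∑ i ∈ s, ∑ j ∈ s, p i * p j * Real.cosh (x i - x j)
        ≤ ∑ i ∈ s, ∑ j ∈ s, p i * p j * Real.exp (c ^ 2 / 2) := by
          refine Finset.sum_le_sum fun i hi => Finset.sum_le_sum fun j hj =>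
            mul_le_mul_of_nonneg_left ?_ (mul_nonneg (hp i hi) (hp j hj))
          refine (Real.cosh_le_exp_half_sq _).trans (Real.exp_le_exp.2 ?_)
          have := sq_le_sq' (abs_le.1 (hx i hi j hj)).1 (abs_le.1 (hx i hi j hj)).2
          linarith
      _ = Real.exp (c ^ 2 / 2) := by
          simp_rw [← Finset.sum_mul, ← Finset.mul_sum, hs]
          simp [hs]
  have : S * Real.exp (-m) ≤ Real.exp (c ^ 2 / 2) :=
    (mul_le_mul_of_nonneg_left hT hS0).trans hST
  rw [Real.exp_neg, ← div_eq_mul_inv, div_le_iff₀ (Real.exp_pos _), ← Real.exp_add] at this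
  rwa [add_comm]

lemma avg_exp_le (hw : IsWeight w) {U : Finset ι} {g : (ι → V) → ℝ} {ω : ι → V} {c : ℝ}
    (h : ∀ ω₁ ω₂, (∀ e ∉ U, ω₁ e = ω₂ e) → |g ω₁ - g ω₂| ≤ c) (t : ℝ) :
    avg w U (fun ω => Real.exp (t * g ω)) ω ≤ Real.exp (t * avg w U g ω + t ^ 2 * c ^ 2 / 2) := by
  have := sum_mul_exp_le (s := Finset.univ) (p := fun η : ι → V => ∏ e, w (η e))
    (x := fun η => t * g (U.piecewise η ω)) (c := |t| * c) (fun η _ => hw.prod_nonneg η)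
    hw.sum_prod (fun η _ θ _ => by
      rw [← mul_sub, abs_mul]
      exact mul_le_mul_of_nonneg_left (h _ _ fun e he => by simp [he]) (abs_nonneg t))
  rw [mul_pow, sq_abs] at this
  refine this.trans_eq ?_
  congr 2
  exact expect_mul_left (w := w) t (fun η => g (U.piecewise η ω))

/-- Exponential moments of functions with bounded differences. -/
lemma avg_exp_le_of_boundedDifferences {κ : Type*} [DecidableEq κ] (hw : IsWeight w) (J : Finset κ)
    (B : κ → Finset ι) {f : (ι → V) → ℝ} {c : ℝ}
    (h : ∀ j ∈ J, ∀ ω₁ ω₂, (∀ e ∉ B j, ω₁ e = ω₂ e) → |f ω₁ - f ω₂| ≤ c) (t : ℝ) (ω : ι → V) :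
    avg w (J.biUnion B) (fun ω => Real.exp (t * f ω)) ω
      ≤ Real.exp (t * avg w (J.biUnion B) f ω + t ^ 2 * (J.card * c ^ 2) / 2) := by
  induction J using Finset.induction_on generalizing ω with
  | empty => simp [avg_empty hw]
  | insert j J hj ih =>
    have ih := ih (fun j' hj' => h j' (Finset.mem_insert_of_mem hj'))
    rw [Finset.biUnion_insert, ← avg_avg hw, ← avg_avg hw]
    have hg : ∀ ω₁ ω₂, (∀ e ∉ B j, ω₁ e = ω₂ e) →
        |avg w (J.biUnion B) f ω₁ - avg w (J.biUnion B) f ω₂| ≤ c := by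
      intro ω₁ ω₂ h12
      have h0 : ∀ η : ι → V, |f ((J.biUnion B).piecewise η ω₁) - f ((J.biUnion B).piecewise η ω₂)| ≤ c := by
        intro η
        refine h j (Finset.mem_insert_self _ _) _ _ fun e he => ?_
        by_cases he' : e ∈ J.biUnion B
        · rw [Finset.piecewise_eq_of_mem _ _ _ he', Finset.piecewise_eq_of_mem _ _ _ he']
        · rw [Finset.piecewise_eq_of_notMem _ _ _ he', Finset.piecewise_eq_of_notMem _ _ _ he',
            h12 e he]
      have key : ∀ ω₁ ω₂ : ι → V, (∀ η : ι → V, f ((J.biUnion B).piecewise η ω₁) - f ((J.biUnion B).piecewise η ω₂) ≤ c) →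
          avg w (J.biUnion B) f ω₁ - avg w (J.biUnion B) f ω₂ ≤ c := by
        intro ω₁ ω₂ h'
        have := expect_mono (w := w) hw
          (f := fun η => f ((J.biUnion B).piecewise η ω₁))
          (g := fun η => c + f ((J.biUnion B).piecewise η ω₂)) (fun η => by linarith [h' η])
        rw [expect_add, expect_const hw] at this
        unfold avg
        linarith
      rw [abs_le]
      constructor
      · have := key ω₂ ω₁ (fun η => by have := (abs_le.1 (h0 η)).1; linarith)
        linarith
      · exact key ω₁ ω₂ (fun η => (abs_le.1 (h0 η)).2)
    calc avg w (B j) (avg w (J.biUnion B) (fun ω => Real.exp (t * f ω))) ω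
        ≤ avg w (B j) (fun ω => Real.exp (t ^ 2 * (J.card * c ^ 2) / 2) *
            Real.exp (t * avg w (J.biUnion B) f ω)) ω := by
          refine avg_mono hw fun ω' _ => (ih ω').trans_eq ?_
          rw [← Real.exp_add, add_comm]
      _ ≤ Real.exp (t ^ 2 * (J.card * c ^ 2) / 2) *
            Real.exp (t * avg w (B j) (avg w (J.biUnion B) f) ω + t ^ 2 * c ^ 2 / 2) := by
          rw [avg_mul_left]
          exact mul_le_mul_of_nonneg_left (avg_exp_le hw hg t) (Real.exp_pos _).le
      _ = _ := by
          rw [← Real.exp_add, Finset.card_insert_of_notMem hj]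
          congr 1
          push_cast
          ring

/-- Markov's inequality for the exponential. -/
lemma avg_ind_le_exp (hw : IsWeight w) (U : Finset ι) {p : (ι → V) → Prop} {g : (ι → V) → ℝ}
    (ω : ι → V) (h : ∀ ω', (∀ e ∉ U, ω' e = ω e) → p ω' → 0 ≤ g ω') :
    avg w U (ind p) ω ≤ avg w U (fun ω => Real.exp (g ω)) ω := by
  refine avg_mono hw fun ω' hω' => ?_
  by_cases hp : p ω'
  · rw [ind_of hp]; exact Real.one_le_exp (h ω' hω' hp)
  · rw [ind_of_not hp]; exact (Real.exp_pos _).le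

/-- The bounded differences inequality. -/
lemma avg_ind_boundedDifferences {κ : Type*} [DecidableEq κ] (hw : IsWeight w) (J : Finset κ)
    (B : κ → Finset ι) {f : (ι → V) → ℝ} {c v t : ℝ}
    (h : ∀ j ∈ J, ∀ ω₁ ω₂, (∀ e ∉ B j, ω₁ e = ω₂ e) → |f ω₁ - f ω₂| ≤ c)
    (hv : J.card * c ^ 2 ≤ v) (hv0 : 0 < v) (ht : 0 ≤ t)
    {p : (ι → V) → Prop} (ω : ι → V)
    (hp : ∀ ω', (∀ e ∉ J.biUnion B, ω' e = ω e) → p ω' → avg w (J.biUnion B) f ω + t ≤ f ω') :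
    avg w (J.biUnion B) (ind p) ω ≤ Real.exp (- t ^ 2 / (2 * v)) := by
  set U := J.biUnion B
  set m := avg w U f ω with hm
  have htv : 0 ≤ t / v := by positivity
  refine (avg_ind_le_exp hw U (g := fun ω' => t / v * f ω' + - (t / v * (m + t))) ω
    (fun ω' h' hp' => ?_)).trans ?_
  · have := hp ω' h' hp'
    nlinarith [mul_le_mul_of_nonneg_left this htv]
  · simp_rw [Real.exp_add, mul_comm _ (Real.exp (-(t / v * (m + t))))]
    rw [avg_mul_left]
    refine (mul_le_mul_of_nonneg_left (avg_exp_le_of_boundedDifferences hw J B h _ ω)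
      (Real.exp_pos _).le).trans ?_
    rw [← Real.exp_add, Real.exp_le_exp]
    change -(t / v * (m + t)) + (t / v * m + _) ≤ _
    have : (t / v) ^ 2 * (J.card * c ^ 2) / 2 ≤ (t / v) ^ 2 * v / 2 := by gcongr
    refine (add_le_add_right (add_le_add_right this _) _).trans (le_of_eq ?_)
    field_simp
    ring

end Averaging

/-! ### The binomial distribution -/

/-- The binomial probabilities. -/
noncomputable def binPmf (r : ℕ) (q : ℝ) (m : ℕ) : ℝ := r.choose m * q ^ m * (1 - q) ^ (r - m)

/-- The expectation of `F X` for a binomial random variable `X`. -/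
noncomputable def binExp (r : ℕ) (q : ℝ) (F : ℕ → ℝ) : ℝ :=
  ∑ m ∈ Finset.range (r + 1), binPmf r q m * F m

lemma binPmf_nonneg {q : ℝ} (h0 : 0 ≤ q) (h1 : q ≤ 1) (r m : ℕ) : 0 ≤ binPmf r q m := by
  have : 0 ≤ 1 - q := by linarith
  unfold binPmf; positivity

lemma binExp_one (r : ℕ) (q : ℝ) : binExp r q (fun _ => 1) = 1 := by
  have := add_pow q (1 - q) r
  rw [add_sub_cancel, one_pow] at this
  refine Eq.trans ?_ this.symm
  rw [binExp]
  exact Finset.sum_congr rfl fun m _ => by rw [binPmf]; ring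

lemma binExp_exp (r : ℕ) (q t : ℝ) :
    binExp r q (fun m => Real.exp (t * m)) = (q * Real.exp t + (1 - q)) ^ r := by
  rw [add_pow, binExp]
  refine Finset.sum_congr rfl fun m _ => ?_
  rw [binPmf, mul_pow, mul_comm t, Real.exp_nat_mul]; ring

lemma binExp_exp_le {q : ℝ} (h0 : 0 ≤ q) (h1 : q ≤ 1) (r : ℕ) (t : ℝ) :
    binExp r q (fun m => Real.exp (t * m)) ≤ Real.exp (r * q * (Real.exp t - 1)) := by
  rw [binExp_exp, mul_assoc, Real.exp_nat_mul]
  have : 0 ≤ q * Real.exp t + (1 - q) := by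
    have := mul_nonneg h0 (Real.exp_pos t).le
    linarith
  refine pow_le_pow_left₀ this ?_ r
  have := Real.add_one_le_exp (q * (Real.exp t - 1))
  linarith

lemma binExp_variance (r : ℕ) (q : ℝ) :
    binExp r q (fun m => ((m : ℝ) - r * q) ^ 2) = r * q * (1 - q) := by
  have := congrArg (Polynomial.eval q) (bernsteinPolynomial.variance (R := ℝ) r)
  simp only [Polynomial.eval_finsetSum, bernsteinPolynomial] at this
  simp at this
  rw [← this, binExp]
  exact Finset.sum_congr rfl fun m _ => by rw [binPmf]; ring

lemma binPmf_succ (r : ℕ) (q : ℝ) (m : ℕ) :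
    binPmf (r + 1) q (m + 1) = q * binPmf r q m + (1 - q) * binPmf r q (m + 1) := by
  unfold binPmf
  rw [Nat.choose_succ_succ]
  rcases Nat.lt_or_ge m r with h | h
  · have : r - m = (r - (m + 1)) + 1 := by omega
    rw [Nat.add_sub_add_right, this]
    push_cast
    ring
  · rw [Nat.choose_eq_zero_of_lt (Nat.lt_succ_of_le h)]
    have : r - m = 0 := by omega
    rw [Nat.add_sub_add_right, this]
    push_cast
    ring

lemma binExp_succ (r : ℕ) (q : ℝ) (F : ℕ → ℝ) :
    binExp (r + 1) q F = q * binExp r q (fun m => F (m + 1)) + (1 - q) * binExp r q F := by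
  have h2 : ∑ m ∈ Finset.range (r + 1), binPmf r q (m + 1) * F (m + 1) + binPmf r q 0 * F 0
      = binExp r q F := by
    rw [← Finset.sum_range_succ' (fun m => binPmf r q m * F m), Finset.sum_range_succ, binExp]
    simp [binPmf]
  have h0 : binPmf (r + 1) q 0 = (1 - q) * binPmf r q 0 := by simp [binPmf, pow_succ]; ring
  rw [← h2, binExp, Finset.sum_range_succ', binExp, h0, mul_add, Finset.mul_sum, Finset.mul_sum,
    ← add_assoc, ← Finset.sum_add_distrib]
  congr 1
  · refine Finset.sum_congr rfl fun m _ => ?_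
    rw [binPmf_succ]; ring
  · ring

section Count

variable {ι V : Type*} [Fintype ι] [DecidableEq ι] [Fintype V] {w : V → ℝ}

open Classical in
/-- The number of coordinates in `U` with property `p`. -/
noncomputable def count (p : V → Prop) (U : Finset ι) (ω : ι → V) : ℕ :=
  (U.filter (fun e => p (ω e))).card

lemma count_congr {p : V → Prop} {U : Finset ι} {ω ω' : ι → V} (h : ∀ e ∈ U, ω' e = ω e) :
    count p U ω' = count p U ω := by
  classical
  unfold count
  rw [Finset.filter_congr fun e he => by rw [h e he]]

lemma expect_coord (hw : IsWeight w) (e : ι) (h : V → ℝ) :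
    expect w (fun η : ι → V => h (η e)) = ∑ v, w v * h v := by
  classical
  let g : V → ι → V → ℝ := fun v e' u => if e' = e then (if u = v then w u else 0) else w u
  have h1 : ∀ η : ι → V, (∏ e, w (η e)) * h (η e) = ∑ v, h v * ∏ e', g v e' (η e') := by
    intro η
    have h2 : ∀ v, v ≠ η e → h v * ∏ e', g v e' (η e') = 0 := by
      intro v hv
      rw [Finset.prod_eq_zero (Finset.mem_univ e), mul_zero]
      simp [g, Ne.symm hv]
    rw [Fintype.sum_eq_single (η e) h2, mul_comm]
    congr 1
    refine Finset.prod_congr rfl fun e' _ => ?_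
    by_cases he : e' = e
    · subst he; simp [g]
    · simp [g, he]
  simp only [expect, h1]
  rw [Finset.sum_comm]
  refine Finset.sum_congr rfl fun v _ => ?_
  rw [← Finset.mul_sum, mul_comm]
  congr 1
  have h3 := (Finset.prod_univ_sum (fun _ : ι => (Finset.univ : Finset V)) (g v)).symm
  rw [Fintype.piFinset_univ] at h3
  rw [h3, Fintype.prod_eq_single e]
  · simp [g]
  · intro e' he'
    simp [g, he', hw.sum_eq]

lemma avg_coord (hw : IsWeight w) {U : Finset ι} {e : ι} (he : e ∈ U) (h : V → ℝ) (ω : ι → V) :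
    avg w U (fun η => h (η e)) ω = ∑ v, w v * h v := by
  unfold avg
  simp only [Finset.piecewise_eq_of_mem _ _ _ he]
  exact expect_coord hw e h

lemma avg_singleton (hw : IsWeight w) (e : ι) (f : (ι → V) → ℝ) (ω : ι → V) :
    avg w {e} f ω = ∑ v, w v * f (Function.update ω e v) := by
  unfold avg
  simp only [Finset.piecewise_singleton]
  exact expect_coord hw e (fun v => f (Function.update ω e v))

/-- The number of coordinates with a given property is binomial. -/
lemma avg_count (hw : IsWeight w) {p : V → Prop} {q : ℝ} (hq : ∑ v, w v * ind p v = q)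
    (U : Finset ι) (F : ℕ → ℝ) (ω : ι → V) :
    avg w U (fun ω => F (count p U ω)) ω = binExp U.card q F := by
  classical
  induction U using Finset.induction_on generalizing F with
  | empty => rw [avg_empty hw]; simp [count, binExp, binPmf]
  | insert e U he ih =>
    rw [Finset.card_insert_of_notMem he, binExp_succ, Finset.insert_eq, Finset.union_comm,
      ← avg_avg hw]
    have h1 : ∀ ω' : ι → V, avg w {e} (fun ω => F (count p (U ∪ {e}) ω)) ω'
        = q * F (count p U ω' + 1) + (1 - q) * F (count p U ω') := by
      intro ω'
      rw [avg_singleton hw]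
      have h2 : ∀ v, F (count p (U ∪ {e}) (Function.update ω' e v))
          = ind p v * F (count p U ω' + 1) + (1 - ind p v) * F (count p U ω') := by
        intro v
        have h3 : count p U (Function.update ω' e v) = count p U ω' :=
          count_congr fun e' he' => Function.update_of_ne (fun h => he (by rwa [h] at he')) _ _
        have h4 : count p (U ∪ {e}) (Function.update ω' e v)
            = count p U ω' + if p v then 1 else 0 := by
          rw [← h3]
          unfold count
          rw [Finset.filter_union, Finset.card_union_of_disjoint, Finset.filter_singleton]
          · simp only [Function.update_self]
            split_ifs <;> simp
          · exact Finset.disjoint_filter_filter (Finset.disjoint_singleton_right.2 he)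
        rw [h4]
        unfold ind
        split_ifs <;> simp
      simp only [h2]
      have h5 : ∀ v, w v * (ind p v * F (count p U ω' + 1) + (1 - ind p v) * F (count p U ω'))
          = (w v * ind p v) * F (count p U ω' + 1)
            + (w v - w v * ind p v) * F (count p U ω') := fun v => by ring
      simp only [h5]
      rw [Finset.sum_add_distrib, ← Finset.sum_mul, ← Finset.sum_mul, Finset.sum_sub_distrib, hq,
        hw.sum_eq]
    rw [avg_congr (g := fun ω' => q * F (count p U ω' + 1) + (1 - q) * F (count p U ω'))
      fun ω' _ => h1 ω', avg_add, avg_mul_left, avg_mul_left, ih (fun m => F (m + 1)), ih]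

/-- Chernoff's bound. -/
lemma avg_count_tail (hw : IsWeight w) {p : V → Prop} {q : ℝ} (hq : ∑ v, w v * ind p v = q)
    (h0 : 0 ≤ q) (h1 : q ≤ 1) (U : Finset ι) (ω : ι → V) (t x : ℝ) {P : (ι → V) → Prop}
    (hP : ∀ ω', (∀ e ∉ U, ω' e = ω e) → P ω' → x ≤ t * count p U ω') :
    avg w U (ind P) ω ≤ Real.exp (U.card * q * (Real.exp t - 1) - x) := by
  refine (avg_ind_le_exp hw U (g := fun ω' => t * count p U ω' + -x) ω fun ω' h' hP' => ?_).trans ?_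
  · have := hP ω' h' hP'; linarith
  · simp_rw [Real.exp_add, mul_comm _ (Real.exp (-x))]
    rw [avg_mul_left, avg_count hw hq U (fun m => Real.exp (t * m)), sub_eq_neg_add, Real.exp_add]
    exact mul_le_mul_of_nonneg_left (binExp_exp_le h0 h1 _ _) (Real.exp_pos _).le

end Count

lemma stdBinomial_real (k : ℕ) (q : unitInterval) {S : Set ℝ} (hS : MeasurableSet S) :
    (stdBinomial k q).real S = binExp k q
      (fun m => ind (· ∈ S) (((m : ℝ) - k * q) / Real.sqrt ((k : ℝ) * q * (1 - q)))) := by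
  classical
  have hm : Measurable (fun x : ℕ => ((x : ℝ) - k * q) / Real.sqrt ((k : ℝ) * q * (1 - q))) :=
    measurable_from_top
  rw [stdBinomial, map_measureReal_apply hm hS]
  rw [← integral_indicator_one (hm hS), integral_binomial, binExp]
  have hI : Finset.Iic k = Finset.range (k + 1) := by ext; simp
  rw [hI]
  refine Finset.sum_congr rfl fun m _ => ?_
  rw [smul_eq_mul, binPmf]
  congr 1

/-! ### Local bounds -/

lemma card_le_of_mem_Icc {s : Finset ℕ} {x y : ℝ} (hxy : x ≤ y + 1)
    (h : ∀ m ∈ s, x ≤ (m : ℝ) ∧ (m : ℝ) ≤ y) : (s.card : ℝ) ≤ y - x + 1 := by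
  rcases s.eq_empty_or_nonempty with rfl | ⟨m₀, hm₀⟩
  · simp; linarith
  have hy : 0 ≤ y := (Nat.cast_nonneg m₀).trans (h m₀ hm₀).2
  have hs : s ⊆ Finset.Icc ⌈x⌉₊ ⌊y⌋₊ := fun m hm => Finset.mem_Icc.2
    ⟨Nat.ceil_le.2 (h m hm).1, Nat.le_floor (h m hm).2⟩
  have h1 : ⌈x⌉₊ ≤ ⌊y⌋₊ := by
    have := Finset.mem_Icc.1 (hs hm₀); omega
  have h2 := Finset.card_le_card hs
  rw [Nat.card_Icc] at h2
  have h3 : (s.card : ℝ) ≤ ⌊y⌋₊ + 1 - ⌈x⌉₊ := by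
    rw [← Nat.cast_succ, ← Nat.cast_sub (by omega)]
    exact_mod_cast h2
  linarith [Nat.floor_le hy, Nat.le_ceil x]

lemma le_card_of_mem_Ico {s : Finset ℕ} {x y : ℝ} (hx : 0 ≤ x)
    (h : ∀ m : ℕ, x ≤ (m : ℝ) → (m : ℝ) < y → m ∈ s) : y - x - 1 ≤ s.card := by
  have hs : Finset.Ico ⌈x⌉₊ ⌈y⌉₊ ⊆ s := fun m hm => by
    rw [Finset.mem_Ico] at hm
    exact h m (Nat.ceil_le.1 hm.1) (Nat.lt_ceil.1 hm.2)
  have h2 := Finset.card_le_card hs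
  rw [Nat.card_Ico] at h2
  have h3 : (⌈y⌉₊ : ℝ) ≤ s.card + ⌈x⌉₊ := by
    exact_mod_cast Nat.sub_le_iff_le_add.1 h2
  linarith [Nat.ceil_lt_add_one hx, Nat.le_ceil y]

lemma binPmf_succ_mul (r : ℕ) (q : ℝ) (m : ℕ) (hm : m < r) :
    binPmf r q (m + 1) * ((m + 1) * (1 - q)) = binPmf r q m * ((r - m) * q) := by
  unfold binPmf
  have h1 : (r.choose (m + 1) : ℝ) * (m + 1) = r.choose m * (r - m) := by
    have := Nat.choose_succ_right_eq r m
    rw [← Nat.cast_sub hm.le]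
    exact_mod_cast this
  have h2 : r - m = (r - (m + 1)) + 1 := by omega
  rw [h2, pow_succ, pow_succ]
  linear_combination q ^ m * q * (1 - q) ^ (r - (m + 1)) * (1 - q) * h1

section Local

variable {r : ℕ} {q : ℝ}

lemma binPmf_ratio (h0 : 0 < q) (h1 : q ≤ 1 / 2) (hμ : 144 ≤ r * q) {m : ℕ}
    (hm : |(m : ℝ) - r * q| ≤ 3 * √(r * q)) :
    binPmf r q (m + 1) ≤ binPmf r q m * Real.exp (11 / √(r * q)) ∧
      binPmf r q m ≤ binPmf r q (m + 1) * Real.exp (11 / √(r * q)) := by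
  set s := √(r * q) with hs
  have hs2 : s * s = r * q := Real.mul_self_sqrt (by linarith)
  have hs12 : 12 ≤ s := by
    rw [hs]; exact Real.le_sqrt_of_sq_le (by linarith)
  have hr : (0 : ℝ) ≤ r := Nat.cast_nonneg r
  obtain ⟨hm1, hm2⟩ := abs_le.1 hm
  have hup : (m : ℝ) ≤ 5 / 4 * (s * s) := by nlinarith
  have hlo : 3 / 4 * (s * s) ≤ (m : ℝ) := by nlinarith
  have hmr : (m : ℝ) < r := by nlinarith
  have hmr' : m < r := by exact_mod_cast hmr
  have key := binPmf_succ_mul r q m hmr'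
  have hb0 := binPmf_nonneg h0.le (by linarith : q ≤ 1) r m
  have hb1 := binPmf_nonneg h0.le (by linarith : q ≤ 1) r (m + 1)
  have hA : 3 / 8 * (s * s) ≤ ((m : ℝ) + 1) * (1 - q) := by nlinarith
  have hB : 3 / 8 * (s * s) ≤ ((r : ℝ) - m) * q := by nlinarith
  have hs0 : 0 < s := by linarith
  have hexp : 1 + 11 / s ≤ Real.exp (11 / s) := by
    have := Real.add_one_le_exp (11 / s); linarith
  have hdiv : (3 / 8 * (s * s)) * (11 / s) = 33 / 8 * s := by field_simp; norm_num
  have h11 : 0 ≤ 11 / s := by positivity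
  constructor
  · have h2 : ((r : ℝ) - m) * q ≤ ((m : ℝ) + 1) * (1 - q) * Real.exp (11 / s) := by
      have : ((m : ℝ) + 1) * (1 - q) * (1 + 11 / s) ≤ ((m : ℝ) + 1) * (1 - q) * Real.exp (11 / s) :=
        mul_le_mul_of_nonneg_left hexp (by nlinarith)
      have h3 := mul_le_mul_of_nonneg_right hA h11
      nlinarith
    have h4 : binPmf r q (m + 1) * ((m + 1) * (1 - q))
        ≤ (binPmf r q m * Real.exp (11 / s)) * ((m + 1) * (1 - q)) := by
      rw [key]
      have := mul_le_mul_of_nonneg_left h2 hb0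
      nlinarith
    exact le_of_mul_le_mul_right h4 (by nlinarith)
  · have h2 : ((m : ℝ) + 1) * (1 - q) ≤ ((r : ℝ) - m) * q * Real.exp (11 / s) := by
      have : ((r : ℝ) - m) * q * (1 + 11 / s) ≤ ((r : ℝ) - m) * q * Real.exp (11 / s) :=
        mul_le_mul_of_nonneg_left hexp (by nlinarith)
      have h3 := mul_le_mul_of_nonneg_right hB h11
      nlinarith
    have h4 : binPmf r q m * ((r - m) * q)
        ≤ (binPmf r q (m + 1) * Real.exp (11 / s)) * ((r - m) * q) := by
      rw [← key]
      have := mul_le_mul_of_nonneg_left h2 hb1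
      nlinarith
    exact le_of_mul_le_mul_right h4 (by nlinarith)

lemma binPmf_compare_aux (h0 : 0 < q) (h1 : q ≤ 1 / 2) (hμ : 144 ≤ r * q) {m : ℕ} (k : ℕ)
    (hm : |(m : ℝ) - r * q| ≤ 3 * √(r * q)) (hk : |((m + k : ℕ) : ℝ) - r * q| ≤ 3 * √(r * q)) :
    binPmf r q (m + k) ≤ binPmf r q m * Real.exp (k * (11 / √(r * q))) ∧
      binPmf r q m ≤ binPmf r q (m + k) * Real.exp (k * (11 / √(r * q))) := by
  induction k with
  | zero => simp
  | succ k ih =>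
    have hk' : |((m + k : ℕ) : ℝ) - r * q| ≤ 3 * √(r * q) := by
      rw [abs_le] at *
      push_cast at *
      constructor <;> linarith [(Nat.cast_nonneg k : (0 : ℝ) ≤ k)]
    obtain ⟨ih1, ih2⟩ := ih hk'
    obtain ⟨s1, s2⟩ := binPmf_ratio h0 h1 hμ hk'
    have he : Real.exp (((k + 1 : ℕ) : ℝ) * (11 / √(r * q)))
        = Real.exp (k * (11 / √(r * q))) * Real.exp (11 / √(r * q)) := by
      rw [← Real.exp_add]; congr 1; push_cast; ring
    rw [he, ← mul_assoc, ← mul_assoc]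
    constructor
    · exact s1.trans (mul_le_mul_of_nonneg_right ih1 (Real.exp_pos _).le)
    · refine ih2.trans ?_
      rw [mul_right_comm]
      exact mul_le_mul_of_nonneg_right s2 (Real.exp_pos _).le

lemma binPmf_compare (h0 : 0 < q) (h1 : q ≤ 1 / 2) (hμ : 144 ≤ r * q) {m m' : ℕ}
    (hm : |(m : ℝ) - r * q| ≤ 3 * √(r * q)) (hm' : |(m' : ℝ) - r * q| ≤ 3 * √(r * q)) :
    binPmf r q m ≤ binPmf r q m' * Real.exp 66 := by
  have hs0 : 0 < √(r * q) := Real.sqrt_pos.2 (by linarith)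
  have key : ∀ m k : ℕ, |(m : ℝ) - r * q| ≤ 3 * √(r * q) → |((m + k : ℕ) : ℝ) - r * q| ≤ 3 * √(r * q) →
      Real.exp (k * (11 / √(r * q))) ≤ Real.exp 66 := by
    intro m k h1 h2
    rw [Real.exp_le_exp, ← mul_div_assoc, div_le_iff₀ hs0]
    rw [abs_le] at h1 h2
    push_cast at h2
    linarith
  have hb := fun m => binPmf_nonneg h0.le (by linarith : q ≤ 1) r m
  rcases le_total m m' with h | h
  · obtain ⟨k, rfl⟩ := Nat.exists_eq_add_of_le h
    exact (binPmf_compare_aux h0 h1 hμ k hm hm').2.trans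
      (mul_le_mul_of_nonneg_left (key m k hm hm') (hb _))
  · obtain ⟨k, rfl⟩ := Nat.exists_eq_add_of_le h
    exact (binPmf_compare_aux h0 h1 hμ k hm' hm).1.trans
      (mul_le_mul_of_nonneg_left (key m' k hm' hm) (hb _))

lemma binPmf_bounds (h0 : 0 < q) (h1 : q ≤ 1 / 2) (hμ : 144 ≤ r * q) {m : ℕ}
    (hm : |(m : ℝ) - r * q| ≤ 3 * √(r * q)) :
    binPmf r q m ≤ Real.exp 66 / √(r * q) ∧ 1 / (8 * Real.exp 66 * √(r * q)) ≤ binPmf r q m := by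
  classical
  set s := √(r * q) with hs
  have hs2 : s * s = r * q := Real.mul_self_sqrt (by linarith)
  have hs12 : 12 ≤ s := by
    rw [hs]; exact Real.le_sqrt_of_sq_le (by linarith)
  have hs0 : 0 < s := by linarith
  have hb := fun m => binPmf_nonneg h0.le (by linarith : q ≤ 1) r m
  set W := (Finset.range (r + 1)).filter (fun m : ℕ => |(m : ℝ) - r * q| ≤ 3 * s) with hW
  have hWup : (W.card : ℝ) ≤ 7 * s := by
    have := card_le_of_mem_Icc (s := W) (x := r * q - 3 * s) (y := r * q + 3 * s) (by linarith)
      (fun m hm => by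
        have := abs_le.1 (Finset.mem_filter.1 hm).2
        constructor <;> linarith)
    linarith
  have hWlo : s ≤ W.card := by
    have := le_card_of_mem_Ico (s := W) (x := r * q) (y := r * q + 3 * s) (by linarith)
      (fun m h2 h3 => by
        refine Finset.mem_filter.2 ⟨Finset.mem_range.2 ?_, abs_le.2 ⟨by linarith, by linarith⟩⟩
        have hr : (0 : ℝ) ≤ r := Nat.cast_nonneg r
        have : (m : ℝ) < r := by nlinarith
        have : m < r := by exact_mod_cast this
        omega)
    linarith
  have hsum1 : ∑ m ∈ W, binPmf r q m ≤ 1 := by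
    refine le_trans ?_ (binExp_one r q).le
    simp only [binExp, mul_one]
    exact Finset.sum_le_sum_of_subset_of_nonneg (Finset.filter_subset _ _) fun _ _ _ => hb _
  have hsum2 : 8 / 9 ≤ ∑ m ∈ W, binPmf r q m := by
    have hv := binExp_variance r q
    have h2 : ∑ m ∈ Finset.range (r + 1), binPmf r q m * (1 - ((m : ℝ) - r * q) ^ 2 / (9 * (s * s)))
        ≤ ∑ m ∈ W, binPmf r q m := by
      rw [hW, Finset.sum_filter]
      refine Finset.sum_le_sum fun m _ => ?_
      split_ifs with h
      · have : 0 ≤ ((m : ℝ) - r * q) ^ 2 / (9 * (s * s)) := by positivity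
        nlinarith [hb m]
      · have : 1 ≤ ((m : ℝ) - r * q) ^ 2 / (9 * (s * s)) := by
          rw [one_le_div (by positivity), ← sq_abs]
          nlinarith [not_le.1 h]
        nlinarith [hb m]
    have h3 : ∑ m ∈ Finset.range (r + 1), binPmf r q m * (1 - ((m : ℝ) - r * q) ^ 2 / (9 * (s * s)))
        = binExp r q (fun _ => 1) - binExp r q (fun m => ((m : ℝ) - r * q) ^ 2) / (9 * (s * s)) := by
      rw [binExp, binExp, Finset.sum_div, ← Finset.sum_sub_distrib]
      exact Finset.sum_congr rfl fun m _ => by ring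
    rw [h3, binExp_one, hv, hs2] at h2
    have : r * q * (1 - q) / (9 * (r * q)) ≤ 1 / 9 := by
      rw [div_le_div_iff₀ (by linarith) (by norm_num)]
      nlinarith
    linarith
  constructor
  · rw [le_div_iff₀ hs0]
    have h3 : binPmf r q m * W.card ≤ (∑ m ∈ W, binPmf r q m) * Real.exp 66 := by
      rw [mul_comm, ← nsmul_eq_mul, ← Finset.sum_const, Finset.sum_mul]
      exact Finset.sum_le_sum fun m' hm' => binPmf_compare h0 h1 hμ hm (Finset.mem_filter.1 hm').2
    have := mul_le_mul_of_nonneg_left hWlo (hb m)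
    nlinarith [Real.exp_pos 66]
  · rw [div_le_iff₀ (by positivity)]
    have h3 : ∑ m ∈ W, binPmf r q m ≤ W.card * (binPmf r q m * Real.exp 66) := by
      rw [← nsmul_eq_mul, ← Finset.sum_const]
      exact Finset.sum_le_sum fun m' hm' => binPmf_compare h0 h1 hμ (Finset.mem_filter.1 hm').2 hm
    have := mul_le_mul_of_nonneg_right hWup (mul_nonneg (hb m) (Real.exp_pos 66).le)
    nlinarith

lemma binExp_ind_le (h0 : 0 < q) (h1 : q ≤ 1 / 2) (hμ : 144 ≤ r * q) {x y : ℝ} (hxy : x ≤ y)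
    (hx : r * q - 3 * √(r * q) ≤ x) (hy : y ≤ r * q + 3 * √(r * q)) :
    binExp r q (ind fun m => x ≤ (m : ℝ) ∧ (m : ℝ) ≤ y)
      ≤ (y - x + 1) * (Real.exp 66 / √(r * q)) := by
  classical
  have h2 : binExp r q (ind fun m => x ≤ (m : ℝ) ∧ (m : ℝ) ≤ y)
      = ∑ m ∈ (Finset.range (r + 1)).filter (fun m : ℕ => x ≤ (m : ℝ) ∧ (m : ℝ) ≤ y), binPmf r q m := by
    rw [Finset.sum_filter, binExp]
    refine Finset.sum_congr rfl fun m _ => ?_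
    unfold ind
    split_ifs <;> simp
  rw [h2]
  refine (Finset.sum_le_card_nsmul _ _ (Real.exp 66 / √(r * q)) fun m hm => ?_).trans ?_
  · have := (Finset.mem_filter.1 hm).2
    exact (binPmf_bounds h0 h1 hμ (abs_le.2 ⟨by linarith, by linarith⟩)).1
  · rw [nsmul_eq_mul]
    refine mul_le_mul_of_nonneg_right ?_ (by positivity)
    exact card_le_of_mem_Icc (by linarith) fun m hm => (Finset.mem_filter.1 hm).2

lemma le_binExp_ind (h0 : 0 < q) (h1 : q ≤ 1 / 2) (hμ : 144 ≤ r * q) {x y : ℝ}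
    (hx : r * q - 3 * √(r * q) ≤ x) (hy : y ≤ r * q + 3 * √(r * q)) :
    (y - x - 1) * (1 / (8 * Real.exp 66 * √(r * q)))
      ≤ binExp r q (ind fun m => x ≤ (m : ℝ) ∧ (m : ℝ) < y) := by
  classical
  have h2 : binExp r q (ind fun m => x ≤ (m : ℝ) ∧ (m : ℝ) < y)
      = ∑ m ∈ (Finset.range (r + 1)).filter (fun m : ℕ => x ≤ (m : ℝ) ∧ (m : ℝ) < y), binPmf r q m := by
    rw [Finset.sum_filter, binExp]
    refine Finset.sum_congr rfl fun m _ => ?_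
    unfold ind
    split_ifs <;> simp
  have hs2 : √(r * q) * √(r * q) = r * q := Real.mul_self_sqrt (by linarith)
  have hs12 : 12 ≤ √(r * q) := Real.le_sqrt_of_sq_le (by linarith)
  rw [h2]
  refine le_trans ?_ (Finset.card_nsmul_le_sum _ _ (1 / (8 * Real.exp 66 * √(r * q))) fun m hm => ?_)
  · rw [nsmul_eq_mul]
    refine mul_le_mul_of_nonneg_right ?_ (by positivity)
    refine le_card_of_mem_Ico (by nlinarith) fun m hm1 hm2 => Finset.mem_filter.2 ⟨?_, hm1, hm2⟩
    have hr : (0 : ℝ) ≤ r := Nat.cast_nonneg r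
    have : (m : ℝ) < r := by nlinarith
    have : m < r := by exact_mod_cast this
    exact Finset.mem_range.2 (by omega)
  · have := (Finset.mem_filter.1 hm).2
    exact (binPmf_bounds h0 h1 hμ (abs_le.2 ⟨by linarith, by linarith⟩)).2

end Local

/-! ### Sums of independent vectors in `ℓ¹` -/

section Sums

variable {ι V κ : Type*} [Fintype ι] [DecidableEq ι] [Fintype V] [DecidableEq κ] {w : V → ℝ}

lemma DependsOn.sum {α : Type*} {S : Set ι} {J : Finset α} {f : α → (ι → V) → ℝ}
    (h : ∀ j ∈ J, DependsOn (f j) S) : DependsOn (fun ω => ∑ j ∈ J, f j ω) S :=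
  fun _ _ hxy => Finset.sum_congr rfl fun j hj => h j hj hxy

lemma DependsOn.comp_fun {α β : Type*} {S : Set ι} {f : (ι → V) → α} (h : DependsOn f S) (g : α → β) :
    DependsOn (fun ω => g (f ω)) S :=
  fun _ _ hxy => congrArg g (h hxy)

lemma avg_sq_le (hw : IsWeight w) (U : Finset ι) (f : (ι → V) → ℝ) (ω : ι → V) :
    avg w U f ω ^ 2 ≤ avg w U (fun ω => f ω ^ 2) ω := by
  set m := avg w U f ω
  have h1 : 0 ≤ avg w U (fun ω => (f ω - m) ^ 2) ω := avg_nonneg hw fun _ => sq_nonneg _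
  have h2 : (fun ω => (f ω - m) ^ 2) = fun ω => (f ω ^ 2 + (-2 * m) * f ω) + m ^ 2 := by
    funext ω; ring
  rw [h2, avg_add, avg_add, avg_mul_left, avg_const hw] at h1
  change 0 ≤ _ + -2 * m * m + m ^ 2 at h1
  linarith

lemma disjoint_biUnion_blocks {J : Finset κ} {B : κ → Finset ι} {j : κ} (hj : j ∉ J)
    (hB : ((insert j J : Finset κ) : Set κ).PairwiseDisjoint B) :
    Disjoint (B j : Set ι) (J.biUnion B : Set ι) := by
  rw [Finset.disjoint_coe, Finset.disjoint_biUnion_right]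
  intro i hi
  exact hB (by simp) (by simp [hi]) (fun h => hj (h ▸ hi))

lemma avg_sum_sq (hw : IsWeight w) (U : Finset ι) {J : Finset κ} {B : κ → Finset ι}
    (hB : (J : Set κ).PairwiseDisjoint B) {ζ : κ → (ι → V) → ℝ}
    (hζ : ∀ j ∈ J, DependsOn (ζ j) (B j : Set ι)) (ω : ι → V)
    (h0 : ∀ j ∈ J, avg w U (ζ j) ω = 0) :
    avg w U (fun ω => (∑ j ∈ J, ζ j ω) ^ 2) ω = ∑ j ∈ J, avg w U (fun ω => ζ j ω ^ 2) ω := by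
  induction J using Finset.induction_on with
  | empty => simpa using avg_const hw U 0 ω
  | insert j J hj ih =>
    have hd := disjoint_biUnion_blocks hj hB
    have ih := ih (hB.subset (by simp)) (fun i hi => hζ i (Finset.mem_insert_of_mem hi))
      (fun i hi => h0 i (Finset.mem_insert_of_mem hi))
    have hS : DependsOn (fun ω => ∑ i ∈ J, ζ i ω) (J.biUnion B : Set ι) :=
      DependsOn.sum fun i hi x y hxy => hζ i (Finset.mem_insert_of_mem hi)
        fun e he => hxy e (Finset.mem_coe.2 (Finset.mem_biUnion.2 ⟨i, hi, he⟩))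
    have hcross : avg w U (fun ω => ζ j ω * ∑ i ∈ J, ζ i ω) ω = 0 := by
      rw [avg_mul hw (hζ j (Finset.mem_insert_self _ _)) hS hd, h0 j (Finset.mem_insert_self _ _),
        zero_mul]
    have h2 : (fun ω => (∑ i ∈ insert j J, ζ i ω) ^ 2)
        = fun ω => (ζ j ω ^ 2 + 2 * (ζ j ω * ∑ i ∈ J, ζ i ω)) + (∑ i ∈ J, ζ i ω) ^ 2 := by
      funext ω; rw [Finset.sum_insert hj]; ring
    rw [h2, avg_add, avg_add, avg_mul_left, hcross, ih, Finset.sum_insert hj]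
    ring

lemma avg_sum_pow_four (hw : IsWeight w) (U : Finset ι) {J : Finset κ} {B : κ → Finset ι}
    (hB : (J : Set κ).PairwiseDisjoint B) {ζ : κ → (ι → V) → ℝ}
    (hζ : ∀ j ∈ J, DependsOn (ζ j) (B j : Set ι)) (ω : ι → V)
    (h0 : ∀ j ∈ J, avg w U (ζ j) ω = 0) (h1 : ∀ j ∈ J, ∀ ω, |ζ j ω| ≤ 1) :
    avg w U (fun ω => (∑ j ∈ J, ζ j ω) ^ 4) ω ≤ ∑ j ∈ J, avg w U (fun ω => ζ j ω ^ 2) ω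
      + 3 * (∑ j ∈ J, avg w U (fun ω => ζ j ω ^ 2) ω) ^ 2 := by
  induction J using Finset.induction_on with
  | empty => simpa using (avg_const hw U 0 ω).le
  | insert j J hj ih =>
    have hd := disjoint_biUnion_blocks hj hB
    have hB' : (J : Set κ).PairwiseDisjoint B := hB.subset (by simp)
    have hζ' : ∀ i ∈ J, DependsOn (ζ i) (B i : Set ι) := fun i hi => hζ i (Finset.mem_insert_of_mem hi)
    have h0' : ∀ i ∈ J, avg w U (ζ i) ω = 0 := fun i hi => h0 i (Finset.mem_insert_of_mem hi)
    have ih := ih hB' hζ' h0' (fun i hi => h1 i (Finset.mem_insert_of_mem hi))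
    have hS : DependsOn (fun ω => ∑ i ∈ J, ζ i ω) (J.biUnion B : Set ι) :=
      DependsOn.sum fun i hi x y hxy => hζ' i hi
        fun e he => hxy e (Finset.mem_coe.2 (Finset.mem_biUnion.2 ⟨i, hi, he⟩))
    have hj' := hζ j (Finset.mem_insert_self _ _)
    have hj0 := h0 j (Finset.mem_insert_self _ _)
    have hS0 : avg w U (fun ω => ∑ i ∈ J, ζ i ω) ω = 0 := by
      rw [avg_sum]; exact Finset.sum_eq_zero h0'
    have hS2 := avg_sum_sq hw U hB' hζ' ω h0'
    have c1 : avg w U (fun ω => ζ j ω * (∑ i ∈ J, ζ i ω) ^ 3) ω = 0 := by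
      rw [avg_mul hw hj' (hS.comp_fun (· ^ 3)) hd, hj0, zero_mul]
    have c2 : avg w U (fun ω => ζ j ω ^ 2 * (∑ i ∈ J, ζ i ω) ^ 2) ω
        = avg w U (fun ω => ζ j ω ^ 2) ω * ∑ i ∈ J, avg w U (fun ω => ζ i ω ^ 2) ω := by
      rw [avg_mul hw (hj'.comp_fun (· ^ 2)) (hS.comp_fun (· ^ 2)) hd, hS2]
    have c3 : avg w U (fun ω => ζ j ω ^ 3 * (∑ i ∈ J, ζ i ω)) ω = 0 := by
      rw [avg_mul hw (hj'.comp_fun (· ^ 3)) hS hd, hS0, mul_zero]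
    have c4 : avg w U (fun ω => ζ j ω ^ 4) ω ≤ avg w U (fun ω => ζ j ω ^ 2) ω :=
      avg_mono hw fun ω' _ => by
        have := h1 j (Finset.mem_insert_self _ _) ω'
        have h3 : ζ j ω' ^ 2 ≤ 1 := (sq_le_one_iff_abs_le_one _).2 this
        nlinarith [sq_nonneg (ζ j ω')]
    have h2 : (fun ω => (∑ i ∈ insert j J, ζ i ω) ^ 4)
        = fun ω => (((ζ j ω ^ 4 + 4 * (ζ j ω ^ 3 * ∑ i ∈ J, ζ i ω))
          + 6 * (ζ j ω ^ 2 * (∑ i ∈ J, ζ i ω) ^ 2)) + 4 * (ζ j ω * (∑ i ∈ J, ζ i ω) ^ 3))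
          + (∑ i ∈ J, ζ i ω) ^ 4 := by
      funext ω; rw [Finset.sum_insert hj]; ring
    rw [h2, avg_add, avg_add, avg_add, avg_add, avg_mul_left, avg_mul_left, avg_mul_left, c1, c2, c3,
      Finset.sum_insert hj]
    nlinarith [sq_nonneg (avg w U (fun ω => ζ j ω ^ 2) ω)]

lemma sub_le_abs_of_pos {x M : ℝ} (hM : 0 < M) : x ^ 2 / M - x ^ 4 / (4 * M ^ 3) ≤ |x| := by
  have h : x ^ 2 / M - x ^ 4 / (4 * M ^ 3) = M * ((|x| / M) ^ 2 - (|x| / M) ^ 4 / 4) := by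
    have h4 : |x| ^ 4 = x ^ 4 := by rw [show 4 = 2 * 2 by norm_num, pow_mul, pow_mul, sq_abs]
    rw [div_pow, div_pow, sq_abs, h4]; field_simp
  have hu : 0 ≤ |x| / M := by positivity
  have hx : |x| = M * (|x| / M) := by field_simp
  rw [h]
  nth_rewrite 3 [hx]
  refine mul_le_mul_of_nonneg_left ?_ hM.le
  set u := |x| / M
  nlinarith [mul_nonneg hu (mul_nonneg (by linarith : 0 ≤ u + 4) (sq_nonneg (u - 1))),
    mul_nonneg hu (sq_nonneg (u - 1)), mul_nonneg hu (mul_nonneg hu (sq_nonneg (u - 1))),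
    mul_nonneg hu (sq_nonneg (u - 2))]

/-- Anticoncentration in mean for sums of independent bounded variables. -/
lemma sqrt_le_avg_abs (hw : IsWeight w) (U : Finset ι) {J : Finset κ} {B : κ → Finset ι}
    (hB : (J : Set κ).PairwiseDisjoint B) {Y : κ → (ι → V) → ℝ}
    (hY : ∀ j ∈ J, DependsOn (Y j) (B j : Set ι)) (h1 : ∀ j ∈ J, ∀ ω, Y j ω = 0 ∨ Y j ω = 1)
    (ω : ι → V) (t : ℝ) {v : ℝ} (hv1 : 1 ≤ v)
    (hv : v ≤ ∑ j ∈ J, avg w U (Y j) ω * (1 - avg w U (Y j) ω)) :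
    √v / 8 ≤ avg w U (fun ω => |∑ j ∈ J, Y j ω - t|) ω := by
  set p := fun j => avg w U (Y j) ω with hp
  set ζ : κ → (ι → V) → ℝ := fun j ω' => Y j ω' - p j with hζdef
  have hp0 : ∀ j ∈ J, 0 ≤ p j := fun j hj => avg_nonneg hw fun ω' => by
    rcases h1 j hj ω' with h | h <;> rw [h] <;> norm_num
  have hp1 : ∀ j ∈ J, p j ≤ 1 := fun j hj => avg_le_const hw fun ω' _ => by
    rcases h1 j hj ω' with h | h <;> rw [h] <;> norm_num
  have hζ : ∀ j ∈ J, DependsOn (ζ j) (B j : Set ι) := fun j hj => (hY j hj).comp_fun (· - p j)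
  have hζ0 : ∀ j ∈ J, avg w U (ζ j) ω = 0 := fun j _ => by
    simp only [hζdef]; rw [avg_sub, avg_const hw]; simp [hp]
  have hζ1 : ∀ j ∈ J, ∀ ω, |ζ j ω| ≤ 1 := fun j hj ω' => by
    have := hp0 j hj
    have := hp1 j hj
    simp only [hζdef]
    rcases h1 j hj ω' with h | h <;> rw [h, abs_le] <;> constructor <;> linarith
  have hζ2 : ∀ j ∈ J, avg w U (fun ω => ζ j ω ^ 2) ω = p j * (1 - p j) := fun j hj => by
    have : avg w U (fun ω => ζ j ω ^ 2) ω
        = avg w U (fun ω => (1 - 2 * p j) * Y j ω + p j ^ 2) ω := avg_congr fun ω' _ => by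
      simp only [hζdef]
      rcases h1 j hj ω' with h | h <;> rw [h] <;> ring
    rw [this, avg_add, avg_mul_left, avg_const hw]
    simp only [hp]; ring
  set S := ∑ j ∈ J, avg w U (fun ω => ζ j ω ^ 2) ω with hS
  have hvS : v ≤ S := by rw [hS, Finset.sum_congr rfl hζ2]; exact hv
  have hm2 := avg_sum_sq hw U hB hζ ω hζ0
  have hm4 := avg_sum_pow_four hw U hB hζ ω hζ0 hζ1
  have hm1 : avg w U (fun ω => ∑ j ∈ J, ζ j ω) ω = 0 := by
    rw [avg_sum]; exact Finset.sum_eq_zero hζ0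
  rw [← hS] at hm2 hm4
  set s := ∑ j ∈ J, p j - t with hs
  set A := S + s ^ 2 with hA
  have hA1 : 1 ≤ A := by nlinarith [sq_nonneg s]
  have hX : ∀ ω', ∑ j ∈ J, Y j ω' - t = ∑ j ∈ J, ζ j ω' + s := fun ω' => by
    simp only [hζdef, Finset.sum_sub_distrib, hs]; ring
  have hsA : √A * √A = A := Real.mul_self_sqrt (by linarith)
  have hsA0 : 0 < √A := Real.sqrt_pos.2 (by linarith)
  set M := 4 * √A with hM
  have hM0 : 0 < M := by positivity
  have e2 : avg w U (fun ω => (∑ j ∈ J, Y j ω - t) ^ 2) ω = A := by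
    have : (fun ω => (∑ j ∈ J, Y j ω - t) ^ 2)
        = fun ω => ((∑ j ∈ J, ζ j ω) ^ 2 + (2 * s) * ∑ j ∈ J, ζ j ω) + s ^ 2 := by
      funext ω'; rw [hX]; ring
    rw [this, avg_add, avg_add, avg_mul_left, hm2, hm1, avg_const hw]; ring
  have e4 : avg w U (fun ω => (∑ j ∈ J, Y j ω - t) ^ 4) ω ≤ 32 * A ^ 2 := by
    have h3 : avg w U (fun ω => (∑ j ∈ J, Y j ω - t) ^ 4) ω
        ≤ avg w U (fun ω => 8 * (∑ j ∈ J, ζ j ω) ^ 4 + 8 * s ^ 4) ω := avg_mono hw fun ω' _ => by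
      rw [hX]
      generalize ∑ j ∈ J, ζ j ω' = y
      have h5 : (y + s) ^ 2 ≤ 2 * (y ^ 2 + s ^ 2) := by nlinarith [sq_nonneg (y - s)]
      have h6 : ((y + s) ^ 2) ^ 2 ≤ (2 * (y ^ 2 + s ^ 2)) ^ 2 :=
        pow_le_pow_left₀ (sq_nonneg _) h5 2
      nlinarith [sq_nonneg (y ^ 2 - s ^ 2)]
    rw [avg_add, avg_mul_left, avg_const hw] at h3
    have hSS : S ≤ S ^ 2 := by nlinarith
    nlinarith [sq_nonneg s, mul_nonneg (by linarith : 0 ≤ S) (sq_nonneg s)]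
  have e1 : A / M - 32 * A ^ 2 / (4 * M ^ 3) ≤ avg w U (fun ω => |∑ j ∈ J, Y j ω - t|) ω := by
    have h3 := avg_mono hw (w := w) (U := U) (ω := ω)
      (f := fun ω => (1 / M) * (∑ j ∈ J, Y j ω - t) ^ 2 - (1 / (4 * M ^ 3)) * (∑ j ∈ J, Y j ω - t) ^ 4)
      (g := fun ω => |∑ j ∈ J, Y j ω - t|) (fun ω' _ => by
        have := sub_le_abs_of_pos (x := ∑ j ∈ J, Y j ω' - t) hM0
        rw [one_div_mul_eq_div, one_div_mul_eq_div]; exact this)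
    rw [avg_sub, avg_mul_left, avg_mul_left, e2] at h3
    refine le_trans ?_ h3
    rw [one_div_mul_eq_div, one_div_mul_eq_div]
    gcongr
  refine le_trans ?_ e1
  have h4 : A / M - 32 * A ^ 2 / (4 * M ^ 3) = √A / 8 := by
    rw [hM]
    nth_rewrite 1 3 [← hsA]
    field_simp
    ring
  rw [h4]
  have : √v ≤ √A := Real.sqrt_le_sqrt (by nlinarith [sq_nonneg s])
  linarith

lemma abs_sum_abs_sub_le {L : ℕ} (x y : Fin L → ℝ) :
    |(∑ l, |x l|) - (∑ l, |y l|)| ≤ ∑ l, |x l - y l| := by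
  rw [← Finset.sum_sub_distrib]
  exact (Finset.abs_sum_le_sum_abs _ _).trans (Finset.sum_le_sum fun l _ => abs_abs_sub_abs_le _ _)

lemma sum_sub_sum_of_agree {J : Finset κ} {B : κ → Finset ι}
    (hB : (J : Set κ).PairwiseDisjoint B) {ζ : κ → (ι → V) → ℝ}
    (hζ : ∀ j ∈ J, DependsOn (ζ j) (B j : Set ι)) {j : κ} (hj : j ∈ J) {ω₁ ω₂ : ι → V}
    (h : ∀ e ∉ B j, ω₁ e = ω₂ e) : ∑ i ∈ J, ζ i ω₁ - ∑ i ∈ J, ζ i ω₂ = ζ j ω₁ - ζ j ω₂ := by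
  rw [← Finset.sum_sub_distrib]
  refine Finset.sum_eq_single_of_mem j hj fun i hi hij => ?_
  rw [sub_eq_zero]
  exact hζ i hi fun e he => h e fun he' =>
    Finset.disjoint_left.1 (hB (Finset.mem_coe.2 hi) (Finset.mem_coe.2 hj) hij) he he'

/-- Upper tail of the `ℓ¹` norm of a sum of centered independent vectors. -/
lemma avg_ind_le_of_sum_abs (hw : IsWeight w) {L : ℕ} {J : Finset κ} {B : κ → Finset ι}
    (hB : (J : Set κ).PairwiseDisjoint B) {ζ : κ → Fin L → (ι → V) → ℝ}
    (hζ : ∀ j ∈ J, ∀ l, DependsOn (ζ j l) (B j : Set ι)) (ω : ι → V)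
    (h0 : ∀ j ∈ J, ∀ l, avg w (J.biUnion B) (ζ j l) ω = 0) {v c S s t : ℝ}
    (hv : ∀ j ∈ J, ∑ l, avg w (J.biUnion B) (fun ω => ζ j l ω ^ 2) ω ≤ v)
    (hc : ∀ j ∈ J, ∀ ω₁ ω₂, ∑ l, |ζ j l ω₁ - ζ j l ω₂| ≤ c)
    (hs : L * (J.card * v) ≤ s ^ 2) (hs0 : 0 ≤ s)
    (hS : J.card * c ^ 2 ≤ S) (hS0 : 0 < S) (ht : 0 ≤ t)
    {P : (ι → V) → Prop} (hP : ∀ ω', P ω' → s + t ≤ ∑ l, |∑ j ∈ J, ζ j l ω'|) :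
    avg w (J.biUnion B) (ind P) ω ≤ Real.exp (-t ^ 2 / (2 * S)) := by
  set U := J.biUnion B with hU
  have hm : avg w U (fun ω => ∑ l, |∑ j ∈ J, ζ j l ω|) ω ≤ s := by
    refine abs_le_of_sq_le_sq' ?_ hs0 |>.2
    refine (avg_sq_le hw _ _ _).trans (le_trans ?_ hs)
    have h1 : avg w U (fun ω => (∑ l, |∑ j ∈ J, ζ j l ω|) ^ 2) ω
        ≤ avg w U (fun ω => L * ∑ l, (∑ j ∈ J, ζ j l ω) ^ 2) ω := avg_mono hw fun ω' _ => by
      have := sq_sum_le_card_mul_sum_sq (s := (Finset.univ : Finset (Fin L)))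
        (f := fun l => |∑ j ∈ J, ζ j l ω'|)
      simpa [sq_abs] using this
    refine h1.trans ?_
    rw [avg_mul_left, avg_sum]
    refine mul_le_mul_of_nonneg_left ?_ (Nat.cast_nonneg _)
    have h2 : ∀ l, avg w U (fun ω => (∑ j ∈ J, ζ j l ω) ^ 2) ω
        = ∑ j ∈ J, avg w U (fun ω => ζ j l ω ^ 2) ω := fun l =>
      avg_sum_sq hw U hB (fun j hj => hζ j hj l) ω (fun j hj => h0 j hj l)
    simp only [h2]
    rw [Finset.sum_comm, ← nsmul_eq_mul]
    exact Finset.sum_le_card_nsmul _ _ _ hv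
  refine avg_ind_boundedDifferences hw J B (f := fun ω => ∑ l, |∑ j ∈ J, ζ j l ω|) (c := c)
    (fun j hj ω₁ ω₂ h => ?_) hS hS0 ht ω (fun ω' _ hp => ?_)
  · refine (abs_sum_abs_sub_le _ _).trans ?_
    have h3 : ∀ l, ∑ i ∈ J, ζ i l ω₁ - ∑ i ∈ J, ζ i l ω₂ = ζ j l ω₁ - ζ j l ω₂ := fun l =>
      sum_sub_sum_of_agree hB (fun i hi => hζ i hi l) hj h
    simp only [h3]
    exact hc j hj ω₁ ω₂
  · have := hP ω' hp
    linarith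

/-- Lower tail of the `ℓ¹` norm of a sum of independent vectors of indicators. -/
lemma avg_ind_le_of_sum_abs_sub (hw : IsWeight w) {L : ℕ} {J : Finset κ} {B : κ → Finset ι}
    (hB : (J : Set κ).PairwiseDisjoint B) {Y : κ → Fin L → (ι → V) → ℝ}
    (hY : ∀ j ∈ J, ∀ l, DependsOn (Y j l) (B j : Set ι))
    (h1 : ∀ j ∈ J, ∀ l ω, Y j l ω = 0 ∨ Y j l ω = 1) (hsum : ∀ j ∈ J, ∀ ω, ∑ l, Y j l ω ≤ 1)
    (ω : ι → V) (t : Fin L → ℝ) {v S : ℝ} (hv1 : 1 ≤ v)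
    (hv : ∀ l, v ≤ ∑ j ∈ J, avg w (J.biUnion B) (Y j l) ω * (1 - avg w (J.biUnion B) (Y j l) ω))
    (hS : J.card * 2 ^ 2 ≤ S) (hS0 : 0 < S)
    {P : (ι → V) → Prop} (hP : ∀ ω', (∀ e ∉ J.biUnion B, ω' e = ω e) →
      P ω' → ∑ l, |∑ j ∈ J, Y j l ω' - t l| ≤ L * √v / 16) :
    avg w (J.biUnion B) (ind P) ω ≤ Real.exp (-(L * √v / 16) ^ 2 / (2 * S)) := by
  set U := J.biUnion B with hU
  have hm : L * √v / 8 ≤ avg w U (fun ω => ∑ l, |∑ j ∈ J, Y j l ω - t l|) ω := by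
    rw [avg_sum]
    have := Finset.card_nsmul_le_sum (Finset.univ : Finset (Fin L))
      (fun l => avg w U (fun ω => |∑ j ∈ J, Y j l ω - t l|) ω) (√v / 8)
      (fun l _ => sqrt_le_avg_abs hw U hB (fun j hj => hY j hj l) (fun j hj => h1 j hj l) ω (t l) hv1 (hv l))
    rw [Finset.card_univ, Fintype.card_fin, nsmul_eq_mul, ← mul_div_assoc] at this
    exact this
  refine avg_ind_boundedDifferences hw J B (f := fun ω => -∑ l, |∑ j ∈ J, Y j l ω - t l|) (c := 2)
    (fun j hj ω₁ ω₂ h => ?_) hS hS0 (by positivity) ω (fun ω' h' hp => ?_)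
  · rw [neg_sub_neg, abs_sub_comm]
    refine (abs_sum_abs_sub_le _ _).trans ?_
    have h3 : ∀ l, (∑ i ∈ J, Y i l ω₁ - t l) - (∑ i ∈ J, Y i l ω₂ - t l) = Y j l ω₁ - Y j l ω₂ := fun l => by
      rw [sub_sub_sub_cancel_right]
      exact sum_sub_sum_of_agree hB (fun i hi => hY i hi l) hj h
    simp only [h3]
    have h4 : ∀ l, |Y j l ω₁ - Y j l ω₂| ≤ Y j l ω₁ + Y j l ω₂ := fun l => by
      rcases h1 j hj l ω₁ with h | h <;> rcases h1 j hj l ω₂ with h' | h' <;> rw [h, h'] <;> norm_num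
    refine (Finset.sum_le_sum fun l _ => h4 l).trans ?_
    rw [Finset.sum_add_distrib]
    linarith [hsum j hj ω₁, hsum j hj ω₂]
  · rw [avg_neg]
    have := hP ω' h' hp
    linarith

end Sums

/-! ### Bins -/

lemma measurableSet_bin (L : ℕ) (l : Fin L) : MeasurableSet (bin L l) := by
  unfold bin; split_ifs <;> measurability

lemma bin_subset {L : ℕ} {l : Fin L} {x : ℝ} (h : x ∈ bin L l) :
    -1 / 2 + (l : ℝ) / L ≤ x ∧ x ≤ -1 / 2 + ((l : ℝ) + 1) / L := by
  have hL : (0 : ℝ) < L := by have := l.pos; exact_mod_cast this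
  unfold bin at h
  split_ifs at h with hl
  · have : ((l : ℝ) + 1) / L = 1 := by rw [div_eq_one_iff_eq hL.ne']; exact_mod_cast hl
    rw [this]
    exact ⟨h.1, by linarith [h.2]⟩
  · exact ⟨h.1, h.2.le⟩

lemma mem_bin_of {L : ℕ} {l : Fin L} {x : ℝ} (h1 : -1 / 2 + (l : ℝ) / L ≤ x)
    (h2 : x < -1 / 2 + ((l : ℝ) + 1) / L) : x ∈ bin L l := by
  have hL : (0 : ℝ) < L := by have := l.pos; exact_mod_cast this
  unfold bin
  split_ifs with hl
  · have : ((l : ℝ) + 1) / L = 1 := by rw [div_eq_one_iff_eq hL.ne']; exact_mod_cast hl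
    rw [this] at h2
    exact ⟨h1, by linarith⟩
  · exact ⟨h1, h2⟩

lemma bin_unique {L : ℕ} {l l' : Fin L} {x : ℝ} (h : x ∈ bin L l) (h' : x ∈ bin L l') : l = l' := by
  have hL : (0 : ℝ) < L := by have := l.pos; exact_mod_cast this
  have key : ∀ l l' : Fin L, x ∈ bin L l → x ∈ bin L l' → ¬ l < l' := by
    intro l l' h h' hlt
    have h1 : ((l : ℕ) : ℝ) + 1 ≤ (l' : ℕ) := by exact_mod_cast hlt
    have hne : ¬ ((l : ℕ) + 1 = L) := by have := l'.2; have : (l : ℕ) < l' := hlt; omega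
    unfold bin at h
    rw [if_neg hne] at h
    have h2 := (bin_subset h').1
    have h3 := h.2
    have : ((l : ℝ) + 1) / L ≤ (l' : ℝ) / L := by gcongr
    linarith
  exact le_antisymm (not_lt.1 (key l' l h' h)) (not_lt.1 (key l l' h h'))

lemma sum_ind_bin_le_one (L : ℕ) (x : ℝ) : ∑ l, ind (· ∈ bin L l) x ≤ 1 := by
  by_cases h : ∃ l, x ∈ bin L l
  · obtain ⟨l, hl⟩ := h
    rw [Fintype.sum_eq_single l]
    · exact ind_le_one _ _
    · exact fun l' hl' => ind_of_not fun h' => hl' (bin_unique h' hl)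
  · rw [Finset.sum_eq_zero]
    · norm_num
    · exact fun l _ => ind_of_not fun h' => h ⟨l, h'⟩

/-- Points in different bins are far apart or close to the end point of a bin. -/
lemma far_or_near_of_bin {L : ℕ} {x y r : ℝ} {l : Fin L} (h : ¬ (x ∈ bin L l ↔ y ∈ bin L l)) :
    r ≤ |x - y| ∨ ∃ t ∈ Finset.range (L + 1), |x - (-1 / 2 + (t : ℝ) / L)| ≤ r := by
  by_contra! hcon
  obtain ⟨h1, h2⟩ := hcon
  have hl := l.2
  have e1 := h2 l (Finset.mem_range.2 (by omega))
  have e2 := h2 (l + 1) (Finset.mem_range.2 (by omega))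
  push_cast at e2
  have h3 := abs_lt.1 h1
  apply h
  constructor
  · intro hx
    obtain ⟨a1, a2⟩ := bin_subset hx
    rw [abs_of_nonneg (by linarith)] at e1
    rw [abs_of_nonpos (by linarith)] at e2
    exact mem_bin_of (by linarith) (by linarith)
  · intro hy
    obtain ⟨a1, a2⟩ := bin_subset hy
    refine mem_bin_of ?_ ?_
    · by_contra! hlt
      rw [abs_of_neg (by linarith)] at e1
      linarith
    · by_contra! hlt
      rw [abs_of_nonneg (by linarith)] at e2
      linarith

/-! ### Random graphs and degree profiles -/

section Model

variable {n : ℕ} {V : Type*} [Fintype V]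

/-- The graph of the pairs whose coordinate has the property `p`. -/
def rgraph (p : V → Prop) (ω : Sym2 (Fin n) → V) : SimpleGraph (Fin n) where
  Adj i j := i ≠ j ∧ p (ω s(i, j))
  symm := ⟨fun i j h => ⟨h.1.symm, by rw [Sym2.eq_swap]; exact h.2⟩⟩
  loopless := ⟨fun _ h => h.1 rfl⟩

/-- The pairs consisting of `j` and an element of `C`. -/
def edgesTo (j : Fin n) (C : Finset (Fin n)) : Finset (Sym2 (Fin n)) := C.image (fun x => s(j, x))

lemma mem_edgesTo {j : Fin n} {C : Finset (Fin n)} {e : Sym2 (Fin n)} :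
    e ∈ edgesTo j C ↔ ∃ x ∈ C, s(j, x) = e := Finset.mem_image

lemma sym2_right_injective (j : Fin n) : Function.Injective (fun x => s(j, x)) := by
  intro x y h
  rcases Sym2.eq_iff.1 h with ⟨_, h⟩ | ⟨h, h'⟩
  · exact h
  · rw [h', h]

lemma card_edgesTo (j : Fin n) (C : Finset (Fin n)) : (edgesTo j C).card = C.card :=
  Finset.card_image_of_injective _ (sym2_right_injective j)

lemma edgesTo_mono (j : Fin n) {C D : Finset (Fin n)} (h : C ⊆ D) : edgesTo j C ⊆ edgesTo j D :=
  Finset.image_subset_image h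

lemma pairwiseDisjoint_edgesTo {J C : Finset (Fin n)} (h : Disjoint J C) :
    (J : Set (Fin n)).PairwiseDisjoint (fun j => edgesTo j C) := by
  intro j hj j' hj' hne
  rw [Function.onFun, Finset.disjoint_left]
  intro e he he'
  obtain ⟨x, hx, rfl⟩ := mem_edgesTo.1 he
  obtain ⟨x', hx', he'⟩ := mem_edgesTo.1 he'
  rcases Sym2.eq_iff.1 he' with ⟨h1, _⟩ | ⟨_, h2⟩
  · exact hne h1.symm
  · subst h2
    exact Finset.disjoint_left.1 h (Finset.mem_coe.1 hj) hx'

lemma mem_nbrs {G : SimpleGraph (Fin n)} {i j : Fin n} : j ∈ nbrs G i ↔ G.Adj i j := by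
  simp [nbrs]

lemma not_mem_nbrs_self (G : SimpleGraph (Fin n)) (i : Fin n) : i ∉ nbrs G i := by
  simp [mem_nbrs]

/-- The standardized number of pairs in `edgesTo j C` with property `p`. -/
noncomputable def stdCount (p : V → Prop) (q : ℝ) (C : Finset (Fin n)) (j : Fin n)
    (ω : Sym2 (Fin n) → V) : ℝ :=
  ((count p (edgesTo j C) ω : ℝ) - C.card * q) / √(C.card * q * (1 - q))

/-- The probability that a standardized binomial variable is in a bin. -/
noncomputable def binProb (k : ℕ) (q : ℝ) (L : ℕ) (l : Fin L) : ℝ :=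
  binExp k q (fun m => ind (· ∈ bin L l) (((m : ℝ) - k * q) / √((k : ℝ) * q * (1 - q))))

lemma card_compl_insert_nbrs (G : SimpleGraph (Fin n)) (i : Fin n) :
    (insert i (nbrs G i))ᶜ.card = n - deg G i - 1 := by
  rw [Finset.card_compl, Fintype.card_fin, Finset.card_insert_of_notMem (not_mem_nbrs_self G i), deg]
  omega

lemma deg_lt (G : SimpleGraph (Fin n)) (i : Fin n) : deg G i + 1 ≤ n := by
  have := Finset.card_le_univ (insert i (nbrs G i))
  rwa [Finset.card_insert_of_notMem (not_mem_nbrs_self G i), Fintype.card_fin] at this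

open Classical in
lemma stdOutdeg_eq (G : SimpleGraph (Fin n)) (q : unitInterval) (i j : Fin n) :
    stdOutdeg G q i j = ((((insert i (nbrs G i))ᶜ.filter (fun l => G.Adj l j)).card : ℝ)
      - (n - deg G i - 1 : ℕ) * q) / √((n - deg G i - 1 : ℕ) * q * (1 - q)) := by
  have h1 : ((n - deg G i - 1 : ℕ) : ℝ) = (n : ℝ) - deg G i - 1 := by
    have := deg_lt G i
    rw [Nat.sub_sub, Nat.cast_sub this]; push_cast; ring
  rw [stdOutdeg, ← h1, Finset.sum_sub_distrib, Finset.sum_const, card_compl_insert_nbrs,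
    Finset.sum_boole, nsmul_eq_mul, one_div_mul_eq_div]

lemma stdOutdeg_rgraph (p : V → Prop) (ω : Sym2 (Fin n) → V) (q : unitInterval) (i j : Fin n)
    (hj : j ∈ nbrs (rgraph p ω) i) :
    stdOutdeg (rgraph p ω) q i j = stdCount p q (insert i (nbrs (rgraph p ω) i))ᶜ j ω := by
  classical
  rw [stdOutdeg_eq, stdCount, card_compl_insert_nbrs]
  congr 3
  rw [count, edgesTo, Finset.filter_image, Finset.card_image_of_injective _ (sym2_right_injective j)]
  congr 1
  ext x
  simp only [Finset.mem_filter]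
  refine and_congr_right fun hx => ?_
  have hne : x ≠ j := by
    rintro rfl
    exact (Finset.mem_compl.1 hx) (Finset.mem_insert_of_mem hj)
  simp only [rgraph]
  rw [Sym2.eq_swap]
  exact ⟨fun h => h.2, fun h => ⟨hne, h⟩⟩

lemma centeredProfile_apply (G : SimpleGraph (Fin n)) (q : unitInterval) (i : Fin n) {S : Set ℝ}
    (hS : MeasurableSet S) :
    centeredProfile G q i S = (1 / (deg G i : ℝ)) * ∑ j ∈ nbrs G i, ind (· ∈ S) (stdOutdeg G q i j)
      - (stdBinomial (n - deg G i - 1) q).real S := by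
  classical
  rw [centeredProfile, sub_apply, Measure.toSignedMeasure_apply_measurable hS,
    Measure.toSignedMeasure_apply_measurable hS]
  congr 1
  rw [profile, measureReal_nnreal_smul_apply]
  push_cast
  congr 1
  rw [measureReal_def, Measure.finsetSum_apply, ENNReal.toReal_sum fun _ _ => measure_ne_top _ _]
  refine Finset.sum_congr rfl fun j _ => ?_
  rw [Measure.dirac_apply' _ hS, Set.indicator_apply, ind]
  split_ifs <;> simp

lemma centeredProfile_bin (G : SimpleGraph (Fin n)) (q : unitInterval) (i : Fin n) {L : ℕ}
    (l : Fin L) (h : 0 < deg G i) :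
    centeredProfile G q i (bin L l) = (1 / (deg G i : ℝ)) * ∑ j ∈ nbrs G i,
      (ind (· ∈ bin L l) (stdOutdeg G q i j) - binProb (n - deg G i - 1) q L l) := by
  rw [centeredProfile_apply G q i (measurableSet_bin L l), Finset.sum_sub_distrib, Finset.sum_const,
    mul_sub, stdBinomial_real _ _ (measurableSet_bin L l), nsmul_eq_mul]
  congr 1
  rw [← mul_assoc]
  have : (1 / (deg G i : ℝ)) * (nbrs G i).card = 1 := by
    rw [deg] at *
    field_simp
  rw [this, one_mul, binProb]

variable {w : V → ℝ}

lemma dependsOn_stdCount (p : V → Prop) (q : ℝ) (C : Finset (Fin n)) (j : Fin n) :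
    DependsOn (stdCount p q C j : (Sym2 (Fin n) → V) → ℝ) (edgesTo j C : Set (Sym2 (Fin n))) :=
  fun ω ω' h => by
    unfold stdCount
    rw [count_congr (ω := ω) (ω' := ω') fun e he => (h e (Finset.mem_coe.2 he)).symm]

lemma avg_stdCount (hw : IsWeight w) {p : V → Prop} {q : ℝ} (hq : ∑ v, w v * ind p v = q)
    {U : Finset (Sym2 (Fin n))} {C : Finset (Fin n)} {j : Fin n} (hU : edgesTo j C ⊆ U)
    (F : ℝ → ℝ) (ω : Sym2 (Fin n) → V) :
    avg w U (fun ω => F (stdCount p q C j ω)) ω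
      = binExp C.card q (fun m => F (((m : ℝ) - C.card * q) / √(C.card * q * (1 - q)))) := by
  rw [avg_inter hw ((dependsOn_stdCount p q C j).comp_fun F) hU (fun e _ he => Finset.mem_coe.1 he)]
  have := avg_count hw hq (edgesTo j C)
    (fun m => F (((m : ℝ) - C.card * q) / √(C.card * q * (1 - q)))) ω
  rw [card_edgesTo] at this
  exact this

lemma avg_ind_stdCount (hw : IsWeight w) {p : V → Prop} {q : ℝ} (hq : ∑ v, w v * ind p v = q)
    {U : Finset (Sym2 (Fin n))} {C : Finset (Fin n)} {j : Fin n} (hU : edgesTo j C ⊆ U)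
    {L : ℕ} (l : Fin L) (ω : Sym2 (Fin n) → V) :
    avg w U (fun ω => ind (· ∈ bin L l) (stdCount p q C j ω)) ω = binProb C.card q L l :=
  avg_stdCount hw hq hU _ ω

end Model

/-! ### Correlated pairs of degree profiles -/

/-- A pair of properties `pA`, `pB` with probability `q` each, such that each of the differences
has probability `ν`. -/
structure IsPairWeight {V : Type*} [Fintype V] (w : V → ℝ) (pA pB : V → Prop) (q ν : ℝ) : Prop where
  weight : IsWeight w
  left : ∑ v, w v * ind pA v = q
  right : ∑ v, w v * ind pB v = q
  left_not_right : ∑ v, w v * ind (fun v => pA v ∧ ¬ pB v) v = ν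
  right_not_left : ∑ v, w v * ind (fun v => pB v ∧ ¬ pA v) v = ν

lemma sq_inv_sqrt_sub_le {x y m : ℝ} (hm : 0 < m) (hx : m ≤ x) (hy : m ≤ y) :
    (1 / √x - 1 / √y) ^ 2 ≤ |x - y| / m ^ 2 := by
  have hx0 : 0 < x := hm.trans_le hx
  have hy0 : 0 < y := hm.trans_le hy
  have sx : 0 < √x := Real.sqrt_pos.2 hx0
  have sy : 0 < √y := Real.sqrt_pos.2 hy0
  have ex : √x ^ 2 = x := Real.sq_sqrt hx0.le
  have ey : √y ^ 2 = y := Real.sq_sqrt hy0.le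
  have h1 : (1 / √x - 1 / √y) ^ 2 = (√x - √y) ^ 2 / (x * y) := by
    rw [← ex, ← ey, Real.sqrt_sq sx.le, Real.sqrt_sq sy.le]; field_simp; ring
  have h2 : (√x - √y) ^ 2 ≤ |x - y| := by
    have h3 : x - y = (√x - √y) * (√x + √y) := by linear_combination ey - ex
    rw [h3, abs_mul, ← sq_abs, sq]
    refine mul_le_mul_of_nonneg_left ?_ (abs_nonneg _)
    rw [abs_of_pos (a := √x + √y) (by positivity), abs_le]
    constructor <;> linarith
  rw [h1]
  have h4 : m ^ 2 ≤ x * y := by nlinarith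
  exact div_le_div₀ (abs_nonneg _) h2 (by positivity) h4

section Model

variable {n : ℕ} {V : Type*} [Fintype V] {w : V → ℝ} {pA pB : V → Prop} {q ν : ℝ}

lemma IsPairWeight.symm (h : IsPairWeight w pA pB q ν) : IsPairWeight w pB pA q ν :=
  ⟨h.weight, h.right, h.left, h.right_not_left, h.left_not_right⟩

lemma cast_count_edgesTo (p : V → Prop) (C : Finset (Fin n)) (j : Fin n) (ω : Sym2 (Fin n) → V) :
    (count p (edgesTo j C) ω : ℝ) = ∑ x ∈ C, ind p (ω s(j, x)) := by
  classical
  rw [count, edgesTo, Finset.filter_image, Finset.card_image_of_injective _ (sym2_right_injective j),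
    ← Finset.sum_boole]
  rfl

lemma avg_sq_stdCount_sub (h : IsPairWeight w pA pB q ν) (hq0 : 0 < q) (hq : q ≤ 1 / 2)
    {CA CB : Finset (Fin n)} {Δ : ℝ} (hn : 0 < n)
    (hA : (n : ℝ) / 2 ≤ CA.card) (hB : (n : ℝ) / 2 ≤ CB.card)
    (hAB : ((CA \ CB).card : ℝ) ≤ Δ) (hBA : ((CB \ CA).card : ℝ) ≤ Δ) (j : Fin n)
    {U : Finset (Sym2 (Fin n))} (hU : edgesTo j (CA ∪ CB) ⊆ U) (ω : Sym2 (Fin n) → V) :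
    avg w U (fun ω => (stdCount pA q CA j ω - stdCount pB q CB j ω) ^ 2) ω
      ≤ 16 * (ν / q) + 48 * (Δ / n) := by
  classical
  have hw := h.weight
  have hn' : (0 : ℝ) < n := by exact_mod_cast hn
  set d := (n : ℝ) * q with hd
  have hd0 : 0 < d := by positivity
  set xA := (CA.card : ℝ) * q * (1 - q) with hxA
  set xB := (CB.card : ℝ) * q * (1 - q) with hxB
  have key : ∀ k : ℝ, (n : ℝ) / 2 ≤ k → d / 4 ≤ k * q * (1 - q) := by
    intro k hk
    have h1 : (n : ℝ) / 2 * q ≤ k * q := by gcongr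
    have h2 : k * q * (1 / 2) ≤ k * q * (1 - q) :=
      mul_le_mul_of_nonneg_left (by linarith) (by nlinarith)
    rw [hd]; linarith
  have hxA4 := key _ hA
  have hxB4 := key _ hB
  have hxA0 : 0 < xA := by linarith
  have hxB0 : 0 < xB := by linarith
  have hν0 : 0 ≤ ν := by
    rw [← h.left_not_right]
    exact Finset.sum_nonneg fun v _ => mul_nonneg (hw.nonneg v) (ind_nonneg _ _)
  set cA : Fin n → ℝ := fun x => if x ∈ CA then 1 / √xA else 0 with hcA
  set cB : Fin n → ℝ := fun x => if x ∈ CB then 1 / √xB else 0 with hcB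
  set g : Fin n → V → ℝ := fun x v => cA x * (ind pA v - q) - cB x * (ind pB v - q) with hg
  have hstd : ∀ (p : V → Prop) (C : Finset (Fin n)) (ω : Sym2 (Fin n) → V), stdCount p q C j ω
      = ∑ x, (if x ∈ C then 1 / √(C.card * q * (1 - q)) else 0) * (ind p (ω s(j, x)) - q) := by
    intro p C ω
    rw [stdCount, cast_count_edgesTo]
    simp only [ite_mul, zero_mul]
    rw [Finset.sum_ite_mem, Finset.univ_inter, ← Finset.mul_sum, Finset.sum_sub_distrib,
      Finset.sum_const, nsmul_eq_mul, one_div_mul_eq_div]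
  have hdiff : ∀ ω : Sym2 (Fin n) → V, stdCount pA q CA j ω - stdCount pB q CB j ω
      = ∑ x, g x (ω s(j, x)) := by
    intro ω
    rw [hstd, hstd, ← Finset.sum_sub_distrib]
  have hind1 : ∀ (p : V → Prop), ∑ v, w v * ind p v = q → ∑ v, w v * (ind p v - q) = 0 := by
    intro p hp
    simp only [mul_sub, Finset.sum_sub_distrib, hp, ← Finset.sum_mul, hw.sum_eq]; ring
  have hg0 : ∀ x, ∑ v, w v * g x v = 0 := by
    intro x
    have : ∀ v, w v * g x v = cA x * (w v * (ind pA v - q)) - cB x * (w v * (ind pB v - q)) :=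
      fun v => by simp only [hg]; ring
    simp only [this, Finset.sum_sub_distrib, ← Finset.mul_sum, hind1 pA h.left, hind1 pB h.right]
    ring
  have hab : ∑ v, w v * (ind pA v - ind pB v) ^ 2 = 2 * ν := by
    have : ∀ v, w v * (ind pA v - ind pB v) ^ 2
        = w v * ind (fun v => pA v ∧ ¬ pB v) v + w v * ind (fun v => pB v ∧ ¬ pA v) v := by
      intro v
      rw [← mul_add]
      congr 1
      by_cases h1 : pA v <;> by_cases h2 : pB v <;> simp [ind, h1, h2]
    simp only [this, Finset.sum_add_distrib, h.left_not_right, h.right_not_left]; ring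
  have hb2 : ∑ v, w v * (ind pB v - q) ^ 2 ≤ q := by
    have : ∀ v, w v * (ind pB v - q) ^ 2 = (1 - 2 * q) * (w v * ind pB v) + q ^ 2 * w v := by
      intro v
      by_cases h2 : pB v <;> simp [ind, h2] <;> ring
    simp only [this, Finset.sum_add_distrib, ← Finset.mul_sum, h.right, hw.sum_eq]
    nlinarith
  have hcA2 : ∀ x, cA x ^ 2 ≤ 4 / d := by
    intro x
    simp only [hcA]
    split_ifs
    · rw [div_pow, Real.sq_sqrt hxA0.le, one_pow, div_le_div_iff₀ hxA0 hd0]; linarith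
    · rw [zero_pow two_ne_zero]; positivity
  have hcB2 : ∀ x, cB x ^ 2 ≤ 4 / d := by
    intro x
    simp only [hcB]
    split_ifs
    · rw [div_pow, Real.sq_sqrt hxB0.le, one_pow, div_le_div_iff₀ hxB0 hd0]; linarith
    · rw [zero_pow two_ne_zero]; positivity
  have hΔ0 : 0 ≤ Δ := (Nat.cast_nonneg _).trans hAB
  have hcard : |(CA.card : ℝ) - CB.card| ≤ Δ := by
    have e1 := Finset.card_sdiff_add_card_inter CA CB
    have e2 := Finset.card_sdiff_add_card_inter CB CA
    rw [Finset.inter_comm] at e2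
    have e1' : ((CA \ CB).card : ℝ) + (CA ∩ CB).card = CA.card := by exact_mod_cast e1
    have e2' : ((CB \ CA).card : ℝ) + (CA ∩ CB).card = CB.card := by exact_mod_cast e2
    have n1 : (0 : ℝ) ≤ (CA \ CB).card := Nat.cast_nonneg _
    have n2 : (0 : ℝ) ≤ (CB \ CA).card := Nat.cast_nonneg _
    rw [abs_le]; constructor <;> linarith
  have hcc : (1 / √xA - 1 / √xB) ^ 2 ≤ 16 * Δ * q / d ^ 2 := by
    refine (sq_inv_sqrt_sub_le (by positivity) hxA4 hxB4).trans ?_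
    have : |xA - xB| ≤ Δ * q := by
      have : xA - xB = ((CA.card : ℝ) - CB.card) * (q * (1 - q)) := by rw [hxA, hxB]; ring
      rw [this, abs_mul, abs_of_nonneg (a := q * (1 - q)) (by nlinarith)]
      exact mul_le_mul hcard (by nlinarith) (by nlinarith) hΔ0
    have h2 : 16 * Δ * q / d ^ 2 = Δ * q / (d / 4) ^ 2 := by field_simp; ring
    rw [h2]
    gcongr
  have hcAB : ∀ x, (cA x - cB x) ^ 2 ≤ 16 * Δ * q / d ^ 2 + ((if x ∈ CA \ CB then 4 / d else 0)
      + (if x ∈ CB \ CA then 4 / d else 0)) := by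
    intro x
    have h0 : 0 ≤ 16 * Δ * q / d ^ 2 := by positivity
    have h1 : 0 ≤ 4 / d := by positivity
    have eA := hcA2 x
    have eB := hcB2 x
    by_cases h1 : x ∈ CA <;> by_cases h2 : x ∈ CB <;> simp [hcA, hcB, h1, h2] at eA eB hcc ⊢ <;>
      linarith
  have hgx : ∀ x, ∑ v, w v * g x v ^ 2 ≤ 16 * ν / d + 2 * q * (cA x - cB x) ^ 2 := by
    intro x
    have h1 : ∀ v, w v * g x v ^ 2 ≤ 2 * cA x ^ 2 * (w v * (ind pA v - ind pB v) ^ 2)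
        + 2 * (cA x - cB x) ^ 2 * (w v * (ind pB v - q) ^ 2) := by
      intro v
      have : g x v = cA x * (ind pA v - ind pB v) + (cA x - cB x) * (ind pB v - q) := by
        simp only [hg]; ring
      rw [this]
      have h2 := mul_le_mul_of_nonneg_left (add_sq_le (a := cA x * (ind pA v - ind pB v))
        (b := (cA x - cB x) * (ind pB v - q))) (hw.nonneg v)
      refine h2.trans (le_of_eq ?_)
      ring
    refine (Finset.sum_le_sum fun v _ => h1 v).trans ?_
    rw [Finset.sum_add_distrib, ← Finset.mul_sum, ← Finset.mul_sum, hab]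
    have h3 : 2 * cA x ^ 2 * (2 * ν) ≤ 16 * ν / d := by
      have := mul_le_mul_of_nonneg_right (hcA2 x) (by linarith : 0 ≤ 4 * ν)
      calc _ = cA x ^ 2 * (4 * ν) := by ring
        _ ≤ 4 / d * (4 * ν) := this
        _ = _ := by ring
    have h4 := mul_le_mul_of_nonneg_left hb2 (by positivity : 0 ≤ 2 * (cA x - cB x) ^ 2)
    linarith
  have hsumsq := avg_sum_sq (κ := Fin n) hw U (J := CA ∪ CB) (B := fun x => {s(j, x)})
    (fun x _ y _ hxy => Finset.disjoint_singleton.2 fun h => hxy (sym2_right_injective j h))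
    (ζ := fun x ω => g x (ω s(j, x)))
    (fun x _ ω ω' h => by
      have : ω s(j, x) = ω' s(j, x) := h _ (by simp)
      simp only [this]) ω
    (fun x hx => by
      rw [avg_coord hw (hU (mem_edgesTo.2 ⟨x, hx, rfl⟩)) (g x)]
      exact hg0 x)
  have hrestr : ∀ ω : Sym2 (Fin n) → V, ∑ x, g x (ω s(j, x)) = ∑ x ∈ CA ∪ CB, g x (ω s(j, x)) := by
    intro ω
    refine (Finset.sum_subset (Finset.subset_univ _) fun x _ hx => ?_).symm
    rw [Finset.mem_union, not_or] at hx
    simp [hg, hcA, hcB, hx.1, hx.2]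
  simp only [hdiff, hrestr]
  rw [hsumsq]
  have hterm : ∀ x ∈ CA ∪ CB, avg w U (fun ω => g x (ω s(j, x)) ^ 2) ω
      ≤ 16 * ν / d + 2 * q * (cA x - cB x) ^ 2 := fun x hx => by
    rw [avg_coord hw (hU (mem_edgesTo.2 ⟨x, hx, rfl⟩)) (fun v => g x v ^ 2)]
    exact hgx x
  refine (Finset.sum_le_sum hterm).trans ?_
  have h5 : ∑ x ∈ CA ∪ CB, (16 * ν / d + 2 * q * (cA x - cB x) ^ 2)
      ≤ ∑ x : Fin n, (16 * ν / d + 2 * q * (16 * Δ * q / d ^ 2 + ((if x ∈ CA \ CB then 4 / d else 0)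
      + (if x ∈ CB \ CA then 4 / d else 0)))) := by
    refine (Finset.sum_le_sum_of_subset_of_nonneg (Finset.subset_univ _) fun x _ _ => ?_).trans
      (Finset.sum_le_sum fun x _ => ?_)
    · positivity
    · have := mul_le_mul_of_nonneg_left (hcAB x) (by positivity : 0 ≤ 2 * q)
      linarith
  refine h5.trans ?_
  rw [Finset.sum_add_distrib, ← Finset.mul_sum, Finset.sum_add_distrib, Finset.sum_add_distrib,
    Finset.sum_ite_mem, Finset.sum_ite_mem]
  simp only [Finset.sum_const, Finset.card_univ, Fintype.card_fin, Finset.univ_inter, nsmul_eq_mul]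
  have e1 : (n : ℝ) * (16 * ν / d) = 16 * (ν / q) := by rw [hd]; field_simp
  have e2 : 2 * q * ((n : ℝ) * (16 * Δ * q / d ^ 2) + (Δ * (4 / d) + Δ * (4 / d))) = 48 * (Δ / n) := by
    rw [hd]; field_simp; ring
  rw [e1, ← e2]
  gcongr

/-- The standardized count is rarely close to the end point of a bin. -/
lemma binExp_near_le {k L : ℕ} {q δ : ℝ} (hq0 : 0 < q) (hq : q ≤ 1 / 2) (hk : 144 ≤ k * q)
    (hL : 1 ≤ L) (hδ0 : 0 ≤ δ) (hδ : δ ≤ 1) {t : ℕ} (ht : t ≤ L) :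
    binExp k q (fun m => ind (fun x => |x - (-1 / 2 + (t : ℝ) / L)| ≤ δ / L)
      (((m : ℝ) - k * q) / √(k * q * (1 - q)))) ≤ 2 * δ * Real.exp 66 / L + Real.exp 66 / √(k * q) := by
  have hL' : (1 : ℝ) ≤ L := by exact_mod_cast hL
  set s := √(k * q * (1 - q)) with hs
  set y := -1 / 2 + (t : ℝ) / L with hy
  have hkq : 0 < k * q := by linarith
  have hs0 : 0 < s := Real.sqrt_pos.2 (mul_pos hkq (by linarith))
  have hsk : s ≤ √(k * q) := Real.sqrt_le_sqrt (by nlinarith)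
  have hsk0 : 0 < √(k * q) := Real.sqrt_pos.2 hkq
  have hy1 : |y| ≤ 1 / 2 := by
    have h1 : (t : ℝ) / L ≤ 1 := by rw [div_le_one (by linarith)]; exact_mod_cast ht
    have h2 : 0 ≤ (t : ℝ) / L := by positivity
    rw [abs_le]; constructor <;> linarith
  have hδL : δ / L ≤ 1 := by rw [div_le_one (by linarith)]; linarith
  have hδL0 : 0 ≤ δ / L := by positivity
  have h1 : ∀ m : ℕ, ind (fun x => |x - y| ≤ δ / L) (((m : ℝ) - k * q) / s)
      = ind (fun m : ℕ => k * q + s * (y - δ / L) ≤ (m : ℝ) ∧ (m : ℝ) ≤ k * q + s * (y + δ / L)) m := by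
    intro m
    refine ind_congr ?_
    rw [abs_le]
    constructor
    · rintro ⟨a, b⟩
      have a' : y - δ / L ≤ ((m : ℝ) - k * q) / s := by linarith
      have b' : ((m : ℝ) - k * q) / s ≤ y + δ / L := by linarith
      rw [le_div_iff₀ hs0] at a'
      rw [div_le_iff₀ hs0] at b'
      constructor <;> linarith
    · rintro ⟨a, b⟩
      have a' : y - δ / L ≤ ((m : ℝ) - k * q) / s := by rw [le_div_iff₀ hs0]; linarith
      have b' : ((m : ℝ) - k * q) / s ≤ y + δ / L := by rw [div_le_iff₀ hs0]; linarith
      constructor <;> linarith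
  simp only [h1]
  obtain ⟨y1, y2⟩ := abs_le.1 hy1
  refine (binExp_ind_le hq0 hq hk (by nlinarith) (by nlinarith) (by nlinarith)).trans ?_
  have h2 : k * q + s * (y + δ / L) - (k * q + s * (y - δ / L)) + 1 = 2 * δ / L * s + 1 := by ring
  rw [h2, add_mul, one_mul]
  refine add_le_add_left ?_ _
  have h3 : 2 * δ / L * s * (Real.exp 66 / √(k * q)) = (2 * δ * Real.exp 66 / L) * (s / √(k * q)) := by
    ring
  rw [h3]
  have h4 : s / √(k * q) ≤ 1 := (div_le_one hsk0).2 hsk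
  exact mul_le_of_le_one_right (by positivity) h4

/-- Corresponding standardized counts are rarely in different bins. -/
lemma avg_ind_bin_ne (h : IsPairWeight w pA pB q ν) (hq0 : 0 < q) (hq : q ≤ 1 / 2)
    {CA CB : Finset (Fin n)} {Δ δ ε : ℝ} {L : ℕ} (hn : 0 < n) (hL : 1 ≤ L)
    (hA : (n : ℝ) / 2 ≤ CA.card) (hB : (n : ℝ) / 2 ≤ CB.card)
    (hAB : ((CA \ CB).card : ℝ) ≤ Δ) (hBA : ((CB \ CA).card : ℝ) ≤ Δ) (j : Fin n)
    {U : Finset (Sym2 (Fin n))} (hU : edgesTo j (CA ∪ CB) ⊆ U)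
    (hδ0 : 0 < δ) (hδ1 : δ ≤ 1) (hδ : 12 * Real.exp 66 * δ ≤ ε)
    (hd : 288 ≤ n * q) (hd' : 12 * Real.exp 66 * L ≤ ε * √(n * q))
    (hσ : L ^ 2 * (16 * (ν / q) + 48 * (Δ / n)) ≤ δ ^ 2 * ε / 3) (ω : Sym2 (Fin n) → V) :
    avg w U (ind fun ω => ∃ l : Fin L,
      ¬ (stdCount pA q CA j ω ∈ bin L l ↔ stdCount pB q CB j ω ∈ bin L l)) ω ≤ ε := by
  have hw := h.weight
  have hL' : (1 : ℝ) ≤ L := by exact_mod_cast hL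
  have hL0 : (0 : ℝ) < L := by linarith
  have hn' : (0 : ℝ) < n := by exact_mod_cast hn
  have hkq : (n * q) / 2 ≤ CA.card * q := by nlinarith
  set a := fun ω : Sym2 (Fin n) → V => stdCount pA q CA j ω
  set b := fun ω : Sym2 (Fin n) → V => stdCount pB q CB j ω
  have h1 : ∀ ω', ind (fun ω => ∃ l : Fin L, ¬ (a ω ∈ bin L l ↔ b ω ∈ bin L l)) ω'
      ≤ (L / δ) ^ 2 * (a ω' - b ω') ^ 2
        + ∑ t ∈ Finset.range (L + 1), ind (fun x => |x - (-1 / 2 + (t : ℝ) / L)| ≤ δ / L) (a ω') := by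
    intro ω'
    have hs : 0 ≤ ∑ t ∈ Finset.range (L + 1), ind (fun x => |x - (-1 / 2 + (t : ℝ) / L)| ≤ δ / L) (a ω') :=
      Finset.sum_nonneg fun _ _ => ind_nonneg _ _
    by_cases hp : ∃ l : Fin L, ¬ (a ω' ∈ bin L l ↔ b ω' ∈ bin L l)
    · rw [ind_of (p := fun ω => ∃ l : Fin L, ¬ (a ω ∈ bin L l ↔ b ω ∈ bin L l)) hp]
      obtain ⟨l, hl⟩ := hp
      rcases far_or_near_of_bin (r := δ / L) hl with h2 | ⟨t, ht, h2⟩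
      · have h3 : 1 ≤ (L / δ) ^ 2 * (a ω' - b ω') ^ 2 := by
          rw [← mul_pow, ← sq_abs, abs_mul, abs_of_nonneg (by positivity : (0 : ℝ) ≤ L / δ)]
          refine one_le_pow₀ ?_
          calc (1 : ℝ) = L / δ * (δ / L) := by field_simp
            _ ≤ _ := mul_le_mul_of_nonneg_left h2 (by positivity)
        linarith
      · have h3 := Finset.single_le_sum (f := fun t : ℕ => ind (fun x => |x - (-1 / 2 + (t : ℝ) / L)| ≤ δ / L) (a ω'))
          (fun _ _ => ind_nonneg _ _) ht
        have h4 : ind (fun x => |x - (-1 / 2 + (t : ℝ) / L)| ≤ δ / L) (a ω') = 1 := ind_of h2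
        simp only [h4] at h3
        have : 0 ≤ (L / δ) ^ 2 * (a ω' - b ω') ^ 2 := by positivity
        linarith
    · rw [ind_of_not (p := fun ω => ∃ l : Fin L, ¬ (a ω ∈ bin L l ↔ b ω ∈ bin L l)) hp]
      positivity
  refine (avg_mono hw fun ω' _ => h1 ω').trans ?_
  rw [avg_add, avg_mul_left, avg_sum]
  have hUA : edgesTo j CA ⊆ U := (edgesTo_mono j Finset.subset_union_left).trans hU
  have h2 : ∀ t ∈ Finset.range (L + 1),
      avg w U (fun ω => ind (fun x => |x - (-1 / 2 + (t : ℝ) / L)| ≤ δ / L) (a ω)) ω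
        ≤ 2 * δ * Real.exp 66 / L + 2 * Real.exp 66 / √(n * q) := by
    intro t ht
    rw [avg_stdCount hw h.left hUA]
    refine (binExp_near_le hq0 hq (by linarith) hL hδ0.le hδ1
      (Nat.lt_succ_iff.1 (Finset.mem_range.1 ht))).trans ?_
    refine add_le_add_right ?_ _
    have h3 : √(n * q) ≤ 2 * √(CA.card * q) := by
      rw [Real.sqrt_le_left (by positivity), mul_pow, Real.sq_sqrt (by positivity)]
      linarith
    rw [div_le_div_iff₀ (Real.sqrt_pos.2 (by linarith)) (Real.sqrt_pos.2 (by linarith))]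
    nlinarith [Real.exp_pos 66]
  have h3 := (Finset.sum_le_card_nsmul _ _ _ h2)
  rw [Finset.card_range, nsmul_eq_mul] at h3
  have h4 : ((L + 1 : ℕ) : ℝ) * (2 * δ * Real.exp 66 / L + 2 * Real.exp 66 / √(n * q)) ≤ 2 * (ε / 3) := by
    have hsq : 0 < √(n * q) := Real.sqrt_pos.2 (by linarith)
    have e1 : ((L + 1 : ℕ) : ℝ) ≤ 2 * L := by push_cast; linarith
    refine (mul_le_mul_of_nonneg_right e1 (by positivity)).trans ?_
    have e2 : 2 * (L : ℝ) * (2 * δ * Real.exp 66 / L + 2 * Real.exp 66 / √(n * q))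
        = 4 * Real.exp 66 * δ + 4 * Real.exp 66 * L / √(n * q) := by field_simp; ring
    have e3 : 4 * Real.exp 66 * L / √(n * q) ≤ ε / 3 := by
      rw [div_le_iff₀ hsq]; linarith
    rw [e2]; linarith
  have h5 := avg_sq_stdCount_sub h hq0 hq hn hA hB hAB hBA j hU ω
  have h6 : (L / δ) ^ 2 * avg w U (fun ω => (a ω - b ω) ^ 2) ω ≤ ε / 3 := by
    refine (mul_le_mul_of_nonneg_left h5 (by positivity)).trans ?_
    rw [div_pow, div_mul_eq_mul_div, div_le_iff₀ (by positivity)]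
    linarith
  linarith

end Model

/-! ### The distance statistic of a true pair -/

section Model

variable {n : ℕ} {V : Type*} [Fintype V] {w : V → ℝ} {pA pB : V → Prop} {q ν : ℝ}

/-- The pairs between `J` and `C`. -/
def blocks (J C : Finset (Fin n)) : Finset (Sym2 (Fin n)) := J.biUnion (fun j => edgesTo j C)

lemma mem_blocks {J C : Finset (Fin n)} {x y : Fin n} :
    s(x, y) ∈ blocks J C ↔ (x ∈ J ∧ y ∈ C) ∨ (y ∈ J ∧ x ∈ C) := by
  rw [blocks, Finset.mem_biUnion]
  constructor
  · rintro ⟨j, hj, he⟩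
    obtain ⟨z, hz, he⟩ := mem_edgesTo.1 he
    rcases Sym2.eq_iff.1 he with ⟨h1, h2⟩ | ⟨h1, h2⟩
    · subst h1 h2; exact Or.inl ⟨hj, hz⟩
    · subst h1 h2; exact Or.inr ⟨hj, hz⟩
  · rintro (⟨h1, h2⟩ | ⟨h1, h2⟩)
    · exact ⟨x, h1, mem_edgesTo.2 ⟨y, h2, rfl⟩⟩
    · exact ⟨y, h1, mem_edgesTo.2 ⟨x, h2, Sym2.eq_swap⟩⟩

lemma nbrs_rgraph_congr {p : V → Prop} {ω ω' : Sym2 (Fin n) → V} {i : Fin n}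
    (h : ∀ x, ω' s(i, x) = ω s(i, x)) : nbrs (rgraph p ω') i = nbrs (rgraph p ω) i := by
  ext x
  simp only [mem_nbrs, rgraph, h x]

lemma nbrs_rgraph_of_agree {p : V → Prop} {ω ω' : Sym2 (Fin n) → V} {i : Fin n}
    {J C : Finset (Fin n)} (hJ : i ∉ J) (hC : i ∉ C) (h : ∀ e ∉ blocks J C, ω' e = ω e) :
    nbrs (rgraph p ω') i = nbrs (rgraph p ω) i :=
  nbrs_rgraph_congr fun x => h _ fun hx => by
    rcases mem_blocks.1 hx with h | h
    · exact hJ h.1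
    · exact hC h.2

/-- The centered indicator of the event that the standardized count is in a bin. -/
noncomputable def binDev (p : V → Prop) (q : ℝ) (C : Finset (Fin n)) (L : ℕ) (j : Fin n)
    (l : Fin L) (ω : Sym2 (Fin n) → V) : ℝ :=
  ind (· ∈ bin L l) (stdCount p q C j ω) - binProb C.card q L l

lemma dependsOn_binDev (p : V → Prop) (q : ℝ) (C : Finset (Fin n)) (L : ℕ) (j : Fin n) (l : Fin L) :
    DependsOn (binDev p q C L j l : (Sym2 (Fin n) → V) → ℝ) (edgesTo j C : Set (Sym2 (Fin n))) :=
  (dependsOn_stdCount p q C j).comp_fun (fun x => ind (· ∈ bin L l) x - binProb C.card q L l)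

lemma avg_binDev (hw : IsWeight w) {p : V → Prop} (hq : ∑ v, w v * ind p v = q)
    {U : Finset (Sym2 (Fin n))} {C : Finset (Fin n)} {j : Fin n} (hU : edgesTo j C ⊆ U)
    {L : ℕ} (l : Fin L) (ω : Sym2 (Fin n) → V) : avg w U (binDev p q C L j l) ω = 0 := by
  unfold binDev
  rw [avg_sub, avg_const hw, avg_ind_stdCount hw hq hU, sub_self]

lemma avg_sq_sub_le (hw : IsWeight w) {U : Finset (Sym2 (Fin n))} {f g : (Sym2 (Fin n) → V) → ℝ}
    {c : ℝ} {ω : Sym2 (Fin n) → V} (hg : ∀ ω, g ω = f ω - c) (h0 : avg w U g ω = 0) :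
    avg w U (fun ω => g ω ^ 2) ω ≤ avg w U (fun ω => f ω ^ 2) ω := by
  have h1 : (fun ω => f ω ^ 2) = fun ω => (g ω ^ 2 + (2 * c) * g ω) + c ^ 2 := by
    funext ω; rw [hg]; ring
  rw [h1, avg_add, avg_add, avg_mul_left, h0, avg_const hw]
  nlinarith [sq_nonneg c]

lemma sum_avg_binDev_sq_le (hw : IsWeight w) {p : V → Prop} (hq : ∑ v, w v * ind p v = q)
    {U : Finset (Sym2 (Fin n))} {C : Finset (Fin n)} {j : Fin n} (hU : edgesTo j C ⊆ U)
    (L : ℕ) (ω : Sym2 (Fin n) → V) :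
    ∑ l : Fin L, avg w U (fun ω => binDev p q C L j l ω ^ 2) ω ≤ 1 := by
  have h1 : ∀ l : Fin L, avg w U (fun ω => binDev p q C L j l ω ^ 2) ω
      ≤ avg w U (fun ω => ind (· ∈ bin L l) (stdCount p q C j ω)) ω := fun l => by
    refine (avg_sq_sub_le hw (f := fun ω => ind (· ∈ bin L l) (stdCount p q C j ω))
      (fun _ => rfl) (avg_binDev hw hq hU l ω)).trans_eq ?_
    simp only [ind_sq]
  refine (Finset.sum_le_sum fun l _ => h1 l).trans ?_
  rw [← avg_sum]
  exact avg_le_const hw fun ω' _ => sum_ind_bin_le_one L _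

lemma sum_abs_binDev_sub_le (p : V → Prop) (q : ℝ) (C : Finset (Fin n)) (L : ℕ) (j : Fin n)
    (ω₁ ω₂ : Sym2 (Fin n) → V) :
    ∑ l : Fin L, |binDev p q C L j l ω₁ - binDev p q C L j l ω₂| ≤ 2 := by
  have h1 : ∀ l : Fin L, |binDev p q C L j l ω₁ - binDev p q C L j l ω₂|
      ≤ ind (· ∈ bin L l) (stdCount p q C j ω₁) + ind (· ∈ bin L l) (stdCount p q C j ω₂) := by
    intro l
    unfold binDev
    rw [sub_sub_sub_cancel_right, abs_le]
    have h1 := ind_nonneg (· ∈ bin L l) (stdCount p q C j ω₁)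
    have h2 := ind_nonneg (· ∈ bin L l) (stdCount p q C j ω₂)
    constructor <;> linarith
  refine (Finset.sum_le_sum fun l _ => h1 l).trans ?_
  rw [Finset.sum_add_distrib]
  linarith [sum_ind_bin_le_one L (stdCount p q C j ω₁), sum_ind_bin_le_one L (stdCount p q C j ω₂)]

lemma edgesTo_subset_blocks {J C : Finset (Fin n)} {j : Fin n} (hj : j ∈ J) :
    edgesTo j C ⊆ blocks J C :=
  Finset.subset_biUnion_of_mem (fun j => edgesTo j C) hj

/-- Tail bound for the deviations of the standardized counts in one of the graphs. -/
lemma avg_ind_binDev (hw : IsWeight w) {p : V → Prop} (hq : ∑ v, w v * ind p v = q)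
    {J C : Finset (Fin n)} (hJC : Disjoint J C) {L : ℕ} {α S s t : ℝ}
    (hs : L * (J.card * α ^ 2) ≤ s ^ 2) (hs0 : 0 ≤ s) (hS : J.card * (2 * |α|) ^ 2 ≤ S) (hS0 : 0 < S)
    (ht : 0 ≤ t) (ω : Sym2 (Fin n) → V) {P : (Sym2 (Fin n) → V) → Prop}
    (hP : ∀ ω', P ω' → s + t ≤ ∑ l : Fin L, |∑ j ∈ J, α * binDev p q C L j l ω'|) :
    avg w (blocks J C) (ind P) ω ≤ Real.exp (-t ^ 2 / (2 * S)) := by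
  refine avg_ind_le_of_sum_abs hw (pairwiseDisjoint_edgesTo hJC)
    (ζ := fun j l ω => α * binDev p q C L j l ω) (v := α ^ 2)
    (fun j _ l => (dependsOn_binDev p q C L j l).comp_fun (α * ·)) ω (fun j hj l => ?_)
    (fun j hj => ?_) (fun j hj ω₁ ω₂ => ?_) hs hs0 hS hS0 ht hP
  · change avg w (blocks J C) (fun ω => α * binDev p q C L j l ω) ω = 0
    rw [avg_mul_left, avg_binDev hw hq (edgesTo_subset_blocks hj), mul_zero]
  · simp only [mul_pow, avg_mul_left]
    rw [← Finset.mul_sum]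
    exact mul_le_of_le_one_right (sq_nonneg _)
      (sum_avg_binDev_sq_le hw hq (edgesTo_subset_blocks hj) L ω)
  · simp only [← mul_sub, abs_mul]
    rw [← Finset.mul_sum, mul_comm]
    exact mul_le_mul_of_nonneg_right (sum_abs_binDev_sub_le _ _ _ _ _ _ _) (abs_nonneg _)

/-- Tail bound for the differences of deviations of the standardized counts in both graphs. -/
lemma avg_ind_binDev_sub (h : IsPairWeight w pA pB q ν)
    {J CA CB : Finset (Fin n)} (hJC : Disjoint J (CA ∪ CB)) {L : ℕ} {α β ε S s t : ℝ}
    (hα : 0 ≤ α) (hβ : 0 ≤ β) (ω : Sym2 (Fin n) → V)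
    (hε : ∀ j ∈ J, avg w (blocks J (CA ∪ CB)) (ind fun ω => ∃ l : Fin L,
      ¬ (stdCount pA q CA j ω ∈ bin L l ↔ stdCount pB q CB j ω ∈ bin L l)) ω ≤ ε)
    (hs : L * (J.card * (4 * α ^ 2 * ε + 2 * (α - β) ^ 2)) ≤ s ^ 2) (hs0 : 0 ≤ s)
    (hS : J.card * (2 * α + 2 * β) ^ 2 ≤ S) (hS0 : 0 < S)
    (ht : 0 ≤ t) {P : (Sym2 (Fin n) → V) → Prop}
    (hP : ∀ ω', P ω' → s + t ≤
      ∑ l : Fin L, |∑ j ∈ J, (α * binDev pA q CA L j l ω' - β * binDev pB q CB L j l ω')|) :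
    avg w (blocks J (CA ∪ CB)) (ind P) ω ≤ Real.exp (-t ^ 2 / (2 * S)) := by
  have hw := h.weight
  have hUA : ∀ j ∈ J, edgesTo j CA ⊆ blocks J (CA ∪ CB) := fun j hj =>
    (edgesTo_mono j Finset.subset_union_left).trans (edgesTo_subset_blocks hj)
  have hUB : ∀ j ∈ J, edgesTo j CB ⊆ blocks J (CA ∪ CB) := fun j hj =>
    (edgesTo_mono j Finset.subset_union_right).trans (edgesTo_subset_blocks hj)
  refine avg_ind_le_of_sum_abs hw (pairwiseDisjoint_edgesTo hJC)
    (ζ := fun j l ω => α * binDev pA q CA L j l ω - β * binDev pB q CB L j l ω)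
    (fun j _ l ω₁ ω₂ h12 => ?_) ω (fun j hj l => ?_)
    (fun j hj => ?_) (fun j hj ω₁ ω₂ => ?_) hs hs0 hS hS0 ht hP
  · have e1 := dependsOn_binDev pA q CA L j l (fun e he => h12 e
      (edgesTo_mono j Finset.subset_union_left he))
    have e2 := dependsOn_binDev pB q CB L j l (fun e he => h12 e
      (edgesTo_mono j Finset.subset_union_right he))
    simp only [e1, e2]
  · change avg w (blocks J (CA ∪ CB))
      (fun ω => α * binDev pA q CA L j l ω - β * binDev pB q CB L j l ω) ω = 0
    rw [avg_sub, avg_mul_left, avg_mul_left, avg_binDev hw h.left (hUA j hj),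
      avg_binDev hw h.right (hUB j hj)]
    ring
  · have h1 : ∀ l : Fin L, avg w (blocks J (CA ∪ CB))
        (fun ω => (α * binDev pA q CA L j l ω - β * binDev pB q CB L j l ω) ^ 2) ω
        ≤ 2 * α ^ 2 * avg w (blocks J (CA ∪ CB)) (fun ω => (ind (· ∈ bin L l) (stdCount pA q CA j ω)
            - ind (· ∈ bin L l) (stdCount pB q CB j ω)) ^ 2) ω
          + 2 * (α - β) ^ 2 * avg w (blocks J (CA ∪ CB)) (fun ω => binDev pB q CB L j l ω ^ 2) ω := by
      intro l
      have e1 : avg w (blocks J (CA ∪ CB))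
          (fun ω => (binDev pA q CA L j l ω - binDev pB q CB L j l ω) ^ 2) ω
          ≤ avg w (blocks J (CA ∪ CB)) (fun ω => (ind (· ∈ bin L l) (stdCount pA q CA j ω)
            - ind (· ∈ bin L l) (stdCount pB q CB j ω)) ^ 2) ω := by
        refine avg_sq_sub_le hw (c := binProb CA.card q L l - binProb CB.card q L l) (fun ω => ?_) ?_
        · unfold binDev; ring
        · rw [avg_sub, avg_binDev hw h.left (hUA j hj), avg_binDev hw h.right (hUB j hj), sub_self]
      refine le_trans ?_ (add_le_add_left (mul_le_mul_of_nonneg_left e1 (by positivity)) _)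
      rw [← avg_mul_left, ← avg_mul_left, ← avg_add]
      refine avg_mono hw fun ω' _ => ?_
      generalize binDev pA q CA L j l ω' = x
      generalize binDev pB q CB L j l ω' = y
      have : α * x - β * y = α * (x - y) + (α - β) * y := by ring
      rw [this]
      refine add_sq_le.trans (le_of_eq ?_)
      ring
    refine (Finset.sum_le_sum fun l _ => h1 l).trans ?_
    rw [Finset.sum_add_distrib, ← Finset.mul_sum, ← Finset.mul_sum]
    have h2 : ∑ l : Fin L, avg w (blocks J (CA ∪ CB)) (fun ω =>
        (ind (· ∈ bin L l) (stdCount pA q CA j ω)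
          - ind (· ∈ bin L l) (stdCount pB q CB j ω)) ^ 2) ω ≤ 2 * ε := by
      rw [← avg_sum]
      refine le_trans ?_ (mul_le_mul_of_nonneg_left (hε j hj) (by norm_num))
      rw [← avg_mul_left]
      refine avg_mono hw fun ω' _ => ?_
      by_cases hp : ∃ l : Fin L, ¬ (stdCount pA q CA j ω' ∈ bin L l ↔ stdCount pB q CB j ω' ∈ bin L l)
      · rw [ind_of (p := fun ω => ∃ l : Fin L, ¬ (stdCount pA q CA j ω ∈ bin L l
          ↔ stdCount pB q CB j ω ∈ bin L l)) hp]
        have h3 : ∀ l : Fin L, (ind (· ∈ bin L l) (stdCount pA q CA j ω')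
            - ind (· ∈ bin L l) (stdCount pB q CB j ω')) ^ 2
            ≤ ind (· ∈ bin L l) (stdCount pA q CA j ω') + ind (· ∈ bin L l) (stdCount pB q CB j ω') := by
          intro l
          unfold ind
          split_ifs <;> norm_num
        refine (Finset.sum_le_sum fun l _ => h3 l).trans ?_
        rw [Finset.sum_add_distrib]
        linarith [sum_ind_bin_le_one L (stdCount pA q CA j ω'), sum_ind_bin_le_one L (stdCount pB q CB j ω')]
      · rw [Finset.sum_eq_zero]
        · exact mul_nonneg (by norm_num) (ind_nonneg _ _)
        · intro l _
          push Not at hp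
          rw [ind_congr (r := (· ∈ bin L l)) (y := stdCount pB q CB j ω') (hp l), sub_self]
          norm_num
    have h3 := sum_avg_binDev_sq_le hw h.right (hUB j hj) L ω
    have h4 := mul_le_mul_of_nonneg_left h2 (by positivity : 0 ≤ 2 * α ^ 2)
    have h5 := mul_le_mul_of_nonneg_left h3 (by positivity : 0 ≤ 2 * (α - β) ^ 2)
    linarith
  · have h1 : ∀ l : Fin L, |(α * binDev pA q CA L j l ω₁ - β * binDev pB q CB L j l ω₁)
        - (α * binDev pA q CA L j l ω₂ - β * binDev pB q CB L j l ω₂)|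
        ≤ α * |binDev pA q CA L j l ω₁ - binDev pA q CA L j l ω₂|
          + β * |binDev pB q CB L j l ω₁ - binDev pB q CB L j l ω₂| := by
      intro l
      have : (α * binDev pA q CA L j l ω₁ - β * binDev pB q CB L j l ω₁)
        - (α * binDev pA q CA L j l ω₂ - β * binDev pB q CB L j l ω₂)
        = α * (binDev pA q CA L j l ω₁ - binDev pA q CA L j l ω₂)
          - β * (binDev pB q CB L j l ω₁ - binDev pB q CB L j l ω₂) := by ring
      rw [this]
      refine (abs_sub _ _).trans (le_of_eq ?_)
      rw [abs_mul, abs_mul, abs_of_nonneg hα, abs_of_nonneg hβ]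
    refine (Finset.sum_le_sum fun l _ => h1 l).trans ?_
    rw [Finset.sum_add_distrib, ← Finset.mul_sum, ← Finset.mul_sum]
    have h2 := mul_le_mul_of_nonneg_left (sum_abs_binDev_sub_le pA q CA L j ω₁ ω₂) hα
    have h3 := mul_le_mul_of_nonneg_left (sum_abs_binDev_sub_le pB q CB L j ω₁ ω₂) hβ
    linarith

end Model

section Model

variable {n : ℕ} {V : Type*} [Fintype V] {w : V → ℝ} {pA pB : V → Prop} {ν : ℝ}

/-- If pairs that do not meet `{i, k}` are resampled, depending on the neighbourhoods of `i` and
of `k`, then conditional bounds given the neighbourhoods imply unconditional bounds. -/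
lemma expect_le_of_nbrs (hw : IsWeight w) (pA pB : V → Prop) (i k : Fin n)
    (J C : Finset (Fin n) → Finset (Fin n) → Finset (Fin n))
    (hJi : ∀ S T, i ∉ S → k ∉ T → i ∉ J S T) (hJk : ∀ S T, i ∉ S → k ∉ T → k ∉ J S T)
    (hCi : ∀ S T, i ∉ S → k ∉ T → i ∉ C S T) (hCk : ∀ S T, i ∉ S → k ∉ T → k ∉ C S T)
    {P : Finset (Fin n) → Finset (Fin n) → (Sym2 (Fin n) → V) → Prop} {c : ℝ}
    (hP : ∀ S T ω, i ∉ S → k ∉ T → avg w (blocks (J S T) (C S T)) (ind (P S T)) ω ≤ c) :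
    expect w (ind fun ω => P (nbrs (rgraph pA ω) i) (nbrs (rgraph pB ω) k) ω) ≤ c := by
  have hagree : ∀ ω ω' : Sym2 (Fin n) → V,
      (∀ e ∉ blocks (J (nbrs (rgraph pA ω) i) (nbrs (rgraph pB ω) k))
        (C (nbrs (rgraph pA ω) i) (nbrs (rgraph pB ω) k)), ω' e = ω e) →
      nbrs (rgraph pA ω') i = nbrs (rgraph pA ω) i ∧ nbrs (rgraph pB ω') k = nbrs (rgraph pB ω) k :=
    fun ω ω' h =>
      have hi := not_mem_nbrs_self (rgraph pA ω) i
      have hk := not_mem_nbrs_self (rgraph pB ω) k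
      ⟨nbrs_rgraph_of_agree (hJi _ _ hi hk) (hCi _ _ hi hk) h,
        nbrs_rgraph_of_agree (hJk _ _ hi hk) (hCk _ _ hi hk) h⟩
  refine expect_le_of_resample hw (fun ω => blocks (J (nbrs (rgraph pA ω) i) (nbrs (rgraph pB ω) k))
        (C (nbrs (rgraph pA ω) i) (nbrs (rgraph pB ω) k))) (fun ω ω' h => ?_) (fun ω => ?_)
  · obtain ⟨h1, h2⟩ := hagree ω ω' h
    simp only [h1, h2]
  · refine le_trans (avg_mono hw fun ω' h => ?_) (hP (nbrs (rgraph pA ω) i) (nbrs (rgraph pB ω) k) ω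
      (not_mem_nbrs_self _ _) (not_mem_nbrs_self _ _))
    obtain ⟨h1, h2⟩ := hagree ω ω' h
    exact ind_mono fun h => by rwa [h1, h2] at h

/-- The neighbourhoods of a vertex in both graphs have the expected sizes, and differ by at
most `Δ`. -/
structure IsTypicalPair (n : ℕ) (q Δ : ℝ) (S T : Finset (Fin n)) : Prop where
  le_left : n * q / 2 ≤ S.card
  left_le : S.card ≤ 2 * (n * q)
  le_right : n * q / 2 ≤ T.card
  right_le : T.card ≤ 2 * (n * q)
  left_sdiff : ((S \ T).card : ℝ) ≤ Δ
  right_sdiff : ((T \ S).card : ℝ) ≤ Δ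

lemma centeredProfile_rgraph (p : V → Prop) (ω : Sym2 (Fin n) → V) (q : unitInterval) (i : Fin n)
    {L : ℕ} (l : Fin L) (h : 0 < (nbrs (rgraph p ω) i).card) :
    centeredProfile (rgraph p ω) q i (bin L l) = ∑ j ∈ nbrs (rgraph p ω) i,
      1 / ((nbrs (rgraph p ω) i).card : ℝ) *
        binDev p q (insert i (nbrs (rgraph p ω) i))ᶜ L j l ω := by
  rw [centeredProfile_bin _ _ _ _ h, ← Finset.mul_sum]
  congr 1
  refine Finset.sum_congr rfl fun j hj => ?_
  rw [binDev, stdOutdeg_rgraph p ω q i j hj, card_compl_insert_nbrs]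

lemma card_compl_insert_ge {q : ℝ} {i : Fin n} {S : Finset (Fin n)} (hi : i ∉ S) (hn : 4 ≤ n)
    (hq : q ≤ 1 / 64) (hS : S.card ≤ 2 * (n * q)) : (n : ℝ) / 2 ≤ ((insert i S)ᶜ.card : ℝ) := by
  have h1 : (((insert i S)ᶜ.card : ℕ) : ℝ) = (n : ℝ) - (S.card + 1) := by
    have := Finset.card_compl_add_card (insert i S)
    rw [Fintype.card_fin, Finset.card_insert_of_notMem hi] at this
    rw [eq_sub_iff_add_eq]
    exact_mod_cast this
  have hn' : (4 : ℝ) ≤ n := by exact_mod_cast hn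
  rw [h1]
  nlinarith

lemma compl_insert_sdiff {i : Fin n} {S T : Finset (Fin n)} (hi : i ∉ T) :
    (insert i S)ᶜ \ (insert i T)ᶜ = T \ S := by
  ext x
  simp only [Finset.mem_sdiff, Finset.mem_compl, Finset.mem_insert]
  constructor
  · rintro ⟨h1, h2⟩; tauto
  · rintro ⟨h1, h2⟩
    have : x ≠ i := fun h => hi (h ▸ h1)
    tauto

/-- Numerical assumptions for the analysis of true pairs. -/
structure TrueParams (n L : ℕ) (q ν τ ε δ Δ : ℝ) : Prop where
  n_ge : 4 ≤ n
  L_ge : 1 ≤ L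
  q_pos : 0 < q
  q_le : q ≤ 1 / 64
  τ_pos : 0 < τ
  ε_pos : 0 < ε
  ε_le : ε ≤ 1
  ε_le' : 3456 * ε ≤ τ ^ 2
  Δ_le : Δ ≤ ε * (n * q)
  δ_pos : 0 < δ
  δ_le_one : δ ≤ 1
  δ_le : 12 * Real.exp 66 * δ ≤ ε
  d_ge : 288 ≤ n * q
  d_ge' : 12 * Real.exp 66 * L ≤ ε * √(n * q)
  σ_le : L ^ 2 * (16 * (ν / q) + 48 * (Δ / n)) ≤ δ ^ 2 * ε / 3

variable {L : ℕ} {τ ε δ Δ : ℝ}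

lemma TrueParams.sq_s {q : ℝ} (hp : TrueParams n L q ν τ ε δ Δ) :
    (τ / 6 * √(L / (n * q))) ^ 2 = τ ^ 2 * L / (36 * (n * q)) := by
  have := hp.d_ge
  rw [mul_pow, Real.sq_sqrt (by positivity)]
  field_simp
  ring

lemma TrueParams.exp_eq {q : ℝ} (hp : TrueParams n L q ν τ ε δ Δ) :
    Real.exp (-(τ / 6 * √(L / (n * q))) ^ 2 / (2 * (128 / (n * q)))) = Real.exp (-(τ ^ 2 * L / 9216)) := by
  rw [hp.sq_s]
  have hd : (n : ℝ) * q ≠ 0 := by linarith [hp.d_ge]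
  generalize (n : ℝ) * q = d at hd
  congr 1
  field_simp
  ring

lemma inv_card_le {d : ℝ} (hd : 0 < d) {a : ℕ} (h : d / 2 ≤ a) : 1 / (a : ℝ) ≤ 2 / d := by
  rw [div_le_div_iff₀ (by linarith) hd]; linarith

/-- The common neighbours contribute much to the distance statistic of a true pair. -/
def IsLargeCommon (pA pB : V → Prop) (q : ℝ) (i : Fin n) (L : ℕ) (τ Δ : ℝ) (S T : Finset (Fin n))
    (ω : Sym2 (Fin n) → V) : Prop :=
  IsTypicalPair n q Δ S T ∧
    τ / 6 * √(L / (n * q)) + τ / 6 * √(L / (n * q)) ≤ ∑ l : Fin L, |∑ j ∈ S ∩ T,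
      (1 / (S.card : ℝ) * binDev pA q (insert i S)ᶜ L j l ω
        - 1 / (T.card : ℝ) * binDev pB q (insert i T)ᶜ L j l ω)|

/-- The neighbours in one graph only contribute much to the distance statistic of a true pair. -/
def IsLargeLeft (pA : V → Prop) (q : ℝ) (i : Fin n) (L : ℕ) (τ Δ : ℝ) (S T : Finset (Fin n))
    (ω : Sym2 (Fin n) → V) : Prop :=
  IsTypicalPair n q Δ S T ∧
    τ / 6 * √(L / (n * q)) + τ / 6 * √(L / (n * q)) ≤ ∑ l : Fin L, |∑ j ∈ S \ T,
      1 / (S.card : ℝ) * binDev pA q (insert i S)ᶜ L j l ω|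

lemma expect_true_pair_common {q : ℝ} (h : IsPairWeight w pA pB q ν)
    (hp : TrueParams n L q ν τ ε δ Δ) (i : Fin n) :
    expect w (ind fun ω => IsLargeCommon pA pB q i L τ Δ
      (nbrs (rgraph pA ω) i) (nbrs (rgraph pB ω) i) ω) ≤ Real.exp (-(τ ^ 2 * L / 9216)) := by
  have hw := h.weight
  refine expect_le_of_nbrs hw pA pB i i (P := IsLargeCommon pA pB q i L τ Δ) (fun S T => S ∩ T) (fun S T => (insert i S)ᶜ ∪ (insert i T)ᶜ)
    (fun S T hS _ => by simp [hS]) (fun S T hS _ => by simp [hS]) (fun S T _ _ => by simp)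
    (fun S T _ _ => by simp) (fun S T ω hS hT => ?_)
  by_cases hg : IsTypicalPair n q Δ S T
  swap
  · exact (avg_le_const hw fun ω' _ => (ind_of_not fun h => hg h.1).le).trans (Real.exp_pos _).le
  rw [← hp.exp_eq]
  have hd := hp.d_ge
  have hd0 : (0 : ℝ) < n * q := by linarith
  have ha : (0 : ℝ) < S.card := by linarith [hg.le_left]
  have hb : (0 : ℝ) < T.card := by linarith [hg.le_right]
  have hα := inv_card_le hd0 hg.le_left
  have hβ := inv_card_le hd0 hg.le_right
  have hα0 : 0 ≤ 1 / (S.card : ℝ) := by positivity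
  have hβ0 : 0 ≤ 1 / (T.card : ℝ) := by positivity
  have hJ : ((S ∩ T).card : ℝ) ≤ 2 * (n * q) :=
    le_trans (by exact_mod_cast Finset.card_le_card Finset.inter_subset_left) hg.left_le
  have hL0 : (0 : ℝ) ≤ L := Nat.cast_nonneg L
  have hε0 := hp.ε_pos
  refine avg_ind_binDev_sub h (ε := ε) ?_ hα0 hβ0 ω (fun j hj => ?_) ?_
    (by have := hp.τ_pos; positivity) ?_ (by positivity) (by have := hp.τ_pos; positivity)
    (fun ω' h' => h'.2)
  · rw [Finset.disjoint_left]
    intro x hx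
    rw [Finset.mem_inter] at hx
    simp [hx.1, hx.2]
  · exact avg_ind_bin_ne h hp.q_pos (by linarith [hp.q_le]) (by linarith [hp.n_ge]) hp.L_ge
      (card_compl_insert_ge hS hp.n_ge hp.q_le hg.left_le)
      (card_compl_insert_ge hT hp.n_ge hp.q_le hg.right_le)
      (by rw [compl_insert_sdiff hT]; exact hg.right_sdiff)
      (by rw [compl_insert_sdiff hS]; exact hg.left_sdiff) j (edgesTo_subset_blocks hj)
      hp.δ_pos hp.δ_le_one hp.δ_le hp.d_ge hp.d_ge' hp.σ_le ω
  · rw [hp.sq_s]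
    have hdiff : |1 / (S.card : ℝ) - 1 / (T.card : ℝ)| ≤ 4 * ε / (n * q) := by
      have e1 := Finset.card_sdiff_add_card_inter S T
      have e2 := Finset.card_sdiff_add_card_inter T S
      rw [Finset.inter_comm] at e2
      have e1' : ((S \ T).card : ℝ) + (S ∩ T).card = S.card := by exact_mod_cast e1
      have e2' : ((T \ S).card : ℝ) + (S ∩ T).card = T.card := by exact_mod_cast e2
      have n1 : (0 : ℝ) ≤ (S \ T).card := Nat.cast_nonneg _
      have n2 : (0 : ℝ) ≤ (T \ S).card := Nat.cast_nonneg _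
      have h1 : |(T.card : ℝ) - S.card| ≤ ε * (n * q) := by
        have := hp.Δ_le
        have := hg.left_sdiff
        have := hg.right_sdiff
        rw [abs_le]; constructor <;> linarith
      have h2 : 1 / (S.card : ℝ) - 1 / (T.card : ℝ)
          = ((T.card : ℝ) - S.card) * (1 / (S.card : ℝ) * (1 / (T.card : ℝ))) := by field_simp
      rw [h2, abs_mul, abs_of_nonneg (mul_nonneg hα0 hβ0)]
      calc _ ≤ ε * (n * q) * (2 / (n * q) * (2 / (n * q))) :=
            mul_le_mul h1 (mul_le_mul hα hβ hβ0 (by positivity)) (mul_nonneg hα0 hβ0) (by positivity)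
        _ = _ := by field_simp; norm_num
    have h1 : 4 * (1 / (S.card : ℝ)) ^ 2 * ε + 2 * (1 / (S.card : ℝ) - 1 / (T.card : ℝ)) ^ 2
        ≤ 48 * ε / (n * q) ^ 2 := by
      have e1 : (1 / (S.card : ℝ)) ^ 2 ≤ (2 / (n * q)) ^ 2 := pow_le_pow_left₀ hα0 hα 2
      have e2 : (1 / (S.card : ℝ) - 1 / (T.card : ℝ)) ^ 2 ≤ (4 * ε / (n * q)) ^ 2 := by
        rw [← sq_abs]; exact pow_le_pow_left₀ (abs_nonneg _) hdiff 2
      calc _ ≤ 4 * (2 / (n * q)) ^ 2 * ε + 2 * (4 * ε / (n * q)) ^ 2 := by gcongr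
        _ = (16 * ε + 32 * (ε * ε)) / (n * q) ^ 2 := by field_simp; ring
        _ ≤ _ := by
          have := hp.ε_le
          gcongr
          nlinarith
    calc (L : ℝ) * ((S ∩ T).card * (4 * (1 / (S.card : ℝ)) ^ 2 * ε + 2 * (1 / (S.card : ℝ) - 1 / (T.card : ℝ)) ^ 2))
        ≤ L * (2 * (n * q) * (48 * ε / (n * q) ^ 2)) := by
          refine mul_le_mul_of_nonneg_left ?_ hL0
          exact mul_le_mul hJ h1 (by positivity) (by positivity)
      _ = (3456 * ε) * L / (36 * (n * q)) := by field_simp; ring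
      _ ≤ _ := by
          have := hp.ε_le'
          gcongr
  · calc ((S ∩ T).card : ℝ) * (2 * (1 / (S.card : ℝ)) + 2 * (1 / (T.card : ℝ))) ^ 2
        ≤ (2 * (n * q)) * (2 * (2 / (n * q)) + 2 * (2 / (n * q))) ^ 2 := by gcongr
      _ = 128 / (n * q) := by field_simp; norm_num

lemma expect_true_pair_left {q : ℝ} (h : IsPairWeight w pA pB q ν)
    (hp : TrueParams n L q ν τ ε δ Δ) (i : Fin n) :
    expect w (ind fun ω => IsLargeLeft pA q i L τ Δ
      (nbrs (rgraph pA ω) i) (nbrs (rgraph pB ω) i) ω) ≤ Real.exp (-(τ ^ 2 * L / 9216)) := by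
  have hw := h.weight
  refine expect_le_of_nbrs hw pA pB i i (P := IsLargeLeft pA q i L τ Δ) (fun S T => S \ T) (fun S T => (insert i S)ᶜ)
    (fun S T hS _ => by simp [hS]) (fun S T hS _ => by simp [hS]) (fun S T _ _ => by simp)
    (fun S T _ _ => by simp) (fun S T ω hS hT => ?_)
  by_cases hg : IsTypicalPair n q Δ S T
  swap
  · exact (avg_le_const hw fun ω' _ => (ind_of_not fun h => hg h.1).le).trans (Real.exp_pos _).le
  rw [← hp.exp_eq]
  have hd := hp.d_ge
  have hd0 : (0 : ℝ) < n * q := by linarith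
  have ha : (0 : ℝ) < S.card := by linarith [hg.le_left]
  have hα := inv_card_le hd0 hg.le_left
  have hα0 : 0 ≤ 1 / (S.card : ℝ) := by positivity
  have hJ : ((S \ T).card : ℝ) ≤ ε * (n * q) := hg.left_sdiff.trans hp.Δ_le
  have hL0 : (0 : ℝ) ≤ L := Nat.cast_nonneg L
  have hε0 := hp.ε_pos
  refine avg_ind_binDev hw h.left (α := 1 / (S.card : ℝ)) ?_ ?_
    (by have := hp.τ_pos; positivity) ?_ (by positivity) (by have := hp.τ_pos; positivity) ω
    (fun ω' h' => h'.2)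
  · rw [Finset.disjoint_left]
    intro x hx
    rw [Finset.mem_sdiff] at hx
    simp [hx.1]
  · rw [hp.sq_s]
    calc (L : ℝ) * ((S \ T).card * (1 / (S.card : ℝ)) ^ 2)
        ≤ L * (ε * (n * q) * (2 / (n * q)) ^ 2) := by gcongr
      _ = (144 * ε) * L / (36 * (n * q)) := by field_simp; ring
      _ ≤ _ := by
          have := hp.ε_le'
          gcongr
          linarith
  · rw [abs_of_nonneg hα0]
    calc ((S \ T).card : ℝ) * (2 * (1 / (S.card : ℝ))) ^ 2
        ≤ (1 * (n * q)) * (2 * (2 / (n * q))) ^ 2 := by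
          have := hp.ε_le
          refine mul_le_mul (hJ.trans (by gcongr)) (by gcongr) (by positivity) (by positivity)
      _ = 16 / (n * q) := by field_simp; norm_num
      _ ≤ _ := by gcongr; norm_num

lemma IsTypicalPair.symm {q : ℝ} {S T : Finset (Fin n)} (h : IsTypicalPair n q Δ S T) :
    IsTypicalPair n q Δ T S :=
  ⟨h.le_right, h.right_le, h.le_left, h.left_le, h.right_sdiff, h.left_sdiff⟩

lemma distStat_self_le (q : unitInterval) (ω : Sym2 (Fin n) → V) (i : Fin n) {S T : Finset (Fin n)}
    (hS : nbrs (rgraph pA ω) i = S) (hT : nbrs (rgraph pB ω) i = T) (hS0 : 0 < S.card)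
    (hT0 : 0 < T.card) :
    distStat (rgraph pA ω) (rgraph pB ω) L q i i ≤
      ∑ l : Fin L, |∑ j ∈ S ∩ T, (1 / (S.card : ℝ) * binDev pA q (insert i S)ᶜ L j l ω
          - 1 / (T.card : ℝ) * binDev pB q (insert i T)ᶜ L j l ω)|
      + ∑ l : Fin L, |∑ j ∈ S \ T, 1 / (S.card : ℝ) * binDev pA q (insert i S)ᶜ L j l ω|
      + ∑ l : Fin L, |∑ j ∈ T \ S, 1 / (T.card : ℝ) * binDev pB q (insert i T)ᶜ L j l ω| := by
  rw [distStat, ← Finset.sum_add_distrib, ← Finset.sum_add_distrib]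
  refine Finset.sum_le_sum fun l _ => ?_
  rw [centeredProfile_rgraph pA ω q i l (by rw [hS]; exact hS0),
    centeredProfile_rgraph pB ω q i l (by rw [hT]; exact hT0), hS, hT,
    ← Finset.sum_inter_add_sum_sdiff S T, ← Finset.sum_inter_add_sum_sdiff T S, Finset.inter_comm T S,
    Finset.sum_sub_distrib]
  set a := ∑ j ∈ S ∩ T, 1 / (S.card : ℝ) * binDev pA q (insert i S)ᶜ L j l ω
  set b := ∑ j ∈ S ∩ T, 1 / (T.card : ℝ) * binDev pB q (insert i T)ᶜ L j l ω
  set c := ∑ j ∈ S \ T, 1 / (S.card : ℝ) * binDev pA q (insert i S)ᶜ L j l ω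
  set e := ∑ j ∈ T \ S, 1 / (T.card : ℝ) * binDev pB q (insert i T)ᶜ L j l ω
  have : a + c - (b + e) = ((a - b) + c) - e := by ring
  rw [this]
  exact (abs_sub _ _).trans (add_le_add_left (abs_add_le _ _) _)

lemma expect_ind_le_add_three (hw : IsWeight w) {P P₁ P₂ P₃ : (Sym2 (Fin n) → V) → Prop}
    (h : ∀ ω, P ω → P₁ ω ∨ P₂ ω ∨ P₃ ω) :
    expect w (ind P) ≤ expect w (ind P₁) + expect w (ind P₂) + expect w (ind P₃) := by
  rw [← expect_add, ← expect_add]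
  refine expect_mono hw fun ω => ?_
  have h1 := ind_nonneg P₁ ω
  have h2 := ind_nonneg P₂ ω
  have h3 := ind_nonneg P₃ ω
  by_cases hP : P ω
  · rw [ind_of hP]
    rcases h ω hP with h | h | h
    · rw [ind_of h]; linarith
    · rw [ind_of h]; linarith
    · rw [ind_of h]; linarith
  · rw [ind_of_not hP]; linarith

/-- The distance statistic of a true pair is small. -/
lemma expect_true_pair {q : unitInterval} (h : IsPairWeight w pA pB q ν)
    (hp : TrueParams n L q ν τ ε δ Δ) (i : Fin n) :
    expect w (ind fun ω => IsTypicalPair n q Δ (nbrs (rgraph pA ω) i) (nbrs (rgraph pB ω) i) ∧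
      τ * √(L / (n * q)) ≤ distStat (rgraph pA ω) (rgraph pB ω) L q i i)
      ≤ 3 * Real.exp (-(τ ^ 2 * L / 9216)) := by
  refine (expect_ind_le_add_three h.weight fun ω hω => ?_).trans (add_le_add (add_le_add
    (expect_true_pair_common h hp i) (expect_true_pair_left h hp i))
    (expect_true_pair_left h.symm hp i)) |>.trans_eq (by ring)
  obtain ⟨hg, hz⟩ := hω
  have hd := hp.d_ge
  have hS0 : 0 < (nbrs (rgraph pA ω) i).card := by
    have : (0 : ℝ) < (nbrs (rgraph pA ω) i).card := by linarith [hg.le_left]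
    exact_mod_cast this
  have hT0 : 0 < (nbrs (rgraph pB ω) i).card := by
    have : (0 : ℝ) < (nbrs (rgraph pB ω) i).card := by linarith [hg.le_right]
    exact_mod_cast this
  have hle := distStat_self_le (L := L) q ω i rfl rfl hS0 hT0
  by_contra hcon
  rw [not_or, not_or] at hcon
  obtain ⟨h1, h2, h3⟩ := hcon
  have h1 := lt_of_not_ge fun h => h1 ⟨hg, h⟩
  have h2 := lt_of_not_ge fun h => h2 ⟨hg, h⟩
  have h3 := lt_of_not_ge fun h => h3 ⟨hg.symm, h⟩
  linarith

/-! ### Degrees -/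

lemma expect_ind_le_of_avg (hw : IsWeight w) (U : Finset (Sym2 (Fin n)))
    {P : (Sym2 (Fin n) → V) → Prop} {c : ℝ} (h : ∀ ω, avg w U (ind P) ω ≤ c) :
    expect w (ind P) ≤ c :=
  expect_le_of_resample hw (fun _ => U) (fun _ _ _ => rfl) h

lemma card_filter_star (p : V → Prop) (ω : Sym2 (Fin n) → V) (i : Fin n) (S : Finset (Fin n))
    (hS : ∀ x, x ∈ S ↔ i ≠ x ∧ p (ω s(i, x))) : count p (edgesTo i {i}ᶜ) ω = S.card := by
  classical
  rw [count, edgesTo, Finset.filter_image, Finset.card_image_of_injective _ (sym2_right_injective i)]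
  congr 1
  ext x
  simp [hS, eq_comm]

lemma card_edgesTo_star (i : Fin n) : ((edgesTo i {i}ᶜ).card : ℝ) = n - 1 := by
  have hn : 1 ≤ n := i.pos
  rw [card_edgesTo, Finset.card_compl, Finset.card_singleton, Fintype.card_fin, Nat.cast_sub hn,
    Nat.cast_one]

lemma expect_degree (hw : IsWeight w) {p : V → Prop} {q : ℝ} (hq : ∑ v, w v * ind p v = q)
    (hq0 : 0 ≤ q) (hq1 : q ≤ 1) (hd : 20 ≤ n * q) (i : Fin n) :
    expect w (ind fun ω => 2 * (n * q) < ((nbrs (rgraph p ω) i).card : ℝ)) ≤ Real.exp (-(n * q / 10)) ∧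
    expect w (ind fun ω => ((nbrs (rgraph p ω) i).card : ℝ) < n * q / 2) ≤ Real.exp (-(n * q / 10)) := by
  have hcard : ∀ ω : Sym2 (Fin n) → V, count p (edgesTo i {i}ᶜ) ω = (nbrs (rgraph p ω) i).card :=
    fun ω => card_filter_star p ω i _ fun x => by rw [mem_nbrs]; rfl
  constructor
  · refine expect_ind_le_of_avg hw (edgesTo i {i}ᶜ) fun ω => ?_
    refine (avg_count_tail hw hq hq0 hq1 (edgesTo i {i}ᶜ) ω 1 (2 * (n * q)) fun ω' _ h => ?_).trans ?_
    · rw [hcard, one_mul]; exact h.le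
    · rw [Real.exp_le_exp, card_edgesTo_star]
      have := Real.exp_one_lt_d9
      have : 0 ≤ Real.exp 1 - 1 := by linarith [Real.add_one_le_exp (1 : ℝ)]
      nlinarith
  · refine expect_ind_le_of_avg hw (edgesTo i {i}ᶜ) fun ω => ?_
    refine (avg_count_tail hw hq hq0 hq1 (edgesTo i {i}ᶜ) ω (-1) (-(n * q / 2)) fun ω' _ h => ?_).trans ?_
    · rw [hcard]; linarith
    · rw [Real.exp_le_exp, card_edgesTo_star]
      have := Real.exp_neg_one_lt_d9
      have := Real.exp_pos (-1)
      nlinarith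

lemma expect_sdiff (hw : IsWeight w) (hν : ∑ v, w v * ind (fun v => pA v ∧ ¬ pB v) v = ν)
    (hν1 : ν ≤ 1) (i : Fin n) :
    expect w (ind fun ω => Δ < ((nbrs (rgraph pA ω) i \ nbrs (rgraph pB ω) i).card : ℝ))
      ≤ Real.exp (2 * (n * ν) - Δ) := by
  have hν0 : 0 ≤ ν := by
    rw [← hν]
    exact Finset.sum_nonneg fun v _ => mul_nonneg (hw.nonneg v) (ind_nonneg _ _)
  have hcard : ∀ ω : Sym2 (Fin n) → V, count (fun v => pA v ∧ ¬ pB v) (edgesTo i {i}ᶜ) ω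
      = (nbrs (rgraph pA ω) i \ nbrs (rgraph pB ω) i).card :=
    fun ω => card_filter_star _ ω i _ fun x => by
      rw [Finset.mem_sdiff, mem_nbrs, mem_nbrs]
      simp only [rgraph]
      tauto
  refine expect_ind_le_of_avg hw (edgesTo i {i}ᶜ) fun ω => ?_
  refine (avg_count_tail hw hν hν0 hν1 (edgesTo i {i}ᶜ) ω 1 Δ fun ω' _ h => ?_).trans ?_
  · rw [hcard, one_mul]; exact h.le
  · rw [Real.exp_le_exp, card_edgesTo_star]
    have := Real.exp_one_lt_d9
    have h1 : ((n : ℝ) - 1) * ν * (Real.exp 1 - 1) ≤ n * ν * 2 := by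
      have : 0 ≤ Real.exp 1 - 1 := by linarith [Real.add_one_le_exp (1 : ℝ)]
      have hn : (0 : ℝ) ≤ n := Nat.cast_nonneg n
      exact mul_le_mul (by nlinarith) (by linarith) this (by positivity)
    linarith

end Model

/-! ### The distance statistic of a wrong pair -/

/-- The constant in the lower bound for the probabilities of the bins. -/
noncomputable def binConst : ℝ := 1 / (32 * Real.exp 66)

lemma binConst_pos : 0 < binConst := by unfold binConst; positivity

lemma binConst_le_one : binConst ≤ 1 := by
  unfold binConst
  rw [div_le_one (by positivity)]
  have := Real.add_one_le_exp (66 : ℝ)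
  linarith

/-- Every bin has probability at least of order `1 / L`, also after a shift. -/
lemma binConst_le_binExp {n L r K : ℕ} {q e : ℝ} (hn : 0 < n) (hL : 1 ≤ L) (hq0 : 0 < q)
    (hq : q ≤ 1 / 64) (hd : 288 ≤ n * q) (hLd : 4 * L ≤ √(n * q)) (hr : (n : ℝ) / 2 ≤ r) (hrn : r ≤ n)
    (hK : (n : ℝ) / 2 ≤ K) (hKn : K ≤ n) (he : |e - (K - r) * q| ≤ √(n * q) + 2) (l : Fin L) :
    binConst / L ≤ binExp r q
      (fun m => ind (· ∈ bin L l) (((m : ℝ) + e - K * q) / √(K * q * (1 - q)))) := by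
  have hn' : (0 : ℝ) < n := by exact_mod_cast hn
  have hL' : (1 : ℝ) ≤ L := by exact_mod_cast hL
  have hrn' : (r : ℝ) ≤ n := by exact_mod_cast hrn
  have hKn' : (K : ℝ) ≤ n := by exact_mod_cast hKn
  set D := √(n * q) with hD
  set s := √(K * q * (1 - q)) with hs
  have hD2 : D * D = n * q := Real.mul_self_sqrt (by positivity)
  have hD16 : 16 ≤ D := Real.le_sqrt_of_sq_le (by linarith)
  have hKq : n * q / 2 ≤ K * q := by nlinarith
  have hs1 : D / 2 ≤ s := by
    refine Real.le_sqrt_of_sq_le ?_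
    nlinarith
  have hs2 : s ≤ D := Real.sqrt_le_sqrt (by nlinarith)
  have hs0 : 0 < s := by linarith
  have hrq : n * q / 2 ≤ r * q := by nlinarith
  have hμ : 144 ≤ r * q := by linarith
  set M := √(r * q) with hM
  have hM2 : M * M = r * q := Real.mul_self_sqrt (by linarith)
  have hMD : M ≤ D := Real.sqrt_le_sqrt (by nlinarith)
  have hM0 : 0 < M := Real.sqrt_pos.2 (by linarith)
  have hDM : 7 * D ≤ 10 * M := by
    refine (abs_le_of_sq_le_sq' ?_ (by positivity)).2
    nlinarith
  set lo := -1 / 2 + (l : ℝ) / L with hlo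
  set hi := -1 / 2 + ((l : ℝ) + 1) / L with hhi
  have hl1 : (l : ℝ) + 1 ≤ L := by exact_mod_cast l.2
  have hlo1 : -1 / 2 ≤ lo := by rw [hlo]; have : 0 ≤ (l : ℝ) / L := by positivity
                                linarith
  have hhi1 : hi ≤ 1 / 2 := by
    have : ((l : ℝ) + 1) / L ≤ 1 := by rw [div_le_one (by linarith)]; exact hl1
    linarith
  obtain ⟨he1, he2⟩ := abs_le.1 he
  have hslo : -(D / 2) ≤ s * lo := by
    have := mul_le_mul_of_nonneg_left hlo1 hs0.le
    linarith
  have hshi : s * hi ≤ D / 2 := by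
    have := mul_le_mul_of_nonneg_left hhi1 hs0.le
    linarith
  have key := le_binExp_ind (r := r) hq0 (by linarith) hμ (x := K * q - e + s * lo)
    (y := K * q - e + s * hi) (by linarith) (by linarith)
  have h1 : binConst / L ≤ (K * q - e + s * hi - (K * q - e + s * lo) - 1)
      * (1 / (8 * Real.exp 66 * √(r * q))) := by
    have h2 : K * q - e + s * hi - (K * q - e + s * lo) - 1 = s / L - 1 := by
      rw [hlo, hhi]; field_simp; ring
    rw [h2]
    have h3 : D / (4 * L) ≤ s / L - 1 := by
      have h5 : D / 2 / L ≤ s / L := by gcongr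
      have h6 : 1 ≤ D / (4 * L) := by rw [one_le_div (by positivity)]; exact hLd
      have h7 : D / 2 / L = D / (4 * L) + D / (4 * L) := by field_simp; norm_num
      linarith
    have h4 : 1 / (8 * Real.exp 66 * D) ≤ 1 / (8 * Real.exp 66 * M) := by gcongr
    refine le_trans (le_of_eq ?_) (mul_le_mul h3 h4 (by positivity) (le_trans (by positivity) h3))
    unfold binConst
    field_simp
    norm_num
  refine h1.trans (key.trans ?_)
  refine Finset.sum_le_sum fun m _ => mul_le_mul_of_nonneg_left (ind_mono fun h => ?_)
    (binPmf_nonneg hq0.le (by linarith) _ _)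
  refine mem_bin_of ?_ ?_
  · change lo ≤ _
    rw [le_div_iff₀ hs0]; linarith [h.1]
  · change _ < hi
    rw [div_lt_iff₀ hs0]; linarith [h.2]

section Model

variable {n L : ℕ} {V : Type*} [Fintype V] {w : V → ℝ} {pA pB : V → Prop} {ν : ℝ}

/-- The vertices that are far from `i` and `k`. -/
def farSet (i k : Fin n) (S T : Finset (Fin n)) : Finset (Fin n) := (S ∪ T ∪ {i, k})ᶜ

/-- The vertices that are close to `i` only. -/
def nearSet (k : Fin n) (S T : Finset (Fin n)) : Finset (Fin n) := S \ insert k T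

open Classical in
/-- The vertices that are close to `i` only and have about the expected number of neighbours that
are close to `k` only. -/
noncomputable def regularSet (p : V → Prop) (q : ℝ) (i k : Fin n) (S T : Finset (Fin n))
    (ω : Sym2 (Fin n) → V) : Finset (Fin n) :=
  (nearSet k S T).filter (fun j => |(count p (edgesTo j (T \ insert i S)) ω : ℝ)
    - (T \ insert i S).card * q| ≤ √(n * q))

/-- The neighbourhoods of `i` and of `k` have the expected sizes and a small intersection. -/
structure IsTypicalWrongPair (n : ℕ) (q : ℝ) (S T : Finset (Fin n)) : Prop where
  le_left : n * q / 2 ≤ S.card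
  left_le : S.card ≤ 2 * (n * q)
  right_le : T.card ≤ 2 * (n * q)
  inter_le : ((S ∩ T).card : ℝ) ≤ n * q / 8

lemma IsTypicalWrongPair.le_card_nearSet {q : ℝ} {k : Fin n} {S T : Finset (Fin n)}
    (h : IsTypicalWrongPair n q S T) (hd : 288 ≤ n * q) : n * q / 4 ≤ ((nearSet k S T).card : ℝ) := by
  have h1 : S ⊆ nearSet k S T ∪ (S ∩ T) ∪ {k} := fun x hx => by
    simp only [nearSet, Finset.mem_union, Finset.mem_sdiff, Finset.mem_insert, Finset.mem_inter,
      Finset.mem_singleton]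
    tauto
  have h2 := (Finset.card_le_card h1).trans ((Finset.card_union_le _ _).trans
    (Nat.add_le_add_right (Finset.card_union_le _ _) _))
  rw [Finset.card_singleton] at h2
  have h3 : (S.card : ℝ) ≤ (nearSet k S T).card + (S ∩ T).card + 1 := by exact_mod_cast h2
  linarith [h.le_left, h.inter_le]

/-- Most vertices which are close to `i` only have about the expected number of neighbours which
are close to `k` only. -/
lemma expect_regularSet (hw : IsWeight w) {q : ℝ} (hq : ∑ v, w v * ind pA v = q) (hq0 : 0 < q)
    (hq1 : q ≤ 1 / 64) (hd : 288 ≤ n * q) (i k : Fin n) :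
    expect w (ind fun ω => (fun S T ω => IsTypicalWrongPair n q S T ∧
        2 * (regularSet pA q i k S T ω).card < (nearSet k S T).card)
      (nbrs (rgraph pA ω) i) (nbrs (rgraph pB ω) k) ω) ≤ Real.exp (-(n * q / 128)) := by
  classical
  refine expect_le_of_nbrs hw pA pB i k
    (P := fun S T ω => IsTypicalWrongPair n q S T ∧
        2 * (regularSet pA q i k S T ω).card < (nearSet k S T).card)
    (nearSet k) (fun S T => T \ insert i S) (fun S T hS _ => by simp [nearSet, hS])
    (fun S T _ _ => by simp [nearSet]) (fun S T _ _ => by simp) (fun S T _ hT => by simp [hT])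
    (fun S T ω hS hT => ?_)
  by_cases hg : IsTypicalWrongPair n q S T
  swap
  · exact (avg_le_const hw fun ω' _ => (ind_of_not fun h => hg h.1).le).trans (Real.exp_pos _).le
  set J := nearSet k S T with hJ
  set C := T \ insert i S with hC
  have hJC : Disjoint J C := by
    rw [Finset.disjoint_left]
    intro x hx
    rw [hJ, nearSet, Finset.mem_sdiff] at hx
    simp [hC, hx.1]
  have hJd : n * q / 4 ≤ (J.card : ℝ) := hg.le_card_nearSet hd
  set bad : Fin n → (Sym2 (Fin n) → V) → ℝ := fun j =>
    ind (fun ω => ¬ |(count pA (edgesTo j C) ω : ℝ) - C.card * q| ≤ √(n * q)) with hbad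
  have hdep : ∀ j ∈ J, DependsOn (bad j) (edgesTo j C : Set (Sym2 (Fin n))) := fun j _ ω ω' h => by
    have := count_congr (p := pA) (U := edgesTo j C) (ω := ω') (ω' := ω) fun e he => h e he
    exact ind_congr (by rw [this])
  have hsq : √(n * q) ^ 2 = n * q := Real.sq_sqrt (by linarith)
  have hmean : ∀ j ∈ J, avg w (blocks J C) (bad j) ω ≤ 1 / 4 := by
    intro j hj
    rw [avg_inter hw (hdep j hj) (edgesTo_subset_blocks hj) (fun e _ he => Finset.mem_coe.1 he)]
    have h1 : avg w (edgesTo j C) (bad j) ω ≤ avg w (edgesTo j C)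
        (fun ω => (1 / (n * q)) * ((count pA (edgesTo j C) ω : ℝ) - C.card * q) ^ 2) ω := by
      refine avg_mono hw fun ω' _ => ?_
      by_cases hb : |(count pA (edgesTo j C) ω' : ℝ) - C.card * q| ≤ √(n * q)
      · have : bad j ω' = 0 := ind_of_not (not_not.2 hb)
        rw [this]; positivity
      · have : bad j ω' = 1 := ind_of hb
        rw [this, one_div_mul_eq_div, one_le_div (by linarith), ← hsq, ← sq_abs (_ - _)]
        exact pow_le_pow_left₀ (Real.sqrt_nonneg _) (not_le.1 hb).le 2
    refine h1.trans ?_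
    have h2 := avg_count hw hq (edgesTo j C) (fun m => ((m : ℝ) - C.card * q) ^ 2) ω
    rw [card_edgesTo, binExp_variance] at h2
    rw [avg_mul_left, h2, one_div_mul_eq_div, div_le_iff₀ (by linarith)]
    have h3 : (C.card : ℝ) ≤ 2 * (n * q) :=
      le_trans (by exact_mod_cast Finset.card_le_card Finset.sdiff_subset) hg.right_le
    have h4 : (C.card : ℝ) * q ≤ 2 * (n * q) * q := by gcongr
    nlinarith [mul_nonneg (Nat.cast_nonneg (α := ℝ) C.card) hq0.le]
  have hcardJ : (0 : ℝ) < J.card := by linarith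
  refine (avg_ind_boundedDifferences hw J (fun j => edgesTo j C) (f := fun ω => ∑ j ∈ J, bad j ω)
    (c := 1) (v := J.card) (t := J.card / 4) (fun j hj ω₁ ω₂ h => ?_) (by simp) hcardJ
    (by positivity) ω (fun ω' _ hP => ?_)).trans ?_
  · rw [sum_sub_sum_of_agree (pairwiseDisjoint_edgesTo hJC) hdep hj h, abs_le]
    have a1 := ind_nonneg (fun ω => ¬ |(count pA (edgesTo j C) ω : ℝ) - C.card * q| ≤ √(n * q)) ω₁
    have a2 := ind_nonneg (fun ω => ¬ |(count pA (edgesTo j C) ω : ℝ) - C.card * q| ≤ √(n * q)) ω₂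
    have a3 := ind_le_one (fun ω => ¬ |(count pA (edgesTo j C) ω : ℝ) - C.card * q| ≤ √(n * q)) ω₁
    have a4 := ind_le_one (fun ω => ¬ |(count pA (edgesTo j C) ω : ℝ) - C.card * q| ≤ √(n * q)) ω₂
    simp only [hbad]
    constructor <;> linarith
  · have h1 : avg w (blocks J C) (fun ω => ∑ j ∈ J, bad j ω) ω ≤ J.card / 4 := by
      rw [avg_sum]
      refine (Finset.sum_le_card_nsmul _ _ _ hmean).trans_eq ?_
      rw [nsmul_eq_mul]; ring
    have h2 : ((regularSet pA q i k S T ω').card : ℝ) + ∑ j ∈ J, bad j ω' = J.card := by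
      have h4 : ∑ j ∈ J, bad j ω' = ((J.filter (fun j => ¬ |(count pA (edgesTo j C) ω' : ℝ)
          - C.card * q| ≤ √(n * q))).card : ℝ) := by
        rw [← Finset.sum_boole]
        refine Finset.sum_congr rfl fun j _ => ?_
        by_cases hb : |(count pA (edgesTo j C) ω' : ℝ) - C.card * q| ≤ √(n * q)
        · rw [if_neg (not_not.2 hb)]; exact ind_of_not (not_not.2 hb)
        · rw [if_pos hb]; exact ind_of hb
      rw [h4, regularSet]
      exact_mod_cast Finset.card_filter_add_card_filter_not _
    have h3 : 2 * ((regularSet pA q i k S T ω').card : ℝ) < J.card := by exact_mod_cast hP.2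
    change avg w (blocks J C) (fun ω => ∑ j ∈ J, bad j ω) ω + _ ≤ _
    linarith
  · rw [Real.exp_le_exp]
    have : -((J.card : ℝ) / 4) ^ 2 / (2 * J.card) = -(J.card / 32) := by field_simp; norm_num
    rw [this]
    linarith

lemma expect_inter (hw : IsWeight w) {q : ℝ} (hq : ∑ v, w v * ind pB v = q) (hq0 : 0 < q)
    (hq1 : q ≤ 1 / 64) {i k : Fin n} (hik : i ≠ k) :
    expect w (ind fun ω => ((nbrs (rgraph pA ω) i).card : ℝ) ≤ 2 * (n * q) ∧
      n * q / 8 < ((nbrs (rgraph pA ω) i ∩ nbrs (rgraph pB ω) k).card : ℝ))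
      ≤ Real.exp (-(n * q / 16)) := by
  have hagree : ∀ ω ω' : Sym2 (Fin n) → V,
      (∀ e ∉ edgesTo k (nbrs (rgraph pA ω) i \ {k}), ω' e = ω e) →
      nbrs (rgraph pA ω') i = nbrs (rgraph pA ω) i := fun ω ω' h =>
    nbrs_rgraph_congr fun x => h _ fun hx => by
      obtain ⟨y, hy, he⟩ := mem_edgesTo.1 hx
      rcases Sym2.eq_iff.1 he with ⟨h1, _⟩ | ⟨_, h2⟩
      · exact hik h1.symm
      · subst h2
        exact not_mem_nbrs_self _ _ (Finset.mem_sdiff.1 hy).1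
  refine expect_le_of_resample hw (fun ω => edgesTo k (nbrs (rgraph pA ω) i \ {k}))
    (fun ω ω' h => by simp only [hagree ω ω' h]) fun ω => ?_
  set S := nbrs (rgraph pA ω) i with hS
  by_cases hc : (S.card : ℝ) ≤ 2 * (n * q)
  swap
  · refine (avg_le_const hw fun ω' h => (ind_of_not fun h' => hc ?_).le).trans (Real.exp_pos _).le
    have h1 := h'.1
    rwa [hagree ω ω' h] at h1
  refine (avg_count_tail hw hq hq0.le (by linarith) _ ω 1 (n * q / 8) fun ω' h h' => ?_).trans ?_
  · rw [one_mul]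
    refine h'.2.le.trans ?_
    rw [hagree ω ω' h]
    have : count pB (edgesTo k (S \ {k})) ω' = (S ∩ nbrs (rgraph pB ω') k).card := by
      classical
      rw [count, edgesTo, Finset.filter_image, Finset.card_image_of_injective _ (sym2_right_injective k)]
      congr 1
      ext x
      simp only [Finset.mem_filter, Finset.mem_sdiff, Finset.mem_singleton, Finset.mem_inter, mem_nbrs,
        rgraph, ne_comm (a := k), ne_eq, and_assoc]
    rw [this]
  · rw [Real.exp_le_exp, card_edgesTo]
    have h1 : ((S \ {k}).card : ℝ) ≤ 2 * (n * q) :=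
      le_trans (by exact_mod_cast Finset.card_le_card Finset.sdiff_subset) hc
    have h2 : ((S \ {k}).card : ℝ) * q * (Real.exp 1 - 1) ≤ 2 * (n * q) * (1 / 64) * 2 := by
      have := Real.exp_one_lt_d9
      have h3 : 0 ≤ Real.exp 1 - 1 := by linarith [Real.add_one_le_exp (1 : ℝ)]
      have h4 : (0 : ℝ) ≤ n * q := by positivity
      exact mul_le_mul (mul_le_mul h1 hq1 hq0.le (by positivity)) (by linarith) h3 (by positivity)
    linarith

lemma centeredProfile_rgraph_congr {p : V → Prop} {q : unitInterval} {k : Fin n}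
    {ω ω' : Sym2 (Fin n) → V} {S : Set ℝ} (hS : MeasurableSet S)
    (hk : ∀ x, ω' s(k, x) = ω s(k, x))
    (h : ∀ j ∈ nbrs (rgraph p ω) k, ∀ x, ω' s(j, x) = ω s(j, x)) :
    centeredProfile (rgraph p ω') q k S = centeredProfile (rgraph p ω) q k S := by
  have hn := nbrs_rgraph_congr (p := p) hk
  rw [centeredProfile_apply _ _ _ hS, centeredProfile_apply _ _ _ hS, deg, deg, hn]
  congr 2
  refine Finset.sum_congr rfl fun j hj => ?_
  rw [stdOutdeg_rgraph p ω' q k j (by rw [hn]; exact hj), stdOutdeg_rgraph p ω q k j hj, hn]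
  congr 1
  refine dependsOn_stdCount p q _ j fun e he => ?_
  obtain ⟨x, _, rfl⟩ := mem_edgesTo.1 (Finset.mem_coe.1 he)
  exact h j hj x

lemma count_edgesTo_add (p : V → Prop) {C R : Finset (Fin n)} (h : R ⊆ C) (j : Fin n)
    (ω : Sym2 (Fin n) → V) :
    (count p (edgesTo j C) ω : ℝ) = count p (edgesTo j R) ω + count p (edgesTo j (C \ R)) ω := by
  rw [cast_count_edgesTo, cast_count_edgesTo, cast_count_edgesTo, add_comm]
  exact (Finset.sum_sdiff h).symm

lemma regularSet_subset (p : V → Prop) (q : ℝ) (i k : Fin n) (S T : Finset (Fin n))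
    (ω : Sym2 (Fin n) → V) : regularSet p q i k S T ω ⊆ S \ insert k T :=
  Finset.filter_subset _ _

lemma card_farSet_ge {q : ℝ} {S T : Finset (Fin n)} {i k : Fin n} (h : IsTypicalWrongPair n q S T)
    (hq : q ≤ 1 / 64) (hn : 8 ≤ n) : (n : ℝ) / 2 ≤ (farSet i k S T).card := by
  have h1 := Finset.card_compl_add_card (S ∪ T ∪ {i, k})
  have h2 : (S ∪ T ∪ {i, k}).card ≤ S.card + T.card + 2 :=
    (Finset.card_union_le _ _).trans (add_le_add (Finset.card_union_le _ _) Finset.card_le_two)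
  rw [Fintype.card_fin] at h1
  have h1' : ((farSet i k S T).card : ℝ) + (S ∪ T ∪ {i, k}).card = n := by exact_mod_cast h1
  have h2' : ((S ∪ T ∪ {i, k}).card : ℝ) ≤ S.card + T.card + 2 := by exact_mod_cast h2
  have hn' : (8 : ℝ) ≤ n := by exact_mod_cast hn
  have := h.left_le
  have := h.right_le
  nlinarith

lemma abs_count_near_le {p : V → Prop} {q : ℝ} (hq0 : 0 < q) (hq1 : q ≤ 1) {i k : Fin n}
    {S T : Finset (Fin n)} {ω : Sym2 (Fin n) → V} {j : Fin n} (hj : j ∈ regularSet p q i k S T ω) :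
    |(count p (edgesTo j ((insert i S)ᶜ \ farSet i k S T)) ω : ℝ)
      - ((insert i S)ᶜ \ farSet i k S T).card * q| ≤ √(n * q) + 2 := by
  classical
  have h1 := (Finset.mem_filter.1 hj).2
  set D := (insert i S)ᶜ \ farSet i k S T with hD
  set D' := T \ insert i S with hD'
  have hsub : D' ⊆ D := fun x hx => by
    simp only [hD, hD', farSet, Finset.mem_sdiff, Finset.mem_compl, Finset.mem_union] at hx ⊢
    tauto
  have hsub2 : D \ D' ⊆ {k} := fun x hx => by
    simp only [hD, hD', farSet, Finset.mem_sdiff, Finset.mem_compl, Finset.mem_union,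
      Finset.mem_insert, Finset.mem_singleton] at hx ⊢
    tauto
  have hc := count_edgesTo_add p hsub j ω
  have hcard : ((D \ D').card : ℝ) ≤ 1 := by
    have := Finset.card_le_card hsub2
    rw [Finset.card_singleton] at this
    exact_mod_cast this
  have hcard2 : (D.card : ℝ) = D'.card + (D \ D').card := by
    rw [add_comm]
    exact_mod_cast (Finset.card_sdiff_add_card_eq_card hsub).symm
  have hcount : (count p (edgesTo j (D \ D')) ω : ℝ) ≤ 1 := by
    refine le_trans ?_ hcard
    rw [← card_edgesTo j]
    exact_mod_cast Finset.card_filter_le _ _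
  have n1 : (0 : ℝ) ≤ (D \ D').card := Nat.cast_nonneg _
  have n2 : (0 : ℝ) ≤ count p (edgesTo j (D \ D')) ω := Nat.cast_nonneg _
  have n3 : ((D \ D').card : ℝ) * q ≤ 1 := by nlinarith
  have n4 : 0 ≤ ((D \ D').card : ℝ) * q := by positivity
  rw [hc, hcard2, add_mul]
  rw [abs_le] at h1 ⊢
  constructor <;> linarith

/-- Numerical assumptions for the analysis of wrong pairs. -/
structure WrongParams (n L : ℕ) (q : ℝ) : Prop where
  n_ge : 8 ≤ n
  L_ge : 2 ≤ L
  q_pos : 0 < q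
  q_le : q ≤ 1 / 64
  d_ge : 288 ≤ n * q
  L_le : 4 * L ≤ √(n * q)
  L_le' : 16 * L ≤ binConst ^ 2 * (n * q)

/-- The distance statistic of a wrong pair is large. -/
lemma expect_wrong_pair (hw : IsWeight w) {q : unitInterval} (hA : ∑ v, w v * ind pA v = (q : ℝ))
    (hp : WrongParams n L q) (i k : Fin n) :
    expect w (ind fun ω => IsTypicalWrongPair n q (nbrs (rgraph pA ω) i) (nbrs (rgraph pB ω) k) ∧
      (nearSet k (nbrs (rgraph pA ω) i) (nbrs (rgraph pB ω) k)).card ≤ 2 * (regularSet pA q i k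
        (nbrs (rgraph pA ω) i) (nbrs (rgraph pB ω) k) ω).card ∧
      distStat (rgraph pA ω) (rgraph pB ω) L q i k ≤ binConst / 128 * √(L / (n * q)))
      ≤ Real.exp (-(binConst ^ 2 * L / 65536)) := by
  classical
  have hagree : ∀ ω ω' : Sym2 (Fin n) → V,
      (∀ e ∉ blocks (regularSet pA q i k (nbrs (rgraph pA ω) i) (nbrs (rgraph pB ω) k) ω)
        (farSet i k (nbrs (rgraph pA ω) i) (nbrs (rgraph pB ω) k)), ω' e = ω e) →
      nbrs (rgraph pA ω') i = nbrs (rgraph pA ω) i ∧ nbrs (rgraph pB ω') k = nbrs (rgraph pB ω) k ∧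
      regularSet pA q i k (nbrs (rgraph pA ω) i) (nbrs (rgraph pB ω) k) ω'
        = regularSet pA q i k (nbrs (rgraph pA ω) i) (nbrs (rgraph pB ω) k) ω := by
    intro ω ω' h
    set S := nbrs (rgraph pA ω) i with hS
    set T := nbrs (rgraph pB ω) k with hT
    have hG := regularSet_subset pA q i k S T ω
    have hi : i ∉ S := not_mem_nbrs_self _ _
    refine ⟨nbrs_rgraph_of_agree (fun h => hi (Finset.mem_sdiff.1 (hG h)).1) (by simp [farSet]) h,
      nbrs_rgraph_of_agree (fun h => (Finset.mem_sdiff.1 (hG h)).2 (by simp)) (by simp [farSet]) h, ?_⟩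
    refine Finset.filter_congr fun j hj => ?_
    rw [count_congr (ω := ω) (ω' := ω')]
    intro e he
    obtain ⟨x, hx, rfl⟩ := mem_edgesTo.1 he
    refine h _ fun hmem => ?_
    rw [Finset.mem_sdiff] at hx
    rcases mem_blocks.1 hmem with ⟨_, hR⟩ | ⟨hxG, _⟩
    · simp [farSet, hx.1] at hR
    · exact hx.2 (Finset.mem_insert_of_mem (Finset.mem_sdiff.1 (hG hxG)).1)
  refine expect_le_of_resample hw (fun ω => blocks (regularSet pA q i k (nbrs (rgraph pA ω) i)
    (nbrs (rgraph pB ω) k) ω) (farSet i k (nbrs (rgraph pA ω) i) (nbrs (rgraph pB ω) k)))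
    (fun ω ω' h => ?_) fun ω => ?_
  · obtain ⟨h1, h2, h3⟩ := hagree ω ω' h
    simp only [h1, h2, h3]
  have hagree := hagree ω
  set S := nbrs (rgraph pA ω) i with hS
  set T := nbrs (rgraph pB ω) k with hT
  set G := regularSet pA q i k S T ω with hGdef
  set R := farSet i k S T with hR
  have hG : G ⊆ S \ insert k T := regularSet_subset pA q i k S T ω
  by_cases hgood : IsTypicalWrongPair n q S T ∧ (nearSet k S T).card ≤ 2 * G.card
  swap
  · refine (avg_le_const hw fun ω' h => (ind_of_not fun h' => hgood ?_).le).trans (Real.exp_pos _).le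
    obtain ⟨h1, h2, h3⟩ := hagree ω' h
    obtain ⟨h4, h5, _⟩ := h'
    rw [h1, h2] at h4
    rw [h1, h2, h3] at h5
    exact ⟨h4, h5⟩
  obtain ⟨htyp, hcardG⟩ := hgood
  have hd := hp.d_ge
  have hq0 := hp.q_pos
  have hL2 : (2 : ℝ) ≤ L := by exact_mod_cast hp.L_ge
  have hd0 : (0 : ℝ) < n * q := by linarith
  have hGd : (n : ℝ) * q / 8 ≤ (G.card : ℝ) := by
    have h1 := htyp.le_card_nearSet (k := k) hd
    have h2 : ((nearSet k S T).card : ℝ) ≤ 2 * G.card := by exact_mod_cast hcardG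
    linarith
  have hGS : G ⊆ S := hG.trans Finset.sdiff_subset
  have hGd' : (G.card : ℝ) ≤ 2 * ((n : ℝ) * q) :=
    le_trans (by exact_mod_cast Finset.card_le_card hGS) htyp.left_le
  have haS : (0 : ℝ) < S.card := by linarith [htyp.le_left]
  have hRC : R ⊆ (insert i S)ᶜ := fun x hx => by
    simp only [hR, farSet, Finset.mem_compl, Finset.mem_union, Finset.mem_insert,
      Finset.mem_singleton] at hx ⊢
    tauto
  have hGR : Disjoint G R := by
    rw [Finset.disjoint_left]
    intro x hx
    simp [hR, farSet, hGS hx]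
  set C := (insert i S)ᶜ with hC
  set s := √(C.card * q * (1 - q)) with hs
  set e : Fin n → ℝ := fun j => count pA (edgesTo j (C \ R)) ω with he
  set Y : Fin n → Fin L → (Sym2 (Fin n) → V) → ℝ := fun j l ω' =>
    ind (· ∈ bin L l) (((count pA (edgesTo j R) ω' : ℝ) + e j - C.card * q) / s) with hY
  have hdep : ∀ j ∈ G, ∀ l, DependsOn (Y j l) (edgesTo j R : Set (Sym2 (Fin n))) :=
    fun j _ l ω ω' h => by
      have := count_congr (p := pA) (U := edgesTo j R) (ω := ω') (ω' := ω) fun e he => h e he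
      simp only [hY, this]
  have hCn : (n : ℝ) / 2 ≤ C.card := card_compl_insert_ge (not_mem_nbrs_self _ _)
    (by linarith [hp.n_ge]) hp.q_le htyp.left_le
  have hRn : (n : ℝ) / 2 ≤ R.card := card_farSet_ge htyp hp.q_le hp.n_ge
  have hcardC : (C.card : ℝ) - R.card = (C \ R).card := by
    rw [sub_eq_iff_eq_add]
    exact_mod_cast (Finset.card_sdiff_add_card_eq_card hRC).symm
  have hpl : ∀ j ∈ G, ∀ l, binConst / L ≤ avg w (blocks G R) (Y j l) ω := fun j hj l => by
    have h1 : avg w (blocks G R) (Y j l) ω = binExp R.card q (fun m =>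
        ind (· ∈ bin L l) (((m : ℝ) + e j - C.card * q) / s)) := by
      rw [avg_inter hw (hdep j hj l) (edgesTo_subset_blocks hj) (fun e _ he => Finset.mem_coe.1 he),
        ← card_edgesTo j R]
      exact avg_count hw hA (edgesTo j R) (fun m => ind (· ∈ bin L l)
        (((m : ℝ) + e j - C.card * q) / s)) ω
    rw [h1]
    refine binConst_le_binExp (by linarith [hp.n_ge]) (by linarith [hp.L_ge]) hq0 hp.q_le hd hp.L_le hRn
      ((Finset.card_le_univ _).trans_eq (Fintype.card_fin n)) hCn
      ((Finset.card_le_univ _).trans_eq (Fintype.card_fin n)) ?_ l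
    rw [hcardC]
    exact abs_count_near_le hq0 q.2.2 hj
  have hc0 := binConst_pos
  have hc1 := binConst_le_one
  have hpu : ∀ j ∈ G, ∀ l, binConst / 2 ≤ 1 - avg w (blocks G R) (Y j l) ω := fun j hj l => by
    have h1 : ∑ l', avg w (blocks G R) (Y j l') ω ≤ 1 := by
      rw [← avg_sum]
      exact avg_le_const hw fun ω' _ => sum_ind_bin_le_one L _
    rw [← Finset.add_sum_erase _ _ (Finset.mem_univ l)] at h1
    have h2 := Finset.card_nsmul_le_sum (Finset.univ.erase l)
      (fun l' => avg w (blocks G R) (Y j l') ω) (binConst / L) (fun l' _ => hpl j hj l')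
    rw [Finset.card_erase_of_mem (Finset.mem_univ l), Finset.card_univ, Fintype.card_fin,
      nsmul_eq_mul, Nat.cast_sub (by linarith [hp.L_ge]), Nat.cast_one] at h2
    have h3 : binConst / 2 ≤ ((L : ℝ) - 1) * (binConst / L) := by
      have : ((L : ℝ) - 1) * (binConst / L) = binConst - binConst / L := by field_simp
      have h4 : binConst / L ≤ binConst / 2 := by gcongr
      linarith
    linarith
  set v := binConst ^ 2 * (n * q) / (16 * L) with hv
  have hv1 : 1 ≤ v := by
    rw [hv, one_le_div (by linarith)]; exact hp.L_le'
  have hv0 : 0 ≤ v := by linarith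
  have hvs : √v * √v = v := Real.mul_self_sqrt hv0
  have hν : ∀ ω' : Sym2 (Fin n) → V, (∀ e ∉ blocks G R, ω' e = ω e) → ∀ l : Fin L,
      centeredProfile (rgraph pB ω') q k (bin L l) = centeredProfile (rgraph pB ω) q k (bin L l) := by
    intro ω' h l
    refine centeredProfile_rgraph_congr (measurableSet_bin L l) (fun x => h _ fun hx => ?_)
      (fun j hj x => h _ fun hx => ?_)
    · rcases mem_blocks.1 hx with h | h
      · exact (Finset.mem_sdiff.1 (hG h.1)).2 (by simp)
      · simp [hR, farSet] at h
    · rcases mem_blocks.1 hx with h | h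
      · exact (Finset.mem_sdiff.1 (hG h.1)).2 (Finset.mem_insert_of_mem hj)
      · exact (Finset.mem_compl.1 h.2) (by simp [hT, hj])
  set t : Fin L → ℝ := fun l => G.card * binProb C.card q L l
    - ∑ j ∈ S \ G, binDev pA q C L j l ω + S.card * centeredProfile (rgraph pB ω) q k (bin L l) with ht
  have hZ : ∀ ω' : Sym2 (Fin n) → V, (∀ e ∉ blocks G R, ω' e = ω e) →
      S.card * distStat (rgraph pA ω') (rgraph pB ω') L q i k = ∑ l, |∑ j ∈ G, Y j l ω' - t l| := by
    intro ω' h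
    have hS' : nbrs (rgraph pA ω') i = S := (hagree ω' h).1
    rw [distStat, Finset.mul_sum]
    refine Finset.sum_congr rfl fun l _ => ?_
    have habs : ∀ x : ℝ, (S.card : ℝ) * |x| = |S.card * x| := fun x => by rw [abs_mul, abs_of_pos haS]
    rw [habs, hν ω' h l, centeredProfile_rgraph pA ω' q i l
      (by rw [hS']; exact_mod_cast haS), hS', ← Finset.mul_sum, ← hC]
    congr 1
    rw [mul_sub, ← mul_assoc, mul_one_div_cancel haS.ne', one_mul, ← Finset.sum_sdiff hGS]
    have h1 : ∑ j ∈ S \ G, binDev pA q C L j l ω' = ∑ j ∈ S \ G, binDev pA q C L j l ω := by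
      refine Finset.sum_congr rfl fun j hj => ?_
      refine dependsOn_binDev pA q C L j l fun e he => ?_
      obtain ⟨x, hx, rfl⟩ := mem_edgesTo.1 (Finset.mem_coe.1 he)
      refine h _ fun hmem => ?_
      rw [Finset.mem_sdiff] at hj
      rcases mem_blocks.1 hmem with h | h
      · exact hj.2 h.1
      · exact (Finset.mem_compl.1 hx) (Finset.mem_insert_of_mem (hGS h.1))
    have h2 : ∑ j ∈ G, binDev pA q C L j l ω' = ∑ j ∈ G, Y j l ω' - G.card * binProb C.card q L l := by
      rw [← nsmul_eq_mul, ← Finset.sum_const, ← Finset.sum_sub_distrib]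
      refine Finset.sum_congr rfl fun j hj => ?_
      simp only [binDev, hY, stdCount]
      congr 3
      rw [count_edgesTo_add pA hRC j ω']
      have h3 : count pA (edgesTo j (C \ R)) ω' = count pA (edgesTo j (C \ R)) ω := by
        refine count_congr fun e he => ?_
        obtain ⟨x, hx, rfl⟩ := mem_edgesTo.1 he
        rw [Finset.mem_sdiff] at hx
        refine h _ fun hmem => ?_
        rcases mem_blocks.1 hmem with h | h
        · exact hx.2 h.2
        · exact (Finset.mem_compl.1 hx.1) (Finset.mem_insert_of_mem (hGS h.1))
      rw [h3]
    rw [h1, h2]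
    simp only [ht]
    ring
  have hexp : (L * √v / 16) ^ 2 = binConst ^ 2 * L * (n * q) / 4096 := by
    rw [div_pow, mul_pow, Real.sq_sqrt hv0, hv]
    field_simp
    norm_num
  refine (avg_ind_le_of_sum_abs_sub hw (J := G) (B := fun j => edgesTo j R)
    (pairwiseDisjoint_edgesTo hGR) hdep (fun j _ l ω' => ?_)
    (fun j _ ω' => sum_ind_bin_le_one L _) ω t hv1 (fun l => ?_) (S := 8 * (n * q)) (by linarith)
    (by positivity) (fun ω' h hP => ?_)).trans ?_
  · simp only [hY, ind]
    split_ifs <;> simp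
  · have h1 : ∀ j ∈ G, binConst / L * (binConst / 2)
        ≤ avg w (blocks G R) (Y j l) ω * (1 - avg w (blocks G R) (Y j l) ω) := fun j hj =>
      mul_le_mul (hpl j hj l) (hpu j hj l) (by positivity) (le_trans (by positivity) (hpl j hj l))
    refine le_trans ?_ (Finset.card_nsmul_le_sum _ _ _ h1)
    rw [nsmul_eq_mul]
    calc v = (n : ℝ) * q / 8 * (binConst / L * (binConst / 2)) := by rw [hv]; field_simp; ring
      _ ≤ _ := by gcongr
  · rw [← hZ ω' h]
    have h1 : S.card * distStat (rgraph pA ω') (rgraph pB ω') L q i k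
        ≤ 2 * (n * q) * (binConst / 128 * √(L / (n * q))) := by
      refine (mul_le_mul_of_nonneg_left hP.2.2 haS.le).trans ?_
      exact mul_le_mul_of_nonneg_right htyp.left_le (by positivity)
    refine h1.trans ?_
    refine (abs_le_of_sq_le_sq' ?_ (by positivity)).2
    rw [hexp, mul_pow, mul_pow (binConst / 128), Real.sq_sqrt (by positivity)]
    apply le_of_eq
    field_simp
    ring
  · rw [Real.exp_le_exp, hexp]
    apply le_of_eq
    have hd' : (n : ℝ) * q ≠ 0 := hd0.ne'
    generalize (n : ℝ) * q = d at hd'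
    field_simp
    norm_num

end Model

/-! ### The correlated Erdős–Rényi model as a finite weighted sum -/

instance SimpleGraph.discreteMeasurableSpace_fin (n : ℕ) :
    DiscreteMeasurableSpace (SimpleGraph (Fin n)) := by
  have : MeasurableSingletonClass (SimpleGraph (Fin n)) := ⟨fun G => by
    rw [← SimpleGraph.measurableEmbedding_edgeSet.measurableSet_image, Set.image_singleton]
    exact measurableSet_singleton _⟩
  exact MeasurableSingletonClass.toDiscreteMeasurableSpace

/-- The Bernoulli distribution. -/
def bernoulliWeight (q : ℝ) (b : Bool) : ℝ := if b then q else 1 - q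

lemma isWeight_bernoulliWeight (q : unitInterval) : IsWeight (bernoulliWeight q) where
  nonneg v := by cases v <;> simp [bernoulliWeight, q.2.1, q.2.2]
  sum_eq := by simp [bernoulliWeight]

open Classical in
lemma binomialRandom_real_singleton {n : ℕ} (q : unitInterval) (G : SimpleGraph (Fin n)) :
    (SimpleGraph.binomialRandom (Fin n) q).real {G} = expect (bernoulliWeight q)
      (fun η : Sym2 (Fin n) → Bool => if rgraph (· = true) η = G then 1 else 0) := by
  set g : Sym2 (Fin n) → Bool → ℝ := fun e b =>
    if e.IsDiag ∨ (b = true ↔ e ∈ G.edgeSet) then 1 else 0 with hg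
  have h1 : ∀ η : Sym2 (Fin n) → Bool,
      (if rgraph (· = true) η = G then (1 : ℝ) else 0) = ∏ e, g e (η e) := fun η => by
    rw [hg, Finset.prod_boole]
    congr 1
    rw [eq_iff_iff]
    constructor
    · rintro rfl e -
      induction e with | _ x y
      by_cases h : x = y
      · exact Or.inl (by simpa using h)
      · exact Or.inr (by simp [rgraph, h])
    · intro h
      ext x y
      have := h s(x, y) (Finset.mem_univ _)
      by_cases hxy : x = y
      · subst hxy; simp
      · rw [Sym2.mk_isDiag_iff, or_iff_right hxy] at this
        simpa [rgraph, hxy] using this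
  have h2 : ∀ e : Sym2 (Fin n), ∑ b, bernoulliWeight q b * g e b =
      (if e ∈ G.edgeSet then (q : ℝ) else 1) * (if ¬ e.IsDiag ∧ e ∉ G.edgeSet then (1 - q : ℝ) else 1) := by
    intro e
    by_cases hd : e.IsDiag
    · have : e ∉ G.edgeSet := fun h => G.not_isDiag_of_mem_edgeSet h hd
      simp [hg, hd, this, bernoulliWeight]
    · by_cases he : e ∈ G.edgeSet <;> simp [hg, hd, he, bernoulliWeight]
  have h3 : (Finset.univ.filter fun e : Sym2 (Fin n) => ¬ e.IsDiag ∧ e ∉ G.edgeSet).card =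
      n.choose 2 - G.edgeSet.ncard := by
    have h4 : (Finset.univ.filter fun e : Sym2 (Fin n) => ¬ e.IsDiag).card = n.choose 2 := by
      rw [← Fintype.card_subtype, Sym2.card_subtype_not_diag, Fintype.card_fin]
    have h5 : G.edgeSet.ncard = (Finset.univ.filter fun e => e ∈ G.edgeSet).card := by
      rw [Set.ncard_eq_toFinset_card']
      congr 1; ext e; simp
    rw [← h4, h5, ← Finset.card_sdiff_of_subset]
    · congr 1; ext e; simp
    · intro e he
      simp only [Finset.mem_filter, Finset.mem_univ, true_and] at he ⊢
      exact G.not_isDiag_of_mem_edgeSet he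
  have h5 : G.edgeSet.ncard = (Finset.univ.filter fun e => e ∈ G.edgeSet).card := by
      rw [Set.ncard_eq_toFinset_card']
      congr 1; ext e; simp
  simp only [expect, h1, ← Finset.prod_mul_distrib]
  rw [← Fintype.piFinset_univ, ← Finset.prod_univ_sum (fun _ => Finset.univ)
    (fun e b => bernoulliWeight q b * g e b)]
  simp only [h2]
  rw [Finset.prod_mul_distrib, Finset.prod_ite, Finset.prod_ite]
  simp only [Finset.prod_const, one_pow, mul_one]
  rw [h3, ← h5, measureReal_def, SimpleGraph.binomialRandom_singleton]
  simp [unitInterval.toNNReal]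
  rfl

lemma integral_binomialRandom {n : ℕ} (q : unitInterval) (F : SimpleGraph (Fin n) → ℝ) :
    ∫ G, F G ∂(SimpleGraph.binomialRandom (Fin n) q) =
      expect (bernoulliWeight q) (fun η => F (rgraph (· = true) η)) := by
  classical
  have := Fintype.ofFinite (SimpleGraph (Fin n))
  rw [integral_fintype Integrable.of_finite]
  simp only [binomialRandom_real_singleton, expect, Finset.sum_mul, smul_eq_mul]
  rw [Finset.sum_comm]
  refine Finset.sum_congr rfl fun η _ => ?_
  simp

lemma expect_prod {ι α β : Type*} [Fintype ι] [DecidableEq ι] [Fintype α] [Fintype β]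
    (u : α → ℝ) (v : β → ℝ) (f : (ι → α × β) → ℝ) :
    expect (fun x : α × β => u x.1 * v x.2) f
      = expect u (fun η => expect v (fun ζ => f (fun e => (η e, ζ e)))) := by
  simp only [expect]
  rw [← (Equiv.arrowProdEquivProdArrow ι (fun _ => α) (fun _ => β)).symm.sum_comp,
    Fintype.sum_prod_type]
  refine Finset.sum_congr rfl fun η _ => ?_
  rw [Finset.mul_sum]
  refine Finset.sum_congr rfl fun ζ _ => ?_
  simp only [Equiv.arrowProdEquivProdArrow, Equiv.coe_fn_symm_mk, Finset.prod_mul_distrib]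
  ring

/-- The weight of the possible values of `(A, S, T)` at a pair of vertices. -/
noncomputable def pairWeight (q s : unitInterval) (v : Bool × Bool × Bool) : ℝ :=
  bernoulliWeight q v.1 * (bernoulliWeight s v.2.1 * bernoulliWeight (flipProb q s) v.2.2)

/-- The pair is an edge of `A`. -/
def InLeft (v : Bool × Bool × Bool) : Prop := v.1 = true

/-- The pair is an edge of `B`, relabelled according to the latent permutation. -/
def InRight (v : Bool × Bool × Bool) : Prop := (v.1 = true ∧ v.2.1 = true) ∨ (v.2.2 = true ∧ v.1 ≠ true)

lemma correlatedER_real {n : ℕ} (q s : unitInterval) (π : Equiv.Perm (Fin n))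
    (E : Set (SimpleGraph (Fin n) × SimpleGraph (Fin n))) :
    (correlatedER n q s π).real E = expect (pairWeight q s)
      (ind fun ω => (rgraph InLeft ω, (rgraph InRight ω).comap π.symm) ∈ E) := by
  classical
  have hprob : ∀ p, IsProbabilityMeasure (SimpleGraph.binomialRandom (Fin n) p) := inferInstance
  rw [correlatedER, map_measureReal_apply (measurable_of_countable _) (MeasurableSet.of_discrete),
    ← integral_indicator_one (MeasurableSet.of_discrete), integral_prod _ Integrable.of_finite,
    integral_binomialRandom]
  refine Eq.trans ?_ (expect_prod (bernoulliWeight q)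
    (fun v : Bool × Bool => bernoulliWeight s v.1 * bernoulliWeight (flipProb q s) v.2) _).symm
  congr 1; ext η
  rw [integral_prod _ Integrable.of_finite, integral_binomialRandom, expect_prod (bernoulliWeight s)]
  congr 1; ext ζ
  rw [integral_binomialRandom]
  congr 1; ext θ
  rw [Set.indicator_apply, ind]
  have h1 : rgraph InLeft (fun e => (η e, ζ e, θ e)) = rgraph (· = true) η := rfl
  have h2 : (rgraph InRight (fun e => (η e, ζ e, θ e))).comap π.symm =
      noisyCopy π (rgraph (· = true) η) (rgraph (· = true) ζ) (rgraph (· = true) θ) := by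
    rw [noisyCopy]
    congr 1
    ext x y
    simp only [rgraph, InRight, SimpleGraph.sup_adj, SimpleGraph.inf_adj, SimpleGraph.sdiff_adj]
    tauto
  rw [h1, h2]
  rfl

lemma coe_flipProb {q : unitInterval} (s : unitInterval) (hq : (q : ℝ) ≤ 1 / 2) :
    (flipProb q s : ℝ) = q * (1 - s) / (1 - q) := by
  have h1 := q.2.1
  have h2 := s.2.1
  have h3 := s.2.2
  rw [flipProb, Set.projIcc_of_mem zero_le_one ⟨?_, ?_⟩]
  · exact div_nonneg (mul_nonneg h1 (by linarith)) (by linarith)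
  · rw [div_le_one (by linarith)]
    nlinarith

lemma isPairWeight_pairWeight {q : unitInterval} (s : unitInterval) (hq : (q : ℝ) ≤ 1 / 2) :
    IsPairWeight (pairWeight q s) InLeft InRight q (q * (1 - s)) := by
  have h1 : (1 - q : ℝ) ≠ 0 := by linarith
  have hf := coe_flipProb s hq
  refine ⟨⟨fun v => ?_, ?_⟩, ?_, ?_, ?_, ?_⟩
  · exact mul_nonneg ((isWeight_bernoulliWeight q).nonneg _) (mul_nonneg
      ((isWeight_bernoulliWeight s).nonneg _) ((isWeight_bernoulliWeight _).nonneg _))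
  all_goals
    simp only [Fintype.sum_prod_type, Fintype.sum_bool, pairWeight, bernoulliWeight, ind, InLeft,
      InRight, hf]
    simp
    field_simp
    ring

/-! ### Relabelling, outputs of the algorithm, edges -/

section Relabel

variable {n : ℕ}

lemma nbrs_comap (G : SimpleGraph (Fin n)) (π : Equiv.Perm (Fin n)) (k : Fin n) :
    nbrs (G.comap π.symm) (π k) = (nbrs G k).map π.toEmbedding := by
  ext x
  rw [Finset.mem_map_equiv, mem_nbrs, mem_nbrs, SimpleGraph.comap_adj, Equiv.symm_apply_apply]

lemma deg_comap (G : SimpleGraph (Fin n)) (π : Equiv.Perm (Fin n)) (k : Fin n) :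
    deg (G.comap π.symm) (π k) = deg G k := by
  rw [deg, nbrs_comap, Finset.card_map, deg]

lemma stdOutdeg_comap (G : SimpleGraph (Fin n)) (π : Equiv.Perm (Fin n)) (q : unitInterval)
    (k j : Fin n) : stdOutdeg (G.comap π.symm) q (π k) (π j) = stdOutdeg G q k j := by
  rw [stdOutdeg, stdOutdeg, deg_comap, nbrs_comap]
  congr 1
  refine Finset.sum_bij' (fun x _ => π.symm x) (fun x _ => π x) (fun x hx => ?_) (fun x hx => ?_)
    (fun x _ => by simp) (fun x _ => by simp) (fun x _ => ?_)
  · simpa [Equiv.symm_apply_eq] using hx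
  · simpa using hx
  · have h : (G.comap π.symm).Adj x (π j) ↔ G.Adj (π.symm x) j := by simp [SimpleGraph.comap_adj]
    by_cases hx : G.Adj (π.symm x) j
    · rw [if_pos hx, if_pos (h.2 hx)]
    · rw [if_neg hx, if_neg (mt h.1 hx)]

lemma centeredProfile_comap (G : SimpleGraph (Fin n)) (π : Equiv.Perm (Fin n)) (q : unitInterval)
    (k : Fin n) : centeredProfile (G.comap π.symm) q (π k) = centeredProfile G q k := by
  have h : profile (G.comap π.symm) q (π k) = profile G q k := by
    rw [profile, profile, deg_comap, nbrs_comap, Finset.sum_map]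
    simp [stdOutdeg_comap]
  unfold centeredProfile
  simp only [h, deg_comap]

lemma distStat_comap (A B : SimpleGraph (Fin n)) (π : Equiv.Perm (Fin n)) (L : ℕ) (q : unitInterval)
    (i k : Fin n) : distStat A (B.comap π.symm) L q i (π k) = distStat A B L q i k := by
  simp only [distStat, centeredProfile_comap]

lemma eq_of_isSmallest {Z : Fin n → Fin n → ℝ} {S M : Finset (Fin n × Fin n)}
    (hS : IsSmallest Z S) (hM : M.card = n) (h : ∀ p ∈ M, ∀ r ∉ M, Z p.1 p.2 < Z r.1 r.2) :
    S = M := by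
  by_contra hne
  have h1 : ∃ p ∈ M, p ∉ S := by
    by_contra! h1
    exact hne (Finset.eq_of_subset_of_card_le h1 (by rw [hM, hS.1])).symm
  have h2 : ∃ p ∈ S, p ∉ M := by
    by_contra! h2
    exact hne (Finset.eq_of_subset_of_card_le h2 (by rw [hM, hS.1]))
  obtain ⟨p, hpM, hpS⟩ := h1
  obtain ⟨r, hrS, hrM⟩ := h2
  exact absurd (hS.2 r hrS p hpS) (not_le.2 (h p hpM r hrM))

lemma eq_some_of_isMatchingOutput {A B : SimpleGraph (Fin n)} {L : ℕ} {q : unitInterval}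
    {π : Equiv.Perm (Fin n)} {o : Option (Equiv.Perm (Fin n))} (ho : IsMatchingOutput A B L q o)
    (h : ∀ i l k, l ≠ k → distStat A B L q i (π i) < distStat A B L q l (π k)) : o = some π := by
  obtain ⟨S, hS, hρ⟩ := ho
  have hSM := eq_of_isSmallest (M := Finset.univ.image fun i => (i, π i)) hS (by
    rw [Finset.card_image_of_injective _ fun i j hij => (Prod.ext_iff.1 hij).1, Finset.card_fin]) (by
    rintro p hp ⟨l, k⟩ hr
    obtain ⟨i, -, rfl⟩ := Finset.mem_image.1 hp
    have := h i l (π.symm k) fun hl => hr (Finset.mem_image.2 ⟨l, Finset.mem_univ _, by rw [hl]; simp⟩)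
    simpa using this)
  rw [hρ]
  intro i k
  rw [hSM]
  simp [eq_comm]

lemma deg_le_maxDeg (G : SimpleGraph (Fin n)) (i : Fin n) : deg G i ≤ maxDeg G :=
  Finset.le_sup (f := deg G) (Finset.mem_univ i)

lemma maxDeg_le {G : SimpleGraph (Fin n)} {x : ℝ} (hx : 0 ≤ x) (h : ∀ i, (deg G i : ℝ) ≤ x) :
    (maxDeg G : ℝ) ≤ x := by
  rw [← Nat.le_floor_iff hx, maxDeg, Finset.sup_le_iff]
  exact fun i _ => Nat.le_floor (h i)

lemma sum_deg (G : SimpleGraph (Fin n)) : ∑ i, deg G i = 2 * numEdges G := by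
  classical
  have h1 := G.sum_degrees_eq_twice_card_edges
  have h2 : numEdges G = G.edgeFinset.card := by
    rw [numEdges, ← SimpleGraph.coe_edgeFinset, Set.ncard_coe_finset]
  rw [h2, ← h1]
  refine Finset.sum_congr rfl fun i _ => ?_
  rw [deg, ← SimpleGraph.card_neighborFinset_eq_degree]
  congr 1
  ext x
  simp [mem_nbrs]

lemma numEdges_le (G : SimpleGraph (Fin n)) : numEdges G ≤ n * maxDeg G := by
  have h1 := sum_deg G
  have h2 : ∑ i, deg G i ≤ _ := Finset.sum_le_card_nsmul _ _ (maxDeg G) fun i _ => deg_le_maxDeg G i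
  rw [Finset.card_univ, Fintype.card_fin, smul_eq_mul] at h2
  omega

lemma numEdges_mul_maxDeg_le {G : SimpleGraph (Fin n)} {x : ℝ} (hx : 0 ≤ x)
    (h : ∀ i, (deg G i : ℝ) ≤ x) : (numEdges G : ℝ) * maxDeg G ≤ n * x ^ 2 := by
  have h1 := maxDeg_le hx h
  have h2 : (numEdges G : ℝ) ≤ n * maxDeg G := by exact_mod_cast numEdges_le G
  have h3 : (0 : ℝ) ≤ maxDeg G := Nat.cast_nonneg _
  calc (numEdges G : ℝ) * maxDeg G ≤ n * maxDeg G * maxDeg G := by gcongr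
    _ ≤ n * x * x := by gcongr
    _ = _ := by ring

end Relabel

/-! ### Union bound -/

section Union

variable {ι V : Type*} [Fintype ι] [DecidableEq ι] [Fintype V] {w : V → ℝ}

lemma expect_ind_or (hw : IsWeight w) {P Q : (ι → V) → Prop} {a b : ℝ} (hP : expect w (ind P) ≤ a)
    (hQ : expect w (ind Q) ≤ b) : expect w (ind fun ω => P ω ∨ Q ω) ≤ a + b := by
  refine (expect_mono hw fun ω => ?_).trans ((expect_add _ _).le.trans (add_le_add hP hQ))
  by_cases h1 : P ω
  · rw [ind_of (p := fun ω => P ω ∨ Q ω) (Or.inl h1), ind_of h1]; linarith [ind_nonneg Q ω]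
  · by_cases h2 : Q ω
    · rw [ind_of (p := fun ω => P ω ∨ Q ω) (Or.inr h2), ind_of h2]; linarith [ind_nonneg P ω]
    · rw [ind_of_not (p := fun ω => P ω ∨ Q ω) (by tauto)]; linarith [ind_nonneg P ω, ind_nonneg Q ω]

lemma one_sub_le_expect (hw : IsWeight w) {κ : Type*} (s : Finset κ) {P : κ → (ι → V) → Prop}
    {Q : (ι → V) → Prop} {b : ℝ} (hP : ∀ k ∈ s, expect w (ind (P k)) ≤ b)
    (h : ∀ ω, (∀ k ∈ s, ¬ P k ω) → Q ω) : 1 - s.card * b ≤ expect w (ind Q) := by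
  have h1 : expect w (fun _ : ι → V => (1 : ℝ))
      ≤ expect w (fun ω => ind Q ω + ∑ k ∈ s, ind (P k) ω) := by
    refine expect_mono hw fun ω => ?_
    have h2 : 0 ≤ ∑ k ∈ s, ind (P k) ω := Finset.sum_nonneg fun k _ => ind_nonneg _ _
    by_cases hQ : Q ω
    · rw [ind_of hQ]; linarith
    · have : ∃ k ∈ s, P k ω := by
        by_contra! h'
        exact hQ (h ω h')
      obtain ⟨k, hk, hPk⟩ := this
      have h3 := Finset.single_le_sum (f := fun k => ind (P k) ω) (fun k _ => ind_nonneg _ _) hk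
      rw [ind_of hPk] at h3
      linarith [ind_nonneg Q ω]
  rw [expect_const hw, expect_add, expect_sum] at h1
  have h2 := Finset.sum_le_card_nsmul s (fun k => expect w (ind (P k))) b hP
  rw [nsmul_eq_mul] at h2
  linarith

end Union

/-! ### The latent permutation minimizes the distance statistic -/

/-- The distance statistics of the true pairs are smaller than those of the wrong pairs, and the
degrees are at most twice the expected ones. -/
structure IsSeparated {n : ℕ} (A B : SimpleGraph (Fin n)) (L : ℕ) (q : unitInterval) : Prop where
  lt : ∀ i l k, l ≠ k → distStat A B L q i i < distStat A B L q l k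
  left : ∀ i, (deg A i : ℝ) ≤ 2 * (n * q)
  right : ∀ i, (deg B i : ℝ) ≤ 2 * (n * q)

lemma expect_isSeparated {n L : ℕ} {V : Type*} [Fintype V] {w : V → ℝ} {pA pB : V → Prop}
    {q : unitInterval} {ν ε δ : ℝ} (h : IsPairWeight w pA pB q ν) (hν : ν ≤ 1)
    (ht : TrueParams n L q ν (binConst / 128) ε δ (2 * (n * ν) + 3 * Real.log n))
    (hp : WrongParams n L q) (hd : 384 * Real.log n ≤ n * q)
    (hL : 3 * Real.log n ≤ (binConst / 128) ^ 2 * L / 9216) :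
    1 - 12 / n ≤ expect w (ind fun ω : Sym2 (Fin n) → V => IsSeparated (rgraph pA ω) (rgraph pB ω) L q) := by
  classical
  have hw := h.weight
  have hn : (8 : ℝ) ≤ n := by exact_mod_cast hp.n_ge
  have hn0 : (0 : ℝ) < n := by linarith
  set b := Real.exp (-(3 * Real.log n)) with hb
  have hb' : b = 1 / (n : ℝ) ^ 3 := by
    rw [hb, Real.exp_neg, mul_comm, Real.exp_mul, Real.exp_log hn0, one_div]
    norm_cast
  have hlog : 0 ≤ Real.log n := Real.log_nonneg (by linarith)
  have hexp : ∀ x : ℝ, 3 * Real.log n ≤ x → Real.exp (-x) ≤ b := fun x hx => by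
    rw [hb, Real.exp_le_exp]; linarith
  have hq0 := hp.q_pos
  have hd' := hp.d_ge
  set Δ := 2 * (n * ν) + 3 * Real.log n with hΔ
  have e1 := fun i => expect_degree (n := n) hw h.left hq0.le q.2.2 (by linarith) i
  have e2 := fun i => expect_degree (n := n) hw h.right hq0.le q.2.2 (by linarith) i
  have e3 := fun i => expect_sdiff (n := n) (Δ := Δ) hw h.left_not_right hν i
  have e4 := fun i => expect_sdiff (n := n) (Δ := Δ) hw h.right_not_left hν i
  have e5 := fun i => expect_true_pair h ht i
  have e6 := fun i k => expect_regularSet (n := n) (pB := pB) hw h.left hq0 hp.q_le hp.d_ge i k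
  have e7 := fun i k => expect_wrong_pair (pB := pB) hw h.left hp i k
  have hΔ' : 2 * (n * ν) - Δ = - (3 * Real.log n) := by rw [hΔ]; ring
  have hbad := fun p : Fin n × Fin n =>
    expect_ind_or hw (e1 p.1).1 <| expect_ind_or hw (e1 p.1).2 <|
    expect_ind_or hw (e2 p.1).1 <| expect_ind_or hw (e2 p.1).2 <|
    expect_ind_or hw (e3 p.1) <| expect_ind_or hw (e4 p.1) <|
    expect_ind_or hw (e5 p.1) <| expect_ind_or hw (e6 p.1 p.2) (e7 p.1 p.2)
  have h8 : ∀ p : Fin n × Fin n, expect w (ind fun ω : Sym2 (Fin n) → V => p.1 ≠ p.2 ∧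
      ((nbrs (rgraph pA ω) p.1).card : ℝ) ≤ 2 * (n * q) ∧
      (n : ℝ) * q / 8 < ((nbrs (rgraph pA ω) p.1 ∩ nbrs (rgraph pB ω) p.2).card : ℝ)) ≤ b := by
    intro p
    by_cases hp' : p.1 = p.2
    · refine (expect_mono hw fun ω => (ind_of_not (by simp [hp'])).le).trans ?_
      rw [expect_const hw]; exact (Real.exp_pos _).le
    · refine (expect_mono hw fun ω => ind_mono fun h => h.2).trans
        ((expect_inter hw h.right hq0 hp.q_le hp').trans (hexp _ (by linarith)))
  have key := one_sub_le_expect hw (Finset.univ : Finset (Fin n × Fin n))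
    (P := fun p ω => _) (Q := fun ω => IsSeparated (rgraph pA ω) (rgraph pB ω) L q) (b := 12 * b)
    (fun p _ => (expect_ind_or hw (hbad p) (h8 p)).trans ?_) ?_
  · refine le_trans (le_of_eq ?_) key
    rw [Finset.card_univ, Fintype.card_prod, Fintype.card_fin, hb']
    push_cast
    field_simp
  · have f1 := hexp ((n : ℝ) * q / 10) (by linarith)
    have f2 := hexp ((n : ℝ) * q / 128) (by linarith)
    have f3 := hexp _ hL
    have f4 := hexp (binConst ^ 2 * L / 65536) (by
      have : (binConst / 128) ^ 2 * L / 9216 ≤ binConst ^ 2 * L / 65536 := by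
        have : 0 ≤ binConst ^ 2 * L := by positivity
        rw [div_pow]
        field_simp
        linarith
      linarith)
    rw [hΔ']
    linarith
  · intro ω hω
    have hω' := fun i k => hω (i, k) (Finset.mem_univ _)
    simp only [not_or, not_lt] at hω'
    have htrue : ∀ i, distStat (rgraph pA ω) (rgraph pB ω) L q i i < binConst / 128 * √(L / (n * q)) := by
      intro i
      obtain ⟨⟨a1, a2, a3, a4, a5, a6, a7, -⟩, -⟩ := hω' i i
      rw [← not_le]
      exact fun hle => a7 ⟨⟨a2, a1, a4, a3, a5, a6⟩, hle⟩
    have hwrong : ∀ i k, i ≠ k →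
        binConst / 128 * √(L / (n * q)) < distStat (rgraph pA ω) (rgraph pB ω) L q i k := by
      intro i k hik
      obtain ⟨⟨a1, a2, -, -, -, -, -, a8, a9⟩, a10⟩ := hω' i k
      obtain ⟨⟨b1, -, b3, -⟩, -⟩ := hω' k k
      have hty : IsTypicalWrongPair n q (nbrs (rgraph pA ω) i) (nbrs (rgraph pB ω) k) :=
        ⟨a2, a1, b3, by
          by_contra hlt
          exact a10 ⟨hik, a1, not_le.1 hlt⟩⟩
      rw [← not_le]
      refine fun hle => a9 ⟨hty, ?_, hle⟩
      by_contra hlt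
      exact a8 ⟨hty, not_le.1 hlt⟩
    exact ⟨fun i l k hlk => (htrue i).trans (hwrong l k hlk), fun i => (hω' i i).1.1,
      fun i => (hω' i i).1.2.2.1⟩

/-! ### Choice of the constants -/

lemma exists_log_pow_le {c : ℝ} (hc : 0 < c) : ∃ n₀ : ℕ, 8 ≤ n₀ ∧ ∀ n : ℕ, n₀ ≤ n →
    Real.log n ^ 3 ≤ c * n := by
  have h1 := (isLittleO_log_rpow_atTop (r := 1 / 3) (by norm_num)).comp_tendsto tendsto_natCast_atTop_atTop
  have h2 := (h1.pow (n := 3) (by norm_num)).bound hc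
  obtain ⟨N, hN⟩ := Filter.eventually_atTop.1 h2
  refine ⟨max 8 N, le_max_left _ _, fun n hn => ?_⟩
  have h3 := hN n ((le_max_right _ _).trans hn)
  have hn0 : (0 : ℝ) ≤ n := Nat.cast_nonneg n
  simp only [Function.comp_apply, norm_pow, Real.norm_eq_abs] at h3
  rw [abs_of_nonneg (Real.rpow_nonneg hn0 _), ← Real.rpow_natCast, ← Real.rpow_natCast,
    ← Real.rpow_mul hn0] at h3
  norm_num at h3
  rwa [abs_of_nonneg (Real.log_natCast_nonneg n)] at h3

set_option maxHeartbeats 1000000 in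
/-- For suitable constants, the numerical assumptions of the analysis are satisfied. -/
lemma exists_constants {L₀ : ℝ} (hL₀ : 9216 * 3 * 16384 / binConst ^ 2 ≤ L₀) :
    ∃ σ₀ : ℝ, 0 < σ₀ ∧ ∃ C₀ : ℝ, 0 < C₀ ∧ ∃ n₀ : ℕ, 8 ≤ n₀ ∧ ∃ ε δ : ℝ, ∀ (n : ℕ) (q σ : ℝ), n₀ ≤ n →
      0 ≤ q → q ≤ 1 / 64 → 0 ≤ σ → σ ≤ σ₀ / Real.log n → C₀ * Real.log n ^ 2 ≤ n * q →
      1 ≤ Real.log n ∧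
      TrueParams n ⌈L₀ * Real.log n⌉₊ q (q * σ ^ 2) (binConst / 128) ε δ
        (2 * (n * (q * σ ^ 2)) + 3 * Real.log n) ∧
      WrongParams n ⌈L₀ * Real.log n⌉₊ q ∧ 384 * Real.log n ≤ n * q ∧
      3 * Real.log n ≤ (binConst / 128) ^ 2 * (⌈L₀ * Real.log n⌉₊ : ℝ) / 9216 ∧
      (⌈L₀ * Real.log n⌉₊ : ℝ) ≤ 2 * L₀ * Real.log n := by
  set β := binConst with hβ
  have hβ0 : 0 < β := binConst_pos
  have hβ1 : β ≤ 1 := binConst_le_one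
  clear_value β
  have hL₀' : 2 ≤ L₀ := by
    refine le_trans ?_ hL₀
    rw [le_div_iff₀ (by positivity)]
    nlinarith
  set ε := (β / 128) ^ 2 / 3456 with hε
  have hε0 : 0 < ε := by positivity
  have hε1 : ε ≤ 1 := by
    rw [hε, div_le_one (by norm_num), div_pow]
    rw [div_le_iff₀ (by norm_num)]
    nlinarith
  set E := 12 * Real.exp 66 with hE
  have hE1 : 1 ≤ E := by
    have := Real.add_one_le_exp (66 : ℝ)
    rw [hE]; linarith
  set δ := ε / E with hδ
  have hδ0 : 0 < δ := by positivity
  have hδ1 : δ ≤ 1 := by rw [hδ, div_le_one (by linarith)]; linarith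
  set η := δ ^ 2 * ε / 3 with hη
  have hη0 : 0 < η := by positivity
  obtain ⟨n₀, hn₀, hlog3⟩ := exists_log_pow_le (c := η / (1152 * L₀ ^ 2)) (by positivity)
  set σ₀ := min 1 (min (ε / 4) (η / (896 * L₀ ^ 2))) with hσ₀
  have s0 : 0 < σ₀ := by positivity
  have s1 : σ₀ ≤ 1 := min_le_left _ _
  have s2 : σ₀ ≤ ε / 4 := (min_le_right _ _).trans (min_le_left _ _)
  have s3 : σ₀ ≤ η / (896 * L₀ ^ 2) := (min_le_right _ _).trans (min_le_right _ _)
  set C₀ := max (6 / ε) (max 384 (max ((2 * L₀ * E / ε) ^ 2) (max (32 * L₀ / β ^ 2) ((8 * L₀) ^ 2)))) with hC₀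
  have c1 : 6 / ε ≤ C₀ := le_max_left _ _
  have c2' : max 384 (max ((2 * L₀ * E / ε) ^ 2) (max (32 * L₀ / β ^ 2) ((8 * L₀) ^ 2))) ≤ C₀ := le_max_right _ _
  have c2 : 384 ≤ C₀ := (le_max_left _ _).trans c2'
  have c3' := (le_max_right _ _).trans c2'
  have c3 : (2 * L₀ * E / ε) ^ 2 ≤ C₀ := (le_max_left _ _).trans c3'
  have c4' := (le_max_right _ _).trans c3'
  have c4 : 32 * L₀ / β ^ 2 ≤ C₀ := (le_max_left _ _).trans c4'
  have c5 : (8 * L₀) ^ 2 ≤ C₀ := (le_max_right _ _).trans c4'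
  clear_value σ₀ C₀
  refine ⟨σ₀, s0, C₀, by linarith, n₀, hn₀, ε, δ, fun n q σ hn hq0 hq1 hσ0 hσ hd => ?_⟩
  have hn8 : 8 ≤ n := hn₀.trans hn
  have hn8' : (8 : ℝ) ≤ n := by exact_mod_cast hn8
  have hl3 := hlog3 n hn
  set l := Real.log n with hl
  have hl1 : 1 ≤ l := by
    rw [hl, Real.le_log_iff_exp_le (by linarith)]
    linarith [Real.exp_one_lt_d9]
  set L := ⌈L₀ * l⌉₊ with hL
  have hLl : L₀ * l ≤ (L : ℝ) := Nat.le_ceil _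
  have hLu : (L : ℝ) ≤ 2 * L₀ * l := by
    have := (Nat.ceil_lt_add_one (a := L₀ * l) (by positivity)).le
    have h2 : 1 ≤ L₀ * l := by nlinarith
    linarith
  have hL2 : 2 ≤ L := by
    have : (2 : ℝ) ≤ L := by nlinarith
    exact_mod_cast this
  clear_value L l
  have hll : l ≤ l ^ 2 := by nlinarith
  have hdl : C₀ * l ≤ n * q := le_trans (by gcongr) hd
  have hd384 : 384 * l ≤ n * q := le_trans (by gcongr) hdl
  have hdpos : 0 < n * q := by linarith
  have hqpos : 0 < q := by
    rcases hq0.eq_or_lt with h | h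
    · rw [← h] at hdpos; simp at hdpos
    · exact h
  have hsqrt : ∀ c, 0 ≤ c → c ^ 2 ≤ C₀ → c * l ≤ √(n * q) := fun c hc h => by
    apply Real.le_sqrt_of_sq_le
    rw [mul_pow]
    exact le_trans (by gcongr) hd
  have hσl : σ * l ≤ σ₀ := by rwa [le_div_iff₀ (by linarith)] at hσ
  have hσ1 : σ ^ 2 * l ^ 2 ≤ σ₀ := by
    calc σ ^ 2 * l ^ 2 = (σ * l) ^ 2 := by ring
      _ ≤ σ₀ ^ 2 := by gcongr
      _ ≤ σ₀ := pow_le_of_le_one s0.le s1 (by norm_num)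
  have hσ2 : σ ^ 2 ≤ σ₀ :=
    le_trans (le_mul_of_one_le_right (sq_nonneg σ) (one_le_pow₀ hl1)) hσ1
  have hβL : β ^ 2 * L₀ ≥ 9216 * 3 * 16384 := by
    rw [div_le_iff₀ (by positivity)] at hL₀; linarith
  refine ⟨hl1, ⟨by omega, by omega, hqpos, hq1, by positivity, hε0, hε1, ?_, ?_, hδ0, hδ1, ?_,
    by linarith, ?_, ?_⟩, ⟨hn8, hL2, hqpos, hq1, by linarith, ?_, ?_⟩, hd384, ?_, hLu⟩
  · rw [hε]; apply le_of_eq; ring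
  · have h1 : 3 * l ≤ ε / 2 * (n * q) := by
      have : 6 / ε * l ≤ n * q := le_trans (by gcongr) hdl
      calc 3 * l = ε / 2 * (6 / ε * l) := by field_simp; ring
        _ ≤ _ := by gcongr
    have h2 : 2 * (n * (q * σ ^ 2)) ≤ ε / 2 * (n * q) := by
      have : 2 * (n * q) * σ ^ 2 ≤ 2 * (n * q) * (ε / 4) := by gcongr; exact hσ2.trans s2
      linarith
    linarith
  · rw [hδ, ← hE]; apply le_of_eq; field_simp
  · have h1 := hsqrt (2 * L₀ * E / ε) (by positivity) c3
    calc E * L ≤ E * (2 * L₀ * l) := by gcongr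
      _ = ε * (2 * L₀ * E / ε * l) := by field_simp
      _ ≤ _ := by gcongr
  · have h1 : (L : ℝ) ^ 2 ≤ 4 * L₀ ^ 2 * l ^ 2 := by
      calc (L : ℝ) ^ 2 ≤ (2 * L₀ * l) ^ 2 := by gcongr
        _ = _ := by ring
    have h2 : 16 * (q * σ ^ 2 / q) + 48 * ((2 * (n * (q * σ ^ 2)) + 3 * l) / n)
        ≤ 112 * σ ^ 2 + 144 * (l / n) := by
      have e1 : q * σ ^ 2 / q = σ ^ 2 := by field_simp
      have e2 : (2 * (n * (q * σ ^ 2)) + 3 * l) / n = 2 * q * σ ^ 2 + 3 * (l / n) := by field_simp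
      rw [e1, e2]
      have : q * σ ^ 2 ≤ 1 * σ ^ 2 := by gcongr; linarith
      linarith
    have h3 : 4 * L₀ ^ 2 * 112 * (σ ^ 2 * l ^ 2) ≤ η / 2 := by
      calc 4 * L₀ ^ 2 * 112 * (σ ^ 2 * l ^ 2) ≤ 4 * L₀ ^ 2 * 112 * (η / (896 * L₀ ^ 2)) := by
            gcongr; linarith
        _ = _ := by field_simp; norm_num
    have h4 : 4 * L₀ ^ 2 * 144 * (l ^ 3 / n) ≤ η / 2 := by
      have : l ^ 3 / n ≤ η / (1152 * L₀ ^ 2) := by rwa [div_le_iff₀ (by linarith)]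
      calc 4 * L₀ ^ 2 * 144 * (l ^ 3 / n) ≤ 4 * L₀ ^ 2 * 144 * (η / (1152 * L₀ ^ 2)) := by gcongr
        _ = _ := by field_simp; norm_num
    calc (L : ℝ) ^ 2 * (16 * (q * σ ^ 2 / q) + 48 * ((2 * (n * (q * σ ^ 2)) + 3 * l) / n))
        ≤ 4 * L₀ ^ 2 * l ^ 2 * (112 * σ ^ 2 + 144 * (l / n)) := by gcongr
      _ = 4 * L₀ ^ 2 * 112 * (σ ^ 2 * l ^ 2) + 4 * L₀ ^ 2 * 144 * (l ^ 3 / n) := by ring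
      _ ≤ η := by linarith
  · have := hsqrt (8 * L₀) (by positivity) c5
    linarith
  · rw [← hβ]
    have h1 : 32 * L₀ / β ^ 2 * l ≤ n * q := le_trans (by gcongr) hdl
    calc 16 * (L : ℝ) ≤ 16 * (2 * L₀ * l) := by gcongr
      _ = β ^ 2 * (32 * L₀ / β ^ 2 * l) := by field_simp; ring
      _ ≤ _ := by gcongr
  · calc 3 * l ≤ β ^ 2 * L₀ / (9216 * 16384) * l := by
          gcongr
          rw [le_div_iff₀ (by norm_num)]
          linarith
      _ = (β / 128) ^ 2 * (L₀ * l) / 9216 := by field_simp; ring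
      _ ≤ _ := by gcongr

/-- In the correlated Erdős–Rényi model, the algorithm recovers the latent permutation with
probability `1 - O(1/n)`, and a program which carries out the algorithm within the time bound of the
first part of the main theorem does so in time `O((n d² + n²) (log n)^κ)`. -/
theorem recovery_of_running_time {P : RealRAM.Cmd} {κ : ℕ} {K₀ : ℝ}
    (hP : ∀ (n L : ℕ) (q : unitInterval) (A B : SimpleGraph (Fin n))
        (adjA adjB : Fin n → List (Fin n)), 1 ≤ n → 1 ≤ L → 0 < (q : ℝ) → (q : ℝ) < 1 →
      RealRAM.IsAdjList A adjA → RealRAM.IsAdjList B adjB →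
      ∃ o : Option (Equiv.Perm (Fin n)), IsMatchingOutput A B L q o ∧
        RealRAM.Computes P (RealRAM.inputMem adjA adjB L q) o
          (K₀ * ((numEdges A : ℝ) * maxDeg A + (numEdges B : ℝ) * maxDeg B + (n : ℝ) ^ 2) *
            ((L : ℝ) + Real.log n) ^ κ)) :
    ∃ q₀ : ℝ, 0 < q₀ ∧ ∃ Lmin : ℝ, 0 < Lmin ∧ ∀ L₀ : ℝ, Lmin ≤ L₀ →
      ∃ σ₀ : ℝ, 0 < σ₀ ∧ ∃ C₀ : ℝ, 0 < C₀ ∧ ∃ K : ℝ,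
        ∀ (n : ℕ) (q s : unitInterval) (σ : ℝ) (π : Equiv.Perm (Fin n)),
          2 ≤ n → (q : ℝ) ≤ q₀ → 0 ≤ σ → (s : ℝ) = 1 - σ ^ 2 →
          σ ≤ σ₀ / Real.log n → C₀ * Real.log n ^ 2 ≤ (n : ℝ) * q →
          1 - K / n ≤ (correlatedER n q s π).real
            {w | (∀ o, IsMatchingOutput w.1 w.2 ⌈L₀ * Real.log n⌉₊ q o → o = some π) ∧
              ∀ adjA adjB : Fin n → List (Fin n),
                RealRAM.IsAdjList w.1 adjA → RealRAM.IsAdjList w.2 adjB →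
                RealRAM.Computes P (RealRAM.inputMem adjA adjB ⌈L₀ * Real.log n⌉₊ q) (some π)
                  (K * ((n : ℝ) * ((n : ℝ) * q) ^ 2 + (n : ℝ) ^ 2) * Real.log n ^ κ)} := by
  refine ⟨1 / 64, by norm_num, 9216 * 3 * 16384 / binConst ^ 2, ?_, fun L₀ hL₀ => ?_⟩
  · have := binConst_pos
    positivity
  have hL₀' : 0 < L₀ := lt_of_lt_of_le (by have := binConst_pos; positivity) hL₀
  obtain ⟨σ₀, hσ₀, C₀, hC₀, n₀, hn₀, ε, δ, hconst⟩ := exists_constants hL₀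
  have hn₀' : (8 : ℝ) ≤ n₀ := by exact_mod_cast hn₀
  set K₁ := 8 * |K₀| * (2 * L₀ + 1) ^ κ with hK₁
  have hK₁0 : 0 ≤ K₁ := by positivity
  refine ⟨σ₀, hσ₀, C₀, hC₀, 12 + n₀ + K₁, fun n q s σ π hn hq hσ hs hσ' hd => ?_⟩
  have hn' : (2 : ℝ) ≤ n := by exact_mod_cast hn
  rcases lt_or_ge n n₀ with hlt | hge
  · refine le_trans ?_ measureReal_nonneg
    rw [sub_nonpos, one_le_div (by linarith)]
    have : (n : ℝ) ≤ n₀ := by exact_mod_cast hlt.le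
    linarith
  obtain ⟨hl, ht, hw, hd384, hL, hLu⟩ := hconst n q σ hge q.2.1 hq hσ hσ' hd
  set L := ⌈L₀ * Real.log n⌉₊ with hLdef
  have hpw := isPairWeight_pairWeight s (q := q) (by linarith)
  have hs' : (1 : ℝ) - s = σ ^ 2 := by rw [hs]; ring
  rw [hs'] at hpw
  have hν : (q : ℝ) * σ ^ 2 ≤ 1 := by
    have h1 : σ ^ 2 ≤ 1 := by rw [← hs']; linarith [s.2.1]
    exact mul_le_one₀ q.2.2 (sq_nonneg σ) h1
  have key := expect_isSeparated hpw hν ht hw hd384 hL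
  rw [correlatedER_real]
  refine le_trans ?_ (key.trans (expect_mono hpw.weight fun ω => ind_mono fun hsep => ?_))
  · have : (12 : ℝ) / n ≤ (12 + n₀ + K₁) / n := by gcongr; linarith
    linarith
  have hout : ∀ o, IsMatchingOutput (rgraph InLeft ω) ((rgraph InRight ω).comap π.symm) L q o →
      o = some π := fun o ho => eq_some_of_isMatchingOutput ho fun i l k hlk => by
    rw [distStat_comap, distStat_comap]
    exact hsep.lt i l k hlk
  refine ⟨hout, fun adjA adjB hA hB => ?_⟩
  have hd0 : 0 ≤ (n : ℝ) * q := mul_nonneg (Nat.cast_nonneg _) q.2.1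
  obtain ⟨o, ho, m', t, hrun, hm', hT⟩ := hP n L q _ _ adjA adjB (by omega) ht.L_ge ht.q_pos
    (by linarith) hA hB
  rw [hout o ho] at hm'
  refine ⟨m', t, hrun, hm', hT.trans ?_⟩
  have hEA := numEdges_mul_maxDeg_le (by positivity) hsep.left
  have hEB : (numEdges ((rgraph InRight ω).comap π.symm) : ℝ) *
      maxDeg ((rgraph InRight ω).comap π.symm) ≤ n * (2 * (n * q)) ^ 2 := by
    refine numEdges_mul_maxDeg_le (by positivity) fun i => ?_
    have := hsep.right (π.symm i)
    rwa [← deg_comap _ π, Equiv.apply_symm_apply] at this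
  set X := (n : ℝ) * (n * q) ^ 2 with hX
  have hX0 : 0 ≤ X := by positivity
  have hlκ : 0 ≤ Real.log n ^ κ := by positivity
  set EA := (numEdges (rgraph InLeft ω) : ℝ) * maxDeg (rgraph InLeft ω)
  set EB := (numEdges ((rgraph InRight ω).comap π.symm) : ℝ) * maxDeg ((rgraph InRight ω).comap π.symm)
  have hEA0 : 0 ≤ EA := by positivity
  have hEB0 : 0 ≤ EB := by positivity
  have hsum : EA + EB + (n : ℝ) ^ 2 ≤ 8 * (X + (n : ℝ) ^ 2) := by
    have h2 : (n : ℝ) * (2 * (n * q)) ^ 2 = 4 * X := by rw [hX]; ring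
    nlinarith
  have hLlog : (L : ℝ) + Real.log n ≤ (2 * L₀ + 1) * Real.log n := by linarith
  calc K₀ * (EA + EB + (n : ℝ) ^ 2) * ((L : ℝ) + Real.log n) ^ κ
      ≤ |K₀| * (8 * (X + (n : ℝ) ^ 2)) * ((2 * L₀ + 1) * Real.log n) ^ κ := by
        gcongr
        exact le_abs_self _
    _ = K₁ * (X + (n : ℝ) ^ 2) * Real.log n ^ κ := by rw [mul_pow, hK₁]; ring
    _ ≤ _ := by gcongr; linarith

/-! ### Verification of programs -/

namespace RealRAM

@[simp] lemma Mem.writeNat_nat_self (m : Mem) (a i v : ℕ) :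
    (m.writeNat a i v).nat a = Function.update (m.nat a) i v := by simp [Mem.writeNat]

@[simp] lemma Mem.writeNat_nat_ne (m : Mem) {a b : ℕ} (i v : ℕ) (h : b ≠ a) :
    (m.writeNat a i v).nat b = m.nat b := by simp [Mem.writeNat, h]

@[simp] lemma Mem.writeNat_real (m : Mem) (a i v : ℕ) : (m.writeNat a i v).real = m.real := rfl

@[simp] lemma Mem.writeReal_real_self (m : Mem) (a i : ℕ) (v : ℝ) :
    (m.writeReal a i v).real a = Function.update (m.real a) i v := by simp [Mem.writeReal]

@[simp] lemma Mem.writeReal_real_ne (m : Mem) {a b : ℕ} (i : ℕ) (v : ℝ) (h : b ≠ a) :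
    (m.writeReal a i v).real b = m.real b := by simp [Mem.writeReal, h]

@[simp] lemma Mem.writeReal_nat (m : Mem) (a i : ℕ) (v : ℝ) : (m.writeReal a i v).nat = m.nat := rfl

/-- The program may write to the array of naturals `b`. -/
def Cmd.writesNat : Cmd → ℕ → Bool
  | .skip, _ => false
  | .setNat a _ _, b => a == b
  | .setReal _ _ _, _ => false
  | .seq c d, b => c.writesNat b || d.writesNat b
  | .ite _ c d, b => c.writesNat b || d.writesNat b
  | .loop _ c, b => c.writesNat b

/-- The program may write to the array of reals `b`. -/
def Cmd.writesReal : Cmd → ℕ → Bool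
  | .skip, _ => false
  | .setNat _ _ _, _ => false
  | .setReal a _ _, b => a == b
  | .seq c d, b => c.writesReal b || d.writesReal b
  | .ite _ c d, b => c.writesReal b || d.writesReal b
  | .loop _ c, b => c.writesReal b

/-- The memories `m` and `m'` differ at most in the arrays to which `c` may write. -/
def Frame (c : Cmd) (m m' : Mem) : Prop :=
  (∀ b, c.writesNat b = false → m'.nat b = m.nat b) ∧
    ∀ b, c.writesReal b = false → m'.real b = m.real b

lemma Frame.refl (c : Cmd) (m : Mem) : Frame c m m := ⟨fun _ _ => rfl, fun _ _ => rfl⟩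

lemma Frame.trans {c : Cmd} {m m' m'' : Mem} (h : Frame c m m') (h' : Frame c m' m'') :
    Frame c m m'' :=
  ⟨fun b hb => (h'.1 b hb).trans (h.1 b hb), fun b hb => (h'.2 b hb).trans (h.2 b hb)⟩

lemma Frame.mono {c d : Cmd} {m m' : Mem} (h : Frame c m m')
    (h1 : ∀ b, d.writesNat b = false → c.writesNat b = false)
    (h2 : ∀ b, d.writesReal b = false → c.writesReal b = false) : Frame d m m' :=
  ⟨fun b hb => h.1 b (h1 b hb), fun b hb => h.2 b (h2 b hb)⟩

lemma Run.frame {c : Cmd} {m m' : Mem} {t : ℕ} (h : Run c m m' t) : Frame c m m' := by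
  induction h with
  | skip m => exact Frame.refl _ _
  | setNat m a i e =>
    refine ⟨fun b hb => Mem.writeNat_nat_ne _ _ _ ?_, fun _ _ => rfl⟩
    rintro rfl
    simp [Cmd.writesNat] at hb
  | setReal m a i x =>
    refine ⟨fun _ _ => rfl, fun b hb => Mem.writeReal_real_ne _ _ _ ?_⟩
    rintro rfl
    simp [Cmd.writesReal] at hb
  | @seq c d m m' m'' _ _ _ _ h1 h2 =>
    have h1' : Frame (.seq c d) m m' := h1.mono (fun b hb => (Bool.or_eq_false_iff.1 hb).1)
      fun b hb => (Bool.or_eq_false_iff.1 hb).1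
    exact h1'.trans (h2.mono (fun b hb => (Bool.or_eq_false_iff.1 hb).2)
      fun b hb => (Bool.or_eq_false_iff.1 hb).2)
  | ite_true _ _ h1 =>
    exact h1.mono (fun b hb => (Bool.or_eq_false_iff.1 hb).1) fun b hb =>
      (Bool.or_eq_false_iff.1 hb).1
  | ite_false _ _ h1 =>
    exact h1.mono (fun b hb => (Bool.or_eq_false_iff.1 hb).2) fun b hb =>
      (Bool.or_eq_false_iff.1 hb).2
  | loop_true _ _ _ h1 h2 => exact (h1.mono (fun _ hb => hb) fun _ hb => hb).trans h2
  | loop_false _ => exact Frame.refl _ _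

/-- Started in memory `m`, the program halts after at most `T` steps in a memory with property `Q`. -/
def Spec (c : Cmd) (m : Mem) (T : ℕ) (Q : Mem → Prop) : Prop :=
  ∃ m' t, Run c m m' t ∧ t ≤ T ∧ Q m' ∧ Frame c m m'

lemma Spec.mono {c : Cmd} {m : Mem} {T T' : ℕ} {Q Q' : Mem → Prop} (h : Spec c m T Q) (hT : T ≤ T')
    (hQ : ∀ m', Q m' → Frame c m m' → Q' m') : Spec c m T' Q' := by
  obtain ⟨m', t, hr, ht, hq, hf⟩ := h
  exact ⟨m', t, hr, ht.trans hT, hQ m' hq hf, hf⟩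

lemma Spec.seq {c d : Cmd} {m : Mem} {T₁ T₂ T : ℕ} {Q₁ Q₂ : Mem → Prop} (h : Spec c m T₁ Q₁)
    (h' : ∀ m', Q₁ m' → Frame c m m' → Spec d m' T₂ Q₂) (hT : T₁ + T₂ ≤ T) :
    Spec (.seq c d) m T Q₂ := by
  obtain ⟨m', t, hr, ht, hq, hf⟩ := h
  obtain ⟨m'', t', hr', ht', hq', hf'⟩ := h' m' hq hf
  exact ⟨m'', t + t', hr.seq hr', by omega, hq', (hr.seq hr').frame⟩

/-- The effect of a program without loops. -/
noncomputable def Cmd.exec : Cmd → Mem → Mem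
  | .skip, m => m
  | .setNat a i e, m => m.writeNat a (i.eval m) (e.eval m)
  | .setReal a i x, m => m.writeReal a (i.eval m) (x.eval m)
  | .seq c d, m => d.exec (c.exec m)
  | .ite b c d, m => open Classical in if b.Holds m then c.exec m else d.exec m
  | .loop _ _, m => m

/-- The program has no loops. -/
def Cmd.isStraight : Cmd → Bool
  | .seq c d => c.isStraight && d.isStraight
  | .ite _ c d => c.isStraight && d.isStraight
  | .loop _ _ => false
  | _ => true

/-- An upper bound for the running time of a program without loops. -/
def Cmd.straightCost : Cmd → ℕ
  | .skip => 1
  | .setNat _ i e => 1 + i.cost + e.cost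
  | .setReal _ i x => 1 + i.cost + x.cost
  | .seq c d => c.straightCost + d.straightCost
  | .ite b c d => 1 + b.cost + (c.straightCost + d.straightCost)
  | .loop _ _ => 0

lemma exists_run_of_isStraight {c : Cmd} (hc : c.isStraight = true) (m : Mem) :
    ∃ t, Run c m (c.exec m) t ∧ t ≤ c.straightCost := by
  classical
  induction c generalizing m with
  | skip => exact ⟨_, .skip m, le_rfl⟩
  | setNat a i e => exact ⟨_, .setNat m a i e, le_rfl⟩
  | setReal a i x => exact ⟨_, .setReal m a i x, le_rfl⟩
  | seq c d hc' hd' =>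
    rw [Cmd.isStraight, Bool.and_eq_true] at hc
    obtain ⟨t, h, ht⟩ := hc' hc.1 m
    obtain ⟨t', h', ht'⟩ := hd' hc.2 (c.exec m)
    exact ⟨_, h.seq h', add_le_add ht ht'⟩
  | ite b c d hc' hd' =>
    rw [Cmd.isStraight, Bool.and_eq_true] at hc
    by_cases hb : b.Holds m
    · obtain ⟨t, h, ht⟩ := hc' hc.1 m
      refine ⟨1 + b.cost + t, ?_, ?_⟩
      · rw [Cmd.exec, if_pos hb]; exact .ite_true hb h
      · rw [Cmd.straightCost]; omega
    · obtain ⟨t, h, ht⟩ := hd' hc.2 m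
      refine ⟨1 + b.cost + t, ?_, ?_⟩
      · rw [Cmd.exec, if_neg hb]; exact .ite_false hb h
      · rw [Cmd.straightCost]; omega
  | loop b c _ => simp [Cmd.isStraight] at hc

lemma spec_straight {c : Cmd} {m : Mem} {T : ℕ} {Q : Mem → Prop} (hc : c.isStraight = true)
    (hT : c.straightCost ≤ T) (hQ : Q (c.exec m)) : Spec c m T Q := by
  obtain ⟨t, h, ht⟩ := exists_run_of_isStraight hc m
  exact ⟨_, t, h, ht.trans hT, hQ, h.frame⟩

/-- `for v in [0, b) do c`, where the counter `v` is cell `0` of an array. -/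
def forCmd (v : ℕ) (b : NExp) (c : Cmd) : Cmd :=
  .seq (.setNat v (.lit 0) (.lit 0)) (.loop (.natLt (.get v (.lit 0)) b)
    (.seq c (.setNat v (.lit 0) (.plus (.get v (.lit 0)) (.lit 1)))))

lemma spec_for {v : ℕ} {b : NExp} {c : Cmd} {m : Mem} {N T : ℕ} {Tc : ℕ → ℕ} (Inv : ℕ → Mem → Prop)
    (hv : c.writesNat v = false) (hbc : b.cost ≤ 20)
    (hb : ∀ m', Frame (forCmd v b c) m m' → b.eval m' = N)
    (hT : 40 * (N + 1) + ∑ k ∈ Finset.range N, Tc k ≤ T) (h0 : Inv 0 m)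
    (hInv : ∀ k m' x, Inv k m' → Inv k (m'.writeNat v 0 x))
    (hstep : ∀ k m', k < N → Frame (forCmd v b c) m m' → m'.nat v 0 = k → Inv k m' →
      Spec c m' (Tc k) (Inv (k + 1))) :
    Spec (forCmd v b c) m T (Inv N) := by
  have hcF : ∀ m' m'', Frame c m' m'' → Frame (forCmd v b c) m' m'' := fun m' m'' h => by
    refine h.mono (fun x hx => ?_) fun x hx => ?_
    · simp only [forCmd, Cmd.writesNat, Bool.or_eq_false_iff] at hx
      exact hx.2.1
    · simp only [forCmd, Cmd.writesReal, Bool.or_eq_false_iff] at hx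
      exact hx.2.1
  have hwF : ∀ m' x, Frame (forCmd v b c) m' (m'.writeNat v 0 x) := fun m' x => by
    refine ⟨fun y hy => Mem.writeNat_nat_ne _ _ _ ?_, fun _ _ => rfl⟩
    rintro rfl
    simp [forCmd, Cmd.writesNat] at hy
  have main : ∀ j k m', k + j = N → Frame (forCmd v b c) m m' → m'.nat v 0 = k → Inv k m' →
      ∃ m'' t, Run (.loop (.natLt (.get v (.lit 0)) b)
        (.seq c (.setNat v (.lit 0) (.plus (.get v (.lit 0)) (.lit 1))))) m' m'' t ∧
        t ≤ 40 * j + 30 + ∑ x ∈ Finset.Ico k N, Tc x ∧ Inv N m'' := by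
    intro j
    induction j with
    | zero =>
      intro k m' hk hF hvk hI
      refine ⟨m', _, .loop_false ?_, ?_, ?_⟩
      · simp only [Test.Holds, NExp.eval, hvk, hb m' hF]; omega
      · simp only [Test.cost, NExp.cost]; omega
      · rwa [← hk]
    | succ j ih =>
      intro k m' hk hF hvk hI
      obtain ⟨m₁, t₁, hr₁, ht₁, hI₁, hF₁⟩ := hstep k m' (by omega) hF hvk hI
      have hv₁ : m₁.nat v 0 = k := by rw [hF₁.1 v hv, hvk]
      obtain ⟨m₂, t₂, hr₂, ht₂, hI₂⟩ := ih (k + 1) (m₁.writeNat v 0 (k + 1)) (by omega)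
        ((hF.trans (hcF _ _ hF₁)).trans (hwF _ _)) (by simp) (hInv _ _ _ hI₁)
      have hset : Run (.setNat v (.lit 0) (.plus (.get v (.lit 0)) (.lit 1))) m₁
          (m₁.writeNat v 0 (k + 1)) 6 := by
        have := Run.setNat m₁ v (.lit 0) (.plus (.get v (.lit 0)) (.lit 1))
        simpa only [NExp.eval, hv₁, NExp.cost] using this
      refine ⟨m₂, _, .loop_true ?_ (hr₁.seq hset) hr₂, ?_, hI₂⟩
      · simp only [Test.Holds, NExp.eval, hvk, hb m' hF]; omega
      · rw [Finset.sum_eq_sum_Ico_succ_bot (by omega)]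
        simp only [Test.cost, NExp.cost]; omega
  obtain ⟨m₂, t₂, hr₂, ht₂, hI₂⟩ := main N 0 (m.writeNat v 0 0) (by omega) (hwF _ _) (by simp)
    (hInv _ _ _ h0)
  have hr : Run (forCmd v b c) m m₂ (3 + t₂) := by
    refine .seq ?_ hr₂
    exact Run.setNat m v (.lit 0) (.lit 0)
  refine ⟨m₂, _, hr, ?_, hI₂, hr.frame⟩
  rw [← Finset.range_eq_Ico] at ht₂
  omega

end RealRAM

namespace RealRAM

/-! ### Adding a mass to the bin of a real number -/

/-- Cell `0` of an array of naturals. -/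
abbrev nv (a : ℕ) : NExp := .get a (.lit 0)

/-- Cell `0` of an array of reals. -/
abbrev rv (a : ℕ) : RExp := .get a (.lit 0)

/-- The number of bins. -/
abbrev numBins : NExp := .get 0 (.lit 1)

/-- The left end of a bin. -/
def lowEnd (l : NExp) : RExp :=
  .plus (.minus (.ofNat (.lit 0)) (.over (.ofNat (.lit 1)) (.ofNat (.lit 2))))
    (.over (.ofNat l) (.ofNat numBins))

/-- Add the weight in cell `0` of the real array `6` to the bin with number in cell `0` of the
array `16` if the point in cell `0` of the real array `5` lies in it. -/
def addToBin : Cmd :=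
  .ite (.realLt (rv 5) (lowEnd (nv 16))) .skip
    (.ite (.natLt (.plus (nv 16) (.lit 1)) numBins)
      (.ite (.realLt (rv 5) (lowEnd (.plus (nv 16) (.lit 1))))
        (.setReal 3 (nv 16) (.plus (.get 3 (nv 16)) (rv 6))) .skip)
      (.ite (.realLt (.over (.ofNat (.lit 1)) (.ofNat (.lit 2))) (rv 5)) .skip
        (.setReal 3 (nv 16) (.plus (.get 3 (nv 16)) (rv 6)))))

/-- Add a weight to the bin which contains a point. -/
def addToBins : Cmd := forCmd 16 numBins addToBin

/-- The indicator function of a bin. -/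
noncomputable def binInd (L l : ℕ) (x : ℝ) : ℝ := if h : l < L then ind (· ∈ bin L ⟨l, h⟩) x else 0

lemma binInd_eq {L l : ℕ} (h : l < L) (x : ℝ) : binInd L l x =
    if x < -1 / 2 + (l : ℝ) / L then 0 else
      if l + 1 < L then (if x < -1 / 2 + ((l : ℝ) + 1) / L then 1 else 0)
      else if 1 / 2 < x then 0 else 1 := by
  rw [binInd, dif_pos h, ind, bin]
  have h1 : (l + 1 = L) ↔ ¬ (l + 1 < L) := by omega
  by_cases h2 : l + 1 < L <;> by_cases h3 : x < -1 / 2 + (l : ℝ) / L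
  · simp [h2.ne, h3]
  · simp [h2, h2.ne, h3, not_lt.1 h3]
  · simp [h1.2 h2, h3]
  · simp [h1.2 h2, h3, not_lt.1 h3, ← not_lt]

lemma spec_addToBins {m : Mem} {L : ℕ} (hL : m.nat 0 1 = L) :
    Spec addToBins m (200 * (L + 1)) (fun m' => ∀ l < L,
      m'.real 3 l = m.real 3 l + m.real 6 0 * binInd L l (m.real 5 0)) := by
  refine (spec_for (N := L) (Tc := fun _ => 100) (fun k m' => ∀ l < L, m'.real 3 l = m.real 3 l +
    if l < k then m.real 6 0 * binInd L l (m.real 5 0) else 0) rfl (by decide)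
    (fun m' hF => ?_) le_rfl (fun l _ => by simp) (fun k m' x h => by simpa using h)
    fun k m' hk hF hv hI => ?_).mono ?_ fun m' h _ l hl => ?_
  · simp only [NExp.eval, hF.1 0 rfl, hL]
  · refine spec_straight rfl (by decide) fun l hl => ?_
    have e0 : m'.nat 0 = m.nat 0 := hF.1 0 rfl
    have e5 : m'.real 5 = m.real 5 := hF.2 5 rfl
    have e6 : m'.real 6 = m.real 6 := hF.2 6 rfl
    have hb := binInd_eq hk (m.real 5 0)
    have hIl := hI l hl
    simp only [addToBin, Cmd.exec, Test.Holds, RExp.eval, NExp.eval, lowEnd, e0, e5, e6, hv, hL]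
    push_cast
    rw [show (0 : ℝ) - 1 / 2 = -1 / 2 by norm_num]
    rw [apply_ite Mem.real, apply_ite Mem.real, apply_ite Mem.real, apply_ite Mem.real]
    by_cases hlk : l = k
    · subst hlk
      rw [hb]
      split_ifs <;> simp_all
    · have hlk' : l < k + 1 ↔ l < k := by omega
      split_ifs <;> simp_all
  · rw [Finset.sum_const, Finset.card_range, smul_eq_mul]; omega
  · rw [h l hl, if_pos hl]

/-! ### Marking a neighbourhood and counting the unmarked neighbours of a vertex -/

/-- Mark the closed neighbourhood of the current vertex. -/
def markNbrs : Cmd :=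
  .seq (.setNat 13 (nv 14) (.plus (nv 14) (.lit 1)))
    (forCmd 15 (.get 1 (nv 14))
      (.setNat 13 (.get 2 (.plus (.get 12 (nv 14)) (nv 15))) (.plus (nv 14) (.lit 1))))

lemma spec_markNbrs {m : Mem} {i : ℕ} (hi : m.nat 14 0 = i) :
    Spec markNbrs m (200 * (m.nat 1 i + 1)) (fun m' => ∀ x, m'.nat 13 x =
      if x = i ∨ ∃ d < m.nat 1 i, m.nat 2 (m.nat 12 i + d) = x then i + 1 else m.nat 13 x) := by
  refine Spec.seq (T₁ := 100) (T₂ := 140 * m.nat 1 i + 40)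
    (Q₁ := fun m' => m'.nat 13 = Function.update (m.nat 13) i (i + 1))
    (spec_straight rfl (by decide) (by simp [Cmd.exec, NExp.eval, hi])) (fun m₁ h₁ hF₁ => ?_) (by omega)
  have e1 : m₁.nat 1 = m.nat 1 := hF₁.1 1 rfl
  have e2 : m₁.nat 2 = m.nat 2 := hF₁.1 2 rfl
  have e12 : m₁.nat 12 = m.nat 12 := hF₁.1 12 rfl
  have e14 : m₁.nat 14 = m.nat 14 := hF₁.1 14 rfl
  refine (spec_for (N := m.nat 1 i) (Tc := fun _ => 100) (fun k m' => ∀ x, m'.nat 13 x =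
    if x = i ∨ ∃ d < k, m.nat 2 (m.nat 12 i + d) = x then i + 1 else m.nat 13 x) rfl (by decide)
    (fun m' hF => ?_) le_rfl (fun x => ?_) (fun k m' x h => by simpa using h)
    fun k m' hk hF hv hI => ?_).mono ?_ fun m' h _ => h
  · simp only [NExp.eval, hF.1 14 rfl, hF.1 1 rfl, e1, e14, hi]
  · rw [h₁]; simp [Function.update_apply]
  · refine spec_straight rfl (by decide) fun x => ?_
    simp only [Cmd.exec, NExp.eval, hF.1 14 rfl, hF.1 2 rfl, hF.1 12 rfl, e14, e2, e12, hi, hv,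
      Mem.writeNat_nat_self, Function.update_apply, hI x]
    have hiff : (x = i ∨ ∃ d < k + 1, m.nat 2 (m.nat 12 i + d) = x) ↔
        x = m.nat 2 (m.nat 12 i + k) ∨ (x = i ∨ ∃ d < k, m.nat 2 (m.nat 12 i + d) = x) := by
      simp only [Nat.lt_succ_iff_lt_or_eq, or_and_right, exists_or, exists_eq_left]
      rw [eq_comm (a := x) (b := m.nat 2 (m.nat 12 i + k))]
      rw [← or_assoc, or_comm]
    by_cases h1 : x = m.nat 2 (m.nat 12 i + k)
    · rw [if_pos h1, if_pos (hiff.2 (Or.inl h1))]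
    · rw [if_neg h1]
      exact if_congr (by rw [hiff, or_iff_right h1]) rfl rfl
  · rw [Finset.sum_const, Finset.card_range, smul_eq_mul]; omega

/-- The number of unmarked neighbours of a vertex, if the marks are larger than `i`. -/
def outCount (m : Mem) (i j : ℕ) : ℕ :=
  ∑ e ∈ Finset.range (m.nat 1 j), if m.nat 13 (m.nat 2 (m.nat 12 j + e)) < i + 1 then 1 else 0

/-- Count the unmarked neighbours of a vertex. -/
def countNbrs : Cmd :=
  .seq (.setNat 19 (.lit 0) (.lit 0))
    (forCmd 20 (.get 1 (nv 18))
      (.ite (.natLt (.get 13 (.get 2 (.plus (.get 12 (nv 18)) (nv 20)))) (.plus (nv 14) (.lit 1)))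
        (.setNat 19 (.lit 0) (.plus (nv 19) (.lit 1))) .skip))

lemma spec_countNbrs {m : Mem} {i j : ℕ} (hi : m.nat 14 0 = i) (hj : m.nat 18 0 = j) :
    Spec countNbrs m (200 * (m.nat 1 j + 1)) (fun m' => m'.nat 19 0 = outCount m i j) := by
  refine Spec.seq (T₁ := 100) (T₂ := 140 * m.nat 1 j + 40) (Q₁ := fun m' => m'.nat 19 0 = 0)
    (spec_straight rfl (by decide) (by simp [Cmd.exec, NExp.eval])) (fun m₁ h₁ hF₁ => ?_) (by omega)
  have e1 : m₁.nat 1 = m.nat 1 := hF₁.1 1 rfl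
  have e2 : m₁.nat 2 = m.nat 2 := hF₁.1 2 rfl
  have e12 : m₁.nat 12 = m.nat 12 := hF₁.1 12 rfl
  have e13 : m₁.nat 13 = m.nat 13 := hF₁.1 13 rfl
  have e14 : m₁.nat 14 = m.nat 14 := hF₁.1 14 rfl
  have e18 : m₁.nat 18 = m.nat 18 := hF₁.1 18 rfl
  refine (spec_for (N := m.nat 1 j) (Tc := fun _ => 100) (fun k m' => m'.nat 19 0 =
    ∑ e ∈ Finset.range k, if m.nat 13 (m.nat 2 (m.nat 12 j + e)) < i + 1 then 1 else 0) rfl (by decide)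
    (fun m' hF => ?_) le_rfl (by simpa using h₁) (fun k m' x h => by simpa using h)
    fun k m' hk hF hv hI => ?_).mono ?_ fun m' h _ => h
  · simp only [NExp.eval, hF.1 18 rfl, hF.1 1 rfl, e1, e18, hj]
  · refine spec_straight rfl (by decide) ?_
    simp only [Cmd.exec, Test.Holds, NExp.eval, hF.1 14 rfl, hF.1 2 rfl, hF.1 12 rfl, hF.1 13 rfl,
      hF.1 18 rfl, e14, e2, e12, e13, e18, hi, hj, hv, Finset.sum_range_succ, ← hI]
    split_ifs <;> simp
  · rw [Finset.sum_const, Finset.card_range, smul_eq_mul]; omega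

/-! ### The standardized outdegrees -/

/-- Add the weight to the bin of the standardized outdegree of a neighbour. -/
def addNbr : Cmd :=
  .seq (.setNat 18 (.lit 0) (.get 2 (.plus (.get 12 (nv 14)) (nv 15))))
    (.seq countNbrs
      (.seq (.setReal 5 (.lit 0)
        (.over (.minus (.ofNat (nv 19)) (.times (.ofNat (nv 17)) (rv 0))) (rv 4))) addToBins))

lemma spec_addNbr {m : Mem} {L i j D : ℕ} (hL : m.nat 0 1 = L) (hi : m.nat 14 0 = i)
    (hj : m.nat 2 (m.nat 12 i + m.nat 15 0) = j) (hD : m.nat 1 j ≤ D) :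
    Spec addNbr m (200 * (D + L) + 600) (fun m' => ∀ l < L, m'.real 3 l = m.real 3 l +
      m.real 6 0 * binInd L l ((outCount m i j - m.nat 17 0 * m.real 0 0) / m.real 4 0)) := by
  refine Spec.seq (T₁ := 100) (T₂ := 200 * (D + L) + 500) (Q₁ := fun m' => m'.nat 18 0 = j)
    (spec_straight rfl (by decide) (by simp [Cmd.exec, NExp.eval, hi, hj])) (fun m₁ h₁ hF₁ => ?_)
    (by omega)
  have hc : outCount m₁ i j = outCount m i j := by
    simp only [outCount, hF₁.1 1 rfl, hF₁.1 2 rfl, hF₁.1 12 rfl, hF₁.1 13 rfl]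
  refine Spec.seq (T₁ := 200 * (D + 1)) (T₂ := 200 * L + 300)
    ((spec_countNbrs (by rw [hF₁.1 14 rfl, hi]) h₁).mono (by rw [hF₁.1 1 rfl]; omega)
      fun m' h _ => h) (fun m₂ h₂ hF₂ => ?_) (by omega)
  refine Spec.seq (T₁ := 100) (T₂ := 200 * (L + 1)) (Q₁ := fun m' => m'.real 5 0 =
      ((outCount m i j - m.nat 17 0 * m.real 0 0) / m.real 4 0))
    (spec_straight rfl (by decide) ?_) (fun m₃ h₃ hF₃ => ?_) (by omega)
  · simp [Cmd.exec, NExp.eval, RExp.eval, h₂, hF₂.1 17 rfl, hF₁.1 17 rfl, hF₂.2 0 rfl, hF₁.2 0 rfl,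
      hF₂.2 4 rfl, hF₁.2 4 rfl, hc]
  · refine (spec_addToBins (L := L) ?_).mono le_rfl fun m' h _ => ?_
    · rw [hF₃.1 0 rfl, hF₂.1 0 rfl, hF₁.1 0 rfl, hL]
    · rwa [hF₃.2 3 rfl, hF₂.2 3 rfl, hF₁.2 3 rfl, hF₃.2 6 rfl, hF₂.2 6 rfl, hF₁.2 6 rfl, h₃] at h

/-- Add the weights to the bins of the standardized outdegrees of the neighbours of the current
vertex. -/
def addNbrs : Cmd := forCmd 15 (.get 1 (nv 14)) addNbr

lemma spec_addNbrs {m : Mem} {L i D : ℕ} (hL : m.nat 0 1 = L) (hi : m.nat 14 0 = i)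
    (hD : ∀ d < m.nat 1 i, m.nat 1 (m.nat 2 (m.nat 12 i + d)) ≤ D) :
    Spec addNbrs m (40 + m.nat 1 i * (200 * (D + L) + 640)) (fun m' => ∀ l < L, m'.real 3 l =
      m.real 3 l + ∑ d ∈ Finset.range (m.nat 1 i), m.real 6 0 * binInd L l
        ((outCount m i (m.nat 2 (m.nat 12 i + d)) - m.nat 17 0 * m.real 0 0) / m.real 4 0)) := by
  refine (spec_for (N := m.nat 1 i) (Tc := fun _ => 200 * (D + L) + 600) (fun k m' => ∀ l < L,
    m'.real 3 l = m.real 3 l + ∑ d ∈ Finset.range k, m.real 6 0 * binInd L l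
        ((outCount m i (m.nat 2 (m.nat 12 i + d)) - m.nat 17 0 * m.real 0 0) / m.real 4 0)) rfl
    (by decide) (fun m' hF => ?_) le_rfl (by simp) (fun k m' x h => by simpa using h)
    fun k m' hk hF hv hI => ?_).mono ?_ fun m' h _ => h
  · simp only [NExp.eval, hF.1 14 rfl, hF.1 1 rfl, hi]
  · have hj : m'.nat 2 (m'.nat 12 i + m'.nat 15 0) = m.nat 2 (m.nat 12 i + k) := by
      rw [hF.1 2 rfl, hF.1 12 rfl, hv]
    refine (spec_addNbr (by rw [hF.1 0 rfl, hL]) (by rw [hF.1 14 rfl, hi]) hj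
      (by rw [hF.1 1 rfl]; exact hD k hk)).mono le_rfl fun m'' h _ l hl => ?_
    have hc : ∀ j, outCount m' i j = outCount m i j := fun j => by
      simp only [outCount, hF.1 1 rfl, hF.1 2 rfl, hF.1 12 rfl, hF.1 13 rfl]
    rw [h l hl, hI l hl, hc, hF.2 6 rfl, hF.2 0 rfl, hF.2 4 rfl, hF.1 17 rfl, Finset.sum_range_succ,
      add_assoc]
  · rw [Finset.sum_const, Finset.card_range, smul_eq_mul]
    apply le_of_eq; ring

/-! ### Subtracting the binomial distribution -/

/-- Compute `(1 - q) ^ k`. -/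
def powCmd : Cmd :=
  .seq (.setReal 7 (.lit 0) (.ofNat (.lit 1)))
    (forCmd 21 (nv 17) (.setReal 7 (.lit 0) (.times (rv 7) (.minus (.ofNat (.lit 1)) (rv 0)))))

lemma spec_powCmd {m : Mem} {k : ℕ} (hk : m.nat 17 0 = k) :
    Spec powCmd m (200 * (k + 1)) (fun m' => m'.real 7 0 = (1 - m.real 0 0) ^ k) := by
  refine Spec.seq (T₁ := 100) (T₂ := 140 * k + 40) (Q₁ := fun m' => m'.real 7 0 = 1)
    (spec_straight rfl (by decide) (by simp [Cmd.exec, NExp.eval, RExp.eval]))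
    (fun m₁ h₁ hF₁ => ?_) (by omega)
  refine (spec_for (N := k) (Tc := fun _ => 100) (fun x m' => m'.real 7 0 = (1 - m.real 0 0) ^ x) rfl
    (by decide) (fun m' hF => ?_) le_rfl (by simpa using h₁) (fun k m' x h => by simpa using h)
    fun x m' hx hF hv hI => ?_).mono ?_ fun m' h _ => h
  · simp only [NExp.eval, hF.1 17 rfl, hF₁.1 17 rfl, hk]
  · refine spec_straight rfl (by decide) ?_
    simp [Cmd.exec, NExp.eval, RExp.eval, hF.2 0 rfl, hF₁.2 0 rfl, hI, pow_succ]
  · rw [Finset.sum_const, Finset.card_range, smul_eq_mul]; omega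

/-- Subtract a binomial probability from a bin, and compute the next one. -/
def subMass : Cmd :=
  .seq (.seq (.setReal 5 (.lit 0)
      (.over (.minus (.ofNat (nv 21)) (.times (.ofNat (nv 17)) (rv 0))) (rv 4)))
    (.setReal 6 (.lit 0) (.minus (.ofNat (.lit 0)) (rv 7))))
    (.seq addToBins
      (.setReal 7 (.lit 0) (.times (.times (rv 7) (.over (.ofNat (.monus (nv 17) (nv 21)))
        (.ofNat (.plus (nv 21) (.lit 1))))) (.over (rv 0) (.minus (.ofNat (.lit 1)) (rv 0))))))

/-- Subtract the standardized binomial distribution from the bins. -/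
def subMasses : Cmd := forCmd 21 (.plus (nv 17) (.lit 1)) subMass

lemma binPmf_succ_eq {k x : ℕ} {q : ℝ} (hq : q < 1) (hx : x ≤ k) :
    binPmf k q (x + 1) = binPmf k q x * ((k - x : ℕ) / ((x + 1 : ℕ) : ℝ)) * (q / (1 - q)) := by
  have h1 : (1 - q) ≠ 0 := by linarith
  rcases hx.lt_or_eq with h | rfl
  · have h2 := binPmf_succ_mul k q x h
    rw [Nat.cast_sub hx]
    push_cast
    field_simp
    linarith
  · simp [binPmf]

lemma spec_subMasses {m : Mem} {L k : ℕ} (hL : m.nat 0 1 = L) (hk : m.nat 17 0 = k)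
    (hq : m.real 0 0 < 1) (hp : m.real 7 0 = (1 - m.real 0 0) ^ k) :
    Spec subMasses m (40 + (k + 1) * (200 * L + 440)) (fun m' => ∀ l < L, m'.real 3 l =
      m.real 3 l - ∑ x ∈ Finset.range (k + 1), binPmf k (m.real 0 0) x *
        binInd L l ((x - k * m.real 0 0) / m.real 4 0)) := by
  refine (spec_for (N := k + 1) (Tc := fun _ => 200 * (L + 1) + 200) (fun y m' =>
    m'.real 7 0 = binPmf k (m.real 0 0) y ∧ ∀ l < L,
    m'.real 3 l = m.real 3 l - ∑ x ∈ Finset.range y, binPmf k (m.real 0 0) x *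
        binInd L l ((x - k * m.real 0 0) / m.real 4 0)) rfl
    (by decide) (fun m' hF => ?_) le_rfl (by simp [binPmf, hp]) (fun k m' x h => by simpa using h)
    fun x m' hx hF hv hI => ?_).mono ?_ fun m' h _ => h.2
  · simp only [NExp.eval, hF.1 17 rfl, hk]
  · refine Spec.seq (T₁ := 100) (T₂ := 200 * (L + 1) + 100) (Q₁ := fun m₁ => m₁.real 5 0 =
      (x - k * m.real 0 0) / m.real 4 0 ∧ m₁.real 6 0 = - binPmf k (m.real 0 0) x)
      (spec_straight rfl (by decide) ?_) (fun m₁ h₁ hF₁ => ?_) (by omega)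
    · simp [Cmd.exec, NExp.eval, RExp.eval, hF.2 0 rfl, hF.2 4 rfl, hF.1 17 rfl, hk, hI.1, hv]
    refine Spec.seq (T₁ := 200 * (L + 1)) (T₂ := 100) (spec_addToBins (L := L)
      (by rw [hF₁.1 0 rfl, hF.1 0 rfl, hL])) (fun m₂ h₂ hF₂ => ?_) (by omega)
    refine spec_straight rfl (by decide) ⟨?_, fun l hl => ?_⟩
    · simp [Cmd.exec, NExp.eval, RExp.eval, hF₂.2 7 rfl, hF₁.2 7 rfl, hI.1, hF₂.1 17 rfl, hF₁.1 17 rfl,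
        hF.1 17 rfl, hF₂.1 21 rfl, hF₁.1 21 rfl, hv, hk, hF₂.2 0 rfl, hF₁.2 0 rfl, hF.2 0 rfl,
        binPmf_succ_eq hq (Nat.lt_succ_iff.1 hx)]
    · simp only [Cmd.exec]
      rw [Mem.writeReal_real_ne _ _ _ (by decide), h₂ l hl, h₁.1, h₁.2, hF₁.2 3 rfl, hI.2 l hl,
        Finset.sum_range_succ]
      ring
  · rw [Finset.sum_const, Finset.card_range, smul_eq_mul]
    apply le_of_eq; ring

end RealRAM

namespace RealRAM

/-! ### The degree profile of a vertex -/

/-- Clear the bins. -/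
def clearBins : Cmd := forCmd 16 numBins (.setReal 3 (nv 16) (.ofNat (.lit 0)))

lemma spec_clearBins {m : Mem} {L : ℕ} (hL : m.nat 0 1 = L) :
    Spec clearBins m (200 * (L + 1)) (fun m' => ∀ l < L, m'.real 3 l = 0) := by
  refine (spec_for (N := L) (Tc := fun _ => 100) (fun k m' => ∀ l < k, m'.real 3 l = 0) rfl
    (by decide) (fun m' hF => ?_) le_rfl (by simp) (fun k m' x h => by simpa using h)
    fun k m' hk hF hv hI => ?_).mono ?_ fun m' h _ => h
  · simp only [NExp.eval, hF.1 0 rfl, hL]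
  · refine spec_straight rfl (by decide) fun l hl => ?_
    simp only [Cmd.exec, NExp.eval, RExp.eval, Mem.writeReal_real_self, Function.update_apply, hv]
    split_ifs with h
    · simp
    · exact hI l (by omega)
  · rw [Finset.sum_const, Finset.card_range, smul_eq_mul]; omega

/-- Copy the bins to the row of the current vertex. -/
def storeBins : Cmd :=
  forCmd 16 numBins (.setReal 1 (.plus (.get 10 (nv 14)) (nv 16)) (.get 3 (nv 16)))

lemma spec_storeBins {m : Mem} {L r : ℕ} (hL : m.nat 0 1 = L) (hr : m.nat 10 (m.nat 14 0) = r) :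
    Spec storeBins m (200 * (L + 1)) (fun m' => (∀ l < L, m'.real 1 (r + l) = m.real 3 l) ∧
      ∀ x < r, m'.real 1 x = m.real 1 x) := by
  refine (spec_for (N := L) (Tc := fun _ => 100) (fun k m' => (∀ l < k, m'.real 1 (r + l) = m.real 3 l) ∧
      ∀ x < r, m'.real 1 x = m.real 1 x) rfl
    (by decide) (fun m' hF => ?_) le_rfl (by simp) (fun k m' x h => by simpa using h)
    fun k m' hk hF hv hI => ?_).mono ?_ fun m' h _ => h
  · simp only [NExp.eval, hF.1 0 rfl, hL]
  · refine spec_straight rfl (by decide) ⟨fun l hl => ?_, fun x hx => ?_⟩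
    · simp only [Cmd.exec, NExp.eval, RExp.eval, Mem.writeReal_real_self, Function.update_apply, hv,
        hF.1 10 rfl, hF.1 14 rfl, hr, hF.2 3 rfl]
      split_ifs with h
      · rw [show l = k by omega]
      · exact hI.1 l (by omega)
    · simp only [Cmd.exec, NExp.eval, RExp.eval, Mem.writeReal_real_self, Function.update_apply, hv,
        hF.1 10 rfl, hF.1 14 rfl, hr]
      rw [if_neg (by omega), hI.2 x hx]
  · rw [Finset.sum_const, Finset.card_range, smul_eq_mul]; omega

/-- Compute the number of vertices outside the closed neighbourhood of the current vertex, the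
standard deviation of the outdegrees, and the weight of a neighbour. -/
def setupVertex : Cmd :=
  .seq (.setNat 17 (.lit 0) (.monus (.monus (.get 0 (.lit 0)) (.get 1 (nv 14))) (.lit 1)))
    (.seq (.setReal 4 (.lit 0) (.root (.times (.times (.ofNat (nv 17)) (rv 0))
        (.minus (.ofNat (.lit 1)) (rv 0)))))
      (.setReal 6 (.lit 0) (.over (.ofNat (.lit 1)) (.ofNat (.get 1 (nv 14))))))

/-- Compute the centered degree profile of the current vertex. -/
def vertexCmd : Cmd :=
  .seq markNbrs (.seq clearBins (.seq setupVertex (.seq addNbrs (.seq powCmd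
    (.seq subMasses storeBins)))))

/-- The array `aj` contains a list of the `dg i` neighbours of `i` from the position `off i` on. -/
structure IsGraphData {n : ℕ} (G : SimpleGraph (Fin n)) (dg aj off : ℕ → ℕ) : Prop where
  deg_eq : ∀ i : Fin n, dg i = deg G i
  adj : ∀ i j : Fin n, G.Adj i j ↔ ∃ d < dg i, aj (off i + d) = j
  lt : ∀ i : Fin n, ∀ d < dg i, aj (off i + d) < n
  sum : ∀ (i : Fin n) (f : ℕ → ℝ), ∑ d ∈ Finset.range (dg i), f (aj (off i + d)) = ∑ j ∈ nbrs G i, f j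

/-- The memory contains a graph and the auxiliary tables. -/
structure GraphMem {n : ℕ} (G : SimpleGraph (Fin n)) (L : ℕ) (q : unitInterval) (m : Mem) : Prop where
  n_eq : m.nat 0 0 = n
  numBins_eq : m.nat 0 1 = L
  prob_eq : m.real 0 0 = q
  data : IsGraphData G (m.nat 1) (m.nat 2) (m.nat 12)
  row_eq : ∀ i < n, m.nat 10 i = i * L

lemma GraphMem.frame {n : ℕ} {G : SimpleGraph (Fin n)} {L : ℕ} {q : unitInterval} {m m' : Mem}
    {c : Cmd} (h : GraphMem G L q m) (hF : Frame c m m')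
    (hc : (c.writesNat 0 || c.writesNat 1 || c.writesNat 2 || c.writesNat 10 || c.writesNat 12 ||
      c.writesReal 0) = false) : GraphMem G L q m' := by
  simp only [Bool.or_eq_false_iff] at hc
  obtain ⟨⟨⟨⟨⟨h0, h1⟩, h2⟩, h10⟩, h12⟩, hr⟩ := hc
  refine ⟨?_, ?_, ?_, ?_, ?_⟩
  · rw [hF.1 0 h0]; exact h.n_eq
  · rw [hF.1 0 h0]; exact h.numBins_eq
  · rw [hF.2 0 hr]; exact h.prob_eq
  · rw [hF.1 1 h1, hF.1 2 h2, hF.1 12 h12]; exact h.data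
  · rw [hF.1 10 h10]; exact h.row_eq

open Classical in
lemma cast_outCount {n : ℕ} {G : SimpleGraph (Fin n)} {m : Mem}
    (h : IsGraphData G (m.nat 1) (m.nat 2) (m.nat 12)) {i : Fin n}
    (hmark : ∀ x : Fin n, m.nat 13 x < (i : ℕ) + 1 ↔ x ∉ insert i (nbrs G i)) (j : Fin n) :
    (outCount m i j : ℝ) = ((insert i (nbrs G i))ᶜ.filter (fun l => G.Adj l j)).card := by
  rw [outCount, Nat.cast_sum]
  push_cast
  rw [h.sum j (fun x => if m.nat 13 x < (i : ℕ) + 1 then (1 : ℝ) else 0), Finset.sum_boole]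
  congr 2
  ext x
  simp only [Finset.mem_filter, Finset.mem_compl, mem_nbrs, hmark, G.adj_comm j x]
  tauto

lemma spec_vertexCmd {n : ℕ} {G : SimpleGraph (Fin n)} {L : ℕ} {q : unitInterval} {m : Mem}
    (h : GraphMem G L q m) (hq : (q : ℝ) < 1) (hL1 : 1 ≤ L) {i : Fin n} (hi : m.nat 14 0 = i)
    (hmark : ∀ x : Fin n, m.nat 13 x ≤ i) :
    Spec vertexCmd m (200 * (deg G i * maxDeg G) + 4000 * (n * L)) (fun m' =>
      (∀ x : Fin n, m'.nat 13 x ≤ (i : ℕ) + 1) ∧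
      (∀ l (hl : l < L), m'.real 1 (i * L + l) = centeredProfile G q i (bin L ⟨l, hl⟩)) ∧
      ∀ x < i * L, m'.real 1 x = m.real 1 x) := by
  classical
  set k := n - deg G i - 1 with hk
  have hdeg := deg_lt G i
  have hdi := h.data.deg_eq i
  have hT : 200 * (deg G i + 1) + (200 * (L + 1) + (100 + ((40 + deg G i * (200 * (maxDeg G + L) + 640)) +
      (200 * (k + 1) + ((40 + (k + 1) * (200 * L + 440)) + 200 * (L + 1)))))) ≤
      200 * (deg G i * maxDeg G) + 4000 * (n * L) := by
    have hkn : k + 1 ≤ n := by omega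
    have h1 : (k + 1) * L ≤ n * L := Nat.mul_le_mul_right L hkn
    have h2 : deg G i * L ≤ n * L := Nat.mul_le_mul_right L (by omega)
    have h3 : n * 1 ≤ n * L := Nat.mul_le_mul_left n hL1
    have h4 : 1 * L ≤ n * L := Nat.mul_le_mul_right L (by omega)
    have e1 : deg G i * (200 * (maxDeg G + L) + 640) =
      200 * (deg G i * maxDeg G) + 200 * (deg G i * L) + 640 * deg G i := by ring
    have e2 : (k + 1) * (200 * L + 440) = 200 * ((k + 1) * L) + 440 * (k + 1) := by ring
    rw [e1, e2]
    omega
  refine Spec.seq ((spec_markNbrs hi).mono (by rw [hdi]) fun m' h _ => h) (fun m₁ h₁ hF₁ => ?_) hT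
  have g₁ := h.frame hF₁ rfl
  have hi₁ : m₁.nat 14 0 = i := by rw [hF₁.1 14 rfl, hi]
  have hmark₁ : ∀ x : Fin n, m₁.nat 13 x < (i : ℕ) + 1 ↔ x ∉ insert i (nbrs G i) := fun x => by
    have hx : ((x : ℕ) = i ∨ ∃ d < m.nat 1 i, m.nat 2 (m.nat 12 i + d) = x) ↔ x ∈ insert i (nbrs G i) := by
      rw [Finset.mem_insert, mem_nbrs, h.data.adj, Fin.ext_iff]
    rw [h₁ x]
    by_cases hx' : x ∈ insert i (nbrs G i)
    · rw [if_pos (hx.2 hx')]; simp [hx']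
    · rw [if_neg (mt hx.1 hx')]; simp [hx', Nat.lt_succ_of_le (hmark x)]
  have hmark₁' : ∀ x : Fin n, m₁.nat 13 x ≤ (i : ℕ) + 1 := fun x => by
    rw [h₁ x]
    split_ifs
    · exact le_rfl
    · exact (hmark x).trans (Nat.le_succ _)
  refine Spec.seq (spec_clearBins g₁.numBins_eq) (fun m₂ h₂ hF₂ => ?_) le_rfl
  have g₂ := g₁.frame hF₂ rfl
  have hi₂ : m₂.nat 14 0 = i := by rw [hF₂.1 14 rfl, hi₁]
  refine Spec.seq (T₁ := 100) (Q₁ := fun m' => m'.nat 17 0 = k ∧ m'.real 4 0 = √(k * q * (1 - q)) ∧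
    m'.real 6 0 = 1 / deg G i) (spec_straight rfl (by decide) ?_) (fun m₃ h₃ hF₃ => ?_) le_rfl
  · simp [setupVertex, Cmd.exec, NExp.eval, RExp.eval, hi₂, g₂.n_eq, g₂.data.deg_eq, g₂.prob_eq, hk]
  have g₃ := g₂.frame hF₃ rfl
  have hi₃ : m₃.nat 14 0 = i := by rw [hF₃.1 14 rfl, hi₂]
  have hd₃ := g₃.data.deg_eq i
  have hmark₃ : ∀ x : Fin n, m₃.nat 13 x < (i : ℕ) + 1 ↔ x ∉ insert i (nbrs G i) := by
    rwa [hF₃.1 13 rfl, hF₂.1 13 rfl]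
  refine Spec.seq ((spec_addNbrs (D := maxDeg G) g₃.numBins_eq hi₃ fun d hd => ?_).mono
    (by rw [hd₃]) fun m' h _ => h) (fun m₄ h₄ hF₄ => ?_) le_rfl
  · have := g₃.data.deg_eq ⟨_, g₃.data.lt i d hd⟩
    rw [this]
    exact deg_le_maxDeg G _
  have g₄ := g₃.frame hF₄ rfl
  have hbin₄ : ∀ l < L, m₄.real 3 l =
      1 / (deg G i : ℝ) * ∑ j ∈ nbrs G i, binInd L l (stdOutdeg G q i j) := fun l hl => by
    rw [h₄ l hl, hF₃.2 3 rfl, h₂ l hl, zero_add, ← Finset.mul_sum, h₃.2.2]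
    congr 1
    rw [g₃.data.sum i fun x => binInd L l ((outCount m₃ i x - m₃.nat 17 0 * m₃.real 0 0) / m₃.real 4 0)]
    refine Finset.sum_congr rfl fun j _ => ?_
    rw [cast_outCount g₃.data hmark₃, stdOutdeg_eq, h₃.1, h₃.2.1, g₃.prob_eq]
  refine Spec.seq (spec_powCmd (k := k) (by rw [hF₄.1 17 rfl, h₃.1])) (fun m₅ h₅ hF₅ => ?_) le_rfl
  have g₅ := g₄.frame hF₅ rfl
  refine Spec.seq (spec_subMasses (k := k) g₅.numBins_eq (by rw [hF₅.1 17 rfl, hF₄.1 17 rfl, h₃.1])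
    (by rw [g₅.prob_eq]; exact hq) (by rw [h₅, g₅.prob_eq, g₄.prob_eq])) (fun m₆ h₆ hF₆ => ?_) le_rfl
  have g₆ := g₅.frame hF₆ rfl
  have hi₆ : m₆.nat 14 0 = i := by rw [hF₆.1 14 rfl, hF₅.1 14 rfl, hF₄.1 14 rfl, hi₃]
  have hbin₆ : ∀ l (hl : l < L), m₆.real 3 l = centeredProfile G q i (bin L ⟨l, hl⟩) := fun l hl => by
    rw [h₆ l hl, hF₅.2 3 rfl, hbin₄ l hl, centeredProfile_apply G q i (measurableSet_bin L _),
      stdBinomial_real _ _ (measurableSet_bin L _), binExp, g₅.prob_eq, hF₅.2 4 rfl, hF₄.2 4 rfl, h₃.2.1]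
    simp only [binInd, hl, dif_pos, hk]
  refine (spec_storeBins (r := i * L) g₆.numBins_eq (by rw [hi₆, g₆.row_eq i i.2])).mono le_rfl
    fun m₇ h₇ hF₇ => ⟨?_, fun l hl => ?_, fun x hx => ?_⟩
  · rwa [hF₇.1 13 rfl, hF₆.1 13 rfl, hF₅.1 13 rfl, hF₄.1 13 rfl, hF₃.1 13 rfl, hF₂.1 13 rfl]
  · rw [h₇.1 l hl, hbin₆ l hl]
  · rw [h₇.2 x hx, hF₆.2 1 rfl, hF₅.2 1 rfl, hF₄.2 1 rfl, hF₃.2 1 rfl, hF₂.2 1 rfl, hF₁.2 1 rfl]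

/-! ### The degree profiles of a graph -/

/-- Compute the positions of the neighbour lists. -/
def offsetsCmd : Cmd :=
  .seq (.setNat 12 (.lit 0) (.lit 0)) (forCmd 15 (.get 0 (.lit 0))
    (.setNat 12 (.plus (nv 15) (.lit 1)) (.plus (.get 12 (nv 15)) (.get 1 (nv 15)))))

lemma spec_offsetsCmd {m : Mem} {n : ℕ} (hn : m.nat 0 0 = n) :
    Spec offsetsCmd m (200 * (n + 1)) (fun m' => ∀ i ≤ n, m'.nat 12 i =
      ∑ x ∈ Finset.range i, m.nat 1 x) := by
  refine Spec.seq (T₁ := 100) (T₂ := 140 * n + 40) (Q₁ := fun m' => m'.nat 12 0 = 0)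
    (spec_straight rfl (by decide) (by simp [Cmd.exec, NExp.eval])) (fun m₁ h₁ hF₁ => ?_) (by omega)
  refine (spec_for (N := n) (Tc := fun _ => 100) (fun k m' => ∀ i ≤ k, m'.nat 12 i =
    ∑ x ∈ Finset.range i, m.nat 1 x) rfl (by decide) (fun m' hF => ?_) le_rfl ?_
    (fun k m' x h => by simpa using h) fun k m' hk hF hv hI => ?_).mono ?_ fun m' h _ => h
  · simp only [NExp.eval, hF.1 0 rfl, hF₁.1 0 rfl, hn]
  · intro i hi
    rw [Nat.le_zero.1 hi, h₁]; simp
  · refine spec_straight rfl (by decide) fun i hi => ?_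
    simp only [Cmd.exec, NExp.eval, Mem.writeNat_nat_self, Function.update_apply, hv, hF.1 1 rfl,
      hF₁.1 1 rfl]
    split_ifs with h
    · rw [h, hI k le_rfl, Finset.sum_range_succ]
    · exact hI i (by omega)
  · rw [Finset.sum_const, Finset.card_range, smul_eq_mul]; omega

/-- Remove all marks. -/
def clearMarks : Cmd := forCmd 15 (.get 0 (.lit 0)) (.setNat 13 (nv 15) (.lit 0))

lemma spec_clearMarks {m : Mem} {n : ℕ} (hn : m.nat 0 0 = n) :
    Spec clearMarks m (200 * (n + 1)) (fun m' => ∀ x < n, m'.nat 13 x = 0) := by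
  refine (spec_for (N := n) (Tc := fun _ => 100) (fun k m' => ∀ x < k, m'.nat 13 x = 0) rfl
    (by decide) (fun m' hF => ?_) le_rfl (by simp) (fun k m' x h => by simpa using h)
    fun k m' hk hF hv hI => ?_).mono ?_ fun m' h _ => h
  · simp only [NExp.eval, hF.1 0 rfl, hn]
  · refine spec_straight rfl (by decide) fun x hx => ?_
    simp only [Cmd.exec, NExp.eval, Mem.writeNat_nat_self, Function.update_apply, hv]
    split_ifs with h
    · rfl
    · exact hI x (by omega)
  · rw [Finset.sum_const, Finset.card_range, smul_eq_mul]; omega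

/-- Compute the centered degree profiles of all vertices of a graph. -/
def profilesCmd : Cmd :=
  .seq offsetsCmd (.seq clearMarks (forCmd 14 (.get 0 (.lit 0)) vertexCmd))

lemma IsGraphData.congr {n : ℕ} {G : SimpleGraph (Fin n)} {dg aj off off' : ℕ → ℕ}
    (h : IsGraphData G dg aj off) (ho : ∀ i < n, off' i = off i) : IsGraphData G dg aj off' := by
  refine ⟨h.deg_eq, fun i j => ?_, fun i => ?_, fun i => ?_⟩
  · rw [ho i i.2]; exact h.adj i j
  · rw [ho i i.2]; exact h.lt i
  · rw [ho i i.2]; exact h.sum i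

lemma spec_profilesCmd {n : ℕ} {G : SimpleGraph (Fin n)} {L : ℕ} {q : unitInterval} {m : Mem}
    (hn : m.nat 0 0 = n) (hL : m.nat 0 1 = L) (hprob : m.real 0 0 = q)
    (hdata : IsGraphData G (m.nat 1) (m.nat 2) (fun i => ∑ x ∈ Finset.range i, m.nat 1 x))
    (hrow : ∀ i < n, m.nat 10 i = i * L) (hq : (q : ℝ) < 1) (hn1 : 1 ≤ n) (hL1 : 1 ≤ L) :
    Spec profilesCmd m (400 * (numEdges G * maxDeg G) + 5000 * (n ^ 2 * L)) (fun m' =>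
      ∀ (i : Fin n) l (hl : l < L), m'.real 1 (i * L + l) = centeredProfile G q i (bin L ⟨l, hl⟩)) := by
  have hsum : ∑ k ∈ Finset.range n, (if h : k < n then
      200 * (deg G ⟨k, h⟩ * maxDeg G) + 4000 * (n * L) else 0)
      = 400 * (numEdges G * maxDeg G) + 4000 * (n ^ 2 * L) := by
    rw [Finset.sum_range fun k => (if h : k < n then
      200 * (deg G ⟨k, h⟩ * maxDeg G) + 4000 * (n * L) else 0)]
    simp only [Fin.is_lt, dif_pos, Fin.eta]
    rw [Finset.sum_add_distrib, ← Finset.mul_sum, ← Finset.sum_mul, sum_deg, Finset.sum_const,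
      Finset.card_univ, Fintype.card_fin, smul_eq_mul]
    ring
  have hT : 200 * (n + 1) + (200 * (n + 1) + (40 * (n + 1) +
      (400 * (numEdges G * maxDeg G) + 4000 * (n ^ 2 * L)))) ≤
      400 * (numEdges G * maxDeg G) + 5000 * (n ^ 2 * L) := by
    have h1 : n * 1 ≤ n * n := Nat.mul_le_mul_left n hn1
    have h2 : n ^ 2 * 1 ≤ n ^ 2 * L := Nat.mul_le_mul_left _ hL1
    rw [sq] at h2 ⊢
    omega
  refine Spec.seq (spec_offsetsCmd hn) (fun m₁ h₁ hF₁ => ?_) hT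
  have g₁ : GraphMem G L q m₁ := by
    refine ⟨?_, ?_, ?_, ?_, ?_⟩
    · rw [hF₁.1 0 rfl, hn]
    · rw [hF₁.1 0 rfl, hL]
    · rw [hF₁.2 0 rfl, hprob]
    · rw [hF₁.1 1 rfl, hF₁.1 2 rfl]
      exact hdata.congr fun i hi => h₁ i hi.le
    · rwa [hF₁.1 10 rfl]
  refine Spec.seq (spec_clearMarks g₁.n_eq) (fun m₂ h₂ hF₂ => ?_) le_rfl
  have g₂ := g₁.frame hF₂ rfl
  refine (spec_for (N := n) (Tc := fun k => if h : k < n then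
      200 * (deg G ⟨k, h⟩ * maxDeg G) + 4000 * (n * L) else 0) (fun k m' =>
      (∀ x : Fin n, m'.nat 13 x ≤ k) ∧ ∀ (i : Fin n), (i : ℕ) < k → ∀ l (hl : l < L),
        m'.real 1 (i * L + l) = centeredProfile G q i (bin L ⟨l, hl⟩)) rfl
    (by decide) (fun m' hF => ?_) (by rw [hsum]) ⟨fun x => (h₂ x x.2).le, fun i hi => by omega⟩
    (fun k m' x h => by simpa using h)
    fun k m' hk hF hv hI => ?_).mono le_rfl fun m' h _ i => h.2 i i.2
  · simp only [NExp.eval, hF.1 0 rfl, g₂.n_eq]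
  · have g' := g₂.frame hF rfl
    refine (spec_vertexCmd g' hq hL1 (i := ⟨k, hk⟩) hv hI.1).mono (by rw [dif_pos hk])
      fun m'' h'' _ => ⟨h''.1, fun i hik l hl => ?_⟩
    rcases (Nat.lt_succ_iff_lt_or_eq.1 hik) with hik | hik
    · have : (i + 1) * L ≤ k * L := Nat.mul_le_mul_right L hik
      rw [h''.2.2 _ (by simp only; linarith), hI.2 i hik l hl]
    · have hi : i = ⟨k, hk⟩ := Fin.ext hik
      subst hi
      exact h''.2.1 l hl

end RealRAM

namespace RealRAM

lemma spec_for_const {v : ℕ} {b : NExp} {c : Cmd} {m : Mem} {N T Tc : ℕ} (Inv : ℕ → Mem → Prop)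
    (hv : c.writesNat v = false) (hbc : b.cost ≤ 20)
    (hb : ∀ m', Frame (forCmd v b c) m m' → b.eval m' = N)
    (hT : N * (Tc + 40) + 40 ≤ T) (h0 : Inv 0 m)
    (hInv : ∀ k m' x, Inv k m' → Inv k (m'.writeNat v 0 x))
    (hstep : ∀ k m', k < N → Frame (forCmd v b c) m m' → m'.nat v 0 = k → Inv k m' →
      Spec c m' Tc (Inv (k + 1))) :
    Spec (forCmd v b c) m T (Inv N) := by
  refine spec_for (Tc := fun _ => Tc) Inv hv hbc hb ?_ h0 hInv hstep
  rw [Finset.sum_const, Finset.card_range, smul_eq_mul]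
  refine le_trans (le_of_eq ?_) hT
  ring

/-! ### Tables of multiples -/

/-- Compute tables of the multiples of the number of bins and of the number of vertices. -/
def tablesCmd : Cmd :=
  .seq (.seq (.setNat 10 (.lit 0) (.lit 0)) (.setNat 11 (.lit 0) (.lit 0)))
    (forCmd 15 (.get 0 (.lit 0))
      (.seq (.setNat 10 (.plus (nv 15) (.lit 1)) (.plus (.get 10 (nv 15)) numBins))
        (.setNat 11 (.plus (nv 15) (.lit 1)) (.plus (.get 11 (nv 15)) (.get 0 (.lit 0))))))

lemma spec_tablesCmd {m : Mem} {n L : ℕ} (hn : m.nat 0 0 = n) (hL : m.nat 0 1 = L) :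
    Spec tablesCmd m (200 * (n + 1)) (fun m' => ∀ i ≤ n, m'.nat 10 i = i * L ∧ m'.nat 11 i = i * n) := by
  refine Spec.seq (T₁ := 100) (T₂ := 140 * n + 40) (Q₁ := fun m' => m'.nat 10 0 = 0 ∧ m'.nat 11 0 = 0)
    (spec_straight rfl (by decide) (by simp [Cmd.exec, NExp.eval])) (fun m₁ h₁ hF₁ => ?_) (by omega)
  refine (spec_for_const (N := n) (Tc := 100) (fun k m' => ∀ i ≤ k, m'.nat 10 i = i * L ∧ m'.nat 11 i = i * n)
    rfl (by decide) (fun m' hF => ?_) (by omega) (fun i hi => ?_) (fun k m' x h => by simpa using h)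
    fun k m' hk hF hv hI => ?_)
  · simp only [NExp.eval, hF.1 0 rfl, hF₁.1 0 rfl, hn]
  · rw [Nat.le_zero.1 hi, h₁.1, h₁.2]; simp
  · refine spec_straight rfl (by decide) fun i hi => ?_
    have e0 : m'.nat 0 = m.nat 0 := by rw [hF.1 0 rfl, hF₁.1 0 rfl]
    rcases hi.lt_or_eq with h | rfl
    · have h1 : i ≠ k + 1 := h.ne
      simpa [Cmd.exec, NExp.eval, hv, Function.update_apply, h1] using hI i (by omega)
    · simp [Cmd.exec, NExp.eval, hv, hI k le_rfl, e0, hn, hL, add_mul]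

/-! ### Copying -/

/-- Copy the array of reals `1` to the array `2`. -/
def copyProfiles : Cmd := forCmd 15 (.get 10 (.get 0 (.lit 0))) (.setReal 2 (nv 15) (.get 1 (nv 15)))

lemma spec_copyProfiles {m : Mem} {N : ℕ} (hN : m.nat 10 (m.nat 0 0) = N) :
    Spec copyProfiles m (140 * N + 40) (fun m' => ∀ x < N, m'.real 2 x = m.real 1 x) := by
  refine spec_for_const (N := N) (Tc := 100) (fun k m' => ∀ x < k, m'.real 2 x = m.real 1 x)
    rfl (by decide) (fun m' hF => ?_) (by omega) (by simp) (fun k m' x h => by simpa using h)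
    fun k m' hk hF hv hI => ?_
  · simp only [NExp.eval, hF.1 0 rfl, hF.1 10 rfl, hN]
  · refine spec_straight rfl (by decide) fun x hx => ?_
    simp only [Cmd.exec, NExp.eval, RExp.eval, Mem.writeReal_real_self, Function.update_apply, hv,
      hF.2 1 rfl]
    split_ifs with h
    · rw [h]
    · exact hI x (by omega)

/-- Copy the degrees in the second graph to the array `1`. -/
def copyDegrees : Cmd := forCmd 15 (.get 0 (.lit 0)) (.setNat 1 (nv 15) (.get 3 (nv 15)))

lemma spec_copyDegrees {m : Mem} {N : ℕ} (hN : m.nat 0 0 = N) :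
    Spec copyDegrees m (140 * N + 40) (fun m' => ∀ x < N, m'.nat 1 x = m.nat 3 x) := by
  refine spec_for_const (N := N) (Tc := 100) (fun k m' => ∀ x < k, m'.nat 1 x = m.nat 3 x)
    rfl (by decide) (fun m' hF => ?_) (by omega) (by simp) (fun k m' x h => by simpa using h)
    fun k m' hk hF hv hI => ?_
  · simp only [NExp.eval, hF.1 0 rfl, hN]
  · refine spec_straight rfl (by decide) fun x hx => ?_
    simp only [Cmd.exec, NExp.eval, Mem.writeNat_nat_self, Function.update_apply, hv, hF.1 3 rfl]
    split_ifs with h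
    · rw [h]
    · exact hI x (by omega)

/-- Copy the neighbour lists of the second graph to the array `2`. -/
def copyNeighbours : Cmd := forCmd 15 (.get 11 (.get 0 (.lit 0))) (.setNat 2 (nv 15) (.get 4 (nv 15)))

lemma spec_copyNeighbours {m : Mem} {N : ℕ} (hN : m.nat 11 (m.nat 0 0) = N) :
    Spec copyNeighbours m (140 * N + 40) (fun m' => ∀ x < N, m'.nat 2 x = m.nat 4 x) := by
  refine spec_for_const (N := N) (Tc := 100) (fun k m' => ∀ x < k, m'.nat 2 x = m.nat 4 x)
    rfl (by decide) (fun m' hF => ?_) (by omega) (by simp) (fun k m' x h => by simpa using h)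
    fun k m' hk hF hv hI => ?_
  · simp only [NExp.eval, hF.1 0 rfl, hF.1 11 rfl, hN]
  · refine spec_straight rfl (by decide) fun x hx => ?_
    simp only [Cmd.exec, NExp.eval, Mem.writeNat_nat_self, Function.update_apply, hv, hF.1 4 rfl]
    split_ifs with h
    · rw [h]
    · exact hI x (by omega)

/-! ### The distance statistics -/

/-- The entry of the array of distance statistics for given row and column. -/
abbrev entry (i k : NExp) : RExp := .get 10 (.plus (.get 11 i) k)

/-- Compute a distance statistic. -/
def distEntry : Cmd :=
  .seq (.setReal 8 (.lit 0) (.ofNat (.lit 0))) (.seq (forCmd 16 numBins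
    (.seq (.setReal 9 (.lit 0) (.minus (.get 2 (.plus (.get 10 (nv 22)) (nv 16)))
        (.get 1 (.plus (.get 10 (nv 23)) (nv 16)))))
      (.setReal 8 (.lit 0) (.plus (rv 8) (.root (.times (rv 9) (rv 9)))))))
    (.setReal 10 (.plus (.get 11 (nv 22)) (nv 23)) (rv 8)))

lemma spec_distEntry {m : Mem} {i k L : ℕ} (hi : m.nat 22 0 = i) (hk : m.nat 23 0 = k)
    (hL : m.nat 0 1 = L) : Spec distEntry m (140 * L + 240) (fun m' => m'.real 10 =
      Function.update (m.real 10) (m.nat 11 i + k) (∑ l ∈ Finset.range L,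
        |m.real 2 (m.nat 10 i + l) - m.real 1 (m.nat 10 k + l)|)) := by
  refine Spec.seq (T₁ := 100) (T₂ := 140 * L + 140) (Q₁ := fun m' => m'.real 8 0 = 0)
    (spec_straight rfl (by decide) (by simp [Cmd.exec, NExp.eval, RExp.eval]))
    (fun m₁ h₁ hF₁ => ?_) (by omega)
  refine Spec.seq (T₁ := 140 * L + 40) (T₂ := 100) (spec_for_const (N := L) (Tc := 100)
    (fun y m' => m'.real 8 0 = ∑ l ∈ Finset.range y,
        |m.real 2 (m.nat 10 i + l) - m.real 1 (m.nat 10 k + l)|) rfl (by decide) (fun m' hF => ?_)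
    (by omega) (by simpa using h₁) (fun k m' x h => by simpa using h) fun y m' hy hF hv hI => ?_)
    (fun m₂ h₂ hF₂ => spec_straight rfl (by decide) ?_) (by omega)
  · simp only [NExp.eval, hF.1 0 rfl, hF₁.1 0 rfl, hL]
  · refine spec_straight rfl (by decide) ?_
    simp [Cmd.exec, NExp.eval, RExp.eval, hv, hI, hF.2 1 rfl, hF.2 2 rfl, hF₁.2 1 rfl, hF₁.2 2 rfl,
      hF.1 10 rfl, hF₁.1 10 rfl, hF.1 22 rfl, hF₁.1 22 rfl, hF.1 23 rfl, hF₁.1 23 rfl, hi, hk,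
      Finset.sum_range_succ, Real.sqrt_mul_self_eq_abs]
  · simp [Cmd.exec, NExp.eval, RExp.eval, hF₂.2 10 rfl, hF₁.2 10 rfl, h₂, hF₂.1 22 rfl, hF₁.1 22 rfl,
      hF₂.1 23 rfl, hF₁.1 23 rfl, hF₂.1 11 rfl, hF₁.1 11 rfl, hi, hk]

/-- Compute all distance statistics. -/
def distances : Cmd := forCmd 22 (.get 0 (.lit 0)) (forCmd 23 (.get 0 (.lit 0)) distEntry)

lemma row_add_lt {n i i' k k' : ℕ} (hi : i' < i) (hk' : k' < n) : i' * n + k' < i * n + k := by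
  have : (i' + 1) * n ≤ i * n := Nat.mul_le_mul_right n hi
  linarith

lemma spec_distances {m : Mem} {n L : ℕ} (hn : m.nat 0 0 = n) (hL : m.nat 0 1 = L)
    (htab : ∀ i ≤ n, m.nat 10 i = i * L ∧ m.nat 11 i = i * n) (hL1 : 1 ≤ L) (hn1 : 1 ≤ n) :
    Spec distances m (600 * (n ^ 2 * L)) (fun m' => ∀ i < n, ∀ k < n, m'.real 10 (i * n + k) =
      ∑ l ∈ Finset.range L, |m.real 2 (i * L + l) - m.real 1 (k * L + l)|) := by
  have hT : n * (n * ((140 * L + 240) + 40) + 40 + 40) + 40 ≤ 600 * (n ^ 2 * L) := by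
    have h2 : n * n * 1 ≤ n * n * L := Nat.mul_le_mul_left _ hL1
    have h3 : n * 1 ≤ n * n := Nat.mul_le_mul_left n hn1
    have e : n * (n * ((140 * L + 240) + 40) + 40 + 40) + 40 =
      140 * (n * n * L) + 280 * (n * n) + 80 * n + 40 := by ring
    rw [e, sq]
    omega
  refine spec_for_const (N := n) (fun y m' => ∀ i < y, ∀ k < n, m'.real 10 (i * n + k) =
      ∑ l ∈ Finset.range L, |m.real 2 (i * L + l) - m.real 1 (k * L + l)|) rfl (by decide)
    (fun m' hF => ?_) hT (by simp) (fun k m' x h => by simpa using h) fun y m₁ hy hF₁ hv₁ hI₁ => ?_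
  · simp only [NExp.eval, hF.1 0 rfl, hn]
  refine (spec_for_const (N := n) (Tc := 140 * L + 240) (fun z m' => (∀ i < y, ∀ k < n, m'.real 10 (i * n + k) =
      ∑ l ∈ Finset.range L, |m.real 2 (i * L + l) - m.real 1 (k * L + l)|) ∧ ∀ k < z,
      m'.real 10 (y * n + k) = ∑ l ∈ Finset.range L, |m.real 2 (y * L + l) - m.real 1 (k * L + l)|)
    rfl (by decide) (fun m' hF => ?_) le_rfl ⟨hI₁, by simp⟩ (fun k m' x h => by simpa using h)
    fun z m₂ hz hF₂ hv₂ hI₂ => ?_).mono le_rfl fun m' h _ i hi => ?_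
  · simp only [NExp.eval, hF.1 0 rfl, hF₁.1 0 rfl, hn]
  · refine (spec_distEntry (i := y) (k := z) (L := L) (by rw [hF₂.1 22 rfl, hv₁]) hv₂
      (by rw [hF₂.1 0 rfl, hF₁.1 0 rfl, hL])).mono le_rfl fun m₃ h₃ hF₃ => ?_
    rw [hF₂.1 11 rfl, hF₁.1 11 rfl, hF₂.1 10 rfl, hF₁.1 10 rfl, (htab y hy.le).1, (htab y hy.le).2,
      (htab z hz.le).1, hF₂.2 2 rfl, hF₁.2 2 rfl, hF₂.2 1 rfl, hF₁.2 1 rfl] at h₃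
    refine ⟨fun i hi k hk => ?_, fun k hk => ?_⟩
    · rw [h₃, Function.update_of_ne (row_add_lt hi hk).ne, hI₂.1 i hi k hk]
    · rw [h₃, Function.update_apply]
      split_ifs with h
      · rw [show k = z by omega]
      · exact hI₂.2 k (by omega)
  · rcases Nat.lt_succ_iff_lt_or_eq.1 hi with h' | rfl
    · exact h.1 i h'
    · exact h.2

/-! ### The output -/

/-- Find the smallest distance statistic of every row. -/
def argmins : Cmd :=
  forCmd 22 (.get 0 (.lit 0)) (.seq (.setNat 6 (nv 22) (.lit 0))
    (forCmd 23 (.get 0 (.lit 0)) (.ite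
      (.realLt (entry (nv 22) (nv 23)) (entry (nv 22) (.get 6 (nv 22))))
      (.setNat 6 (nv 22) (nv 23)) .skip)))

lemma spec_argmins {m : Mem} {n : ℕ} (hn : m.nat 0 0 = n) (hn1 : 1 ≤ n) :
    Spec argmins m (500 * n ^ 2) (fun m' => ∀ i < n, m'.nat 6 i < n ∧ ∀ k < n,
      m.real 10 (m.nat 11 i + m'.nat 6 i) ≤ m.real 10 (m.nat 11 i + k)) := by
  have hT : n * ((100 + (n * (100 + 40) + 40)) + 40) + 40 ≤ 500 * n ^ 2 := by
    have h3 : n * 1 ≤ n * n := Nat.mul_le_mul_left n hn1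
    have e : n * ((100 + (n * (100 + 40) + 40)) + 40) + 40 = 140 * (n * n) + 180 * n + 40 := by ring
    rw [e, sq]
    omega
  refine spec_for_const (N := n) (fun y m' => ∀ i < y, m'.nat 6 i < n ∧ ∀ k < n,
      m.real 10 (m.nat 11 i + m'.nat 6 i) ≤ m.real 10 (m.nat 11 i + k)) rfl (by decide)
    (fun m' hF => ?_) hT (by simp) (fun k m' x h => by simpa using h) fun y m₁ hy hF₁ hv₁ hI₁ => ?_
  · simp only [NExp.eval, hF.1 0 rfl, hn]
  refine Spec.seq (T₁ := 100) (Q₁ := fun m' => m'.nat 6 = Function.update (m₁.nat 6) y 0)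
    (spec_straight rfl (by decide) (by simp [Cmd.exec, NExp.eval, hv₁])) (fun m₂ h₂ hF₂ => ?_) le_rfl
  refine (spec_for_const (N := n) (Tc := 100) (fun z m' => (∀ i < y, m'.nat 6 i = m₁.nat 6 i) ∧
      m'.nat 6 y < n ∧ ∀ k < z, m.real 10 (m.nat 11 y + m'.nat 6 y) ≤ m.real 10 (m.nat 11 y + k))
    rfl (by decide) (fun m' hF => ?_) le_rfl ⟨fun i hi => ?_, ?_, by simp⟩
    (fun k m' x h => by simpa using h) fun z m₃ hz hF₃ hv₃ hI₃ => ?_).mono le_rfl fun m' h _ i hi => ?_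
  · simp only [NExp.eval, hF.1 0 rfl, hF₂.1 0 rfl, hF₁.1 0 rfl, hn]
  · rw [h₂, Function.update_of_ne hi.ne]
  · rw [h₂, Function.update_self]; omega
  · refine spec_straight rfl (by decide) ?_
    have e22 : m₃.nat 22 0 = y := by rw [hF₃.1 22 rfl, hF₂.1 22 rfl, hv₁]
    simp only [Cmd.exec, Test.Holds, RExp.eval, NExp.eval, hv₃, e22, hF₃.1 11 rfl, hF₂.1 11 rfl,
      hF₁.1 11 rfl, hF₃.2 10 rfl, hF₂.2 10 rfl, hF₁.2 10 rfl]
    split_ifs with hlt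
    · refine ⟨fun i hi => ?_, ?_, fun k hk => ?_⟩
      · simp [hi.ne, hI₃.1 i hi]
      · simpa using hz
      · simp only [Mem.writeNat_nat_self, Function.update_self]
        rcases Nat.lt_succ_iff_lt_or_eq.1 hk with h' | rfl
        · exact hlt.le.trans (hI₃.2.2 k h')
        · exact le_rfl
    · refine ⟨hI₃.1, hI₃.2.1, fun k hk => ?_⟩
      rcases Nat.lt_succ_iff_lt_or_eq.1 hk with h' | rfl
      · exact hI₃.2.2 k h'
      · exact not_lt.1 hlt
  · rcases Nat.lt_succ_iff_lt_or_eq.1 hi with h' | rfl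
    · rw [h.1 i h']; exact hI₁ i h'
    · exact h.2

/-- Find the largest row minimum. -/
def maxMin : Cmd :=
  .seq (.setReal 11 (.lit 0) (entry (.lit 0) (.get 6 (.lit 0))))
    (forCmd 22 (.get 0 (.lit 0)) (.ite (.realLt (rv 11) (entry (nv 22) (.get 6 (nv 22))))
      (.setReal 11 (.lit 0) (entry (nv 22) (.get 6 (nv 22)))) .skip))

lemma spec_maxMin {m : Mem} {n : ℕ} (hn : m.nat 0 0 = n) (hn1 : 1 ≤ n) :
    Spec maxMin m (200 * n ^ 2 + 200) (fun m' =>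
      (∃ i < n, m'.real 11 0 = m.real 10 (m.nat 11 i + m.nat 6 i)) ∧
      ∀ i < n, m.real 10 (m.nat 11 i + m.nat 6 i) ≤ m'.real 11 0) := by
  refine Spec.seq (T₁ := 100) (T₂ := 140 * n + 40)
    (Q₁ := fun m' => m'.real 11 0 = m.real 10 (m.nat 11 0 + m.nat 6 0))
    (spec_straight rfl (by decide) (by simp [Cmd.exec, NExp.eval, RExp.eval]))
    (fun m₁ h₁ hF₁ => ?_) (by nlinarith)
  refine (spec_for_const (N := n) (Tc := 100) (fun y m' =>
      (∃ i < n, m'.real 11 0 = m.real 10 (m.nat 11 i + m.nat 6 i)) ∧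
      ∀ i < y, m.real 10 (m.nat 11 i + m.nat 6 i) ≤ m'.real 11 0) rfl (by decide)
    (fun m' hF => ?_) (by omega) ⟨⟨0, hn1, h₁⟩, by simp⟩ (fun k m' x h => by simpa using h)
    fun y m₂ hy hF₂ hv₂ hI₂ => ?_)
  · simp only [NExp.eval, hF.1 0 rfl, hF₁.1 0 rfl, hn]
  refine spec_straight rfl (by decide) ?_
  simp only [Cmd.exec, Test.Holds, RExp.eval, NExp.eval, hv₂, hF₂.1 11 rfl, hF₁.1 11 rfl,
    hF₂.1 6 rfl, hF₁.1 6 rfl, hF₂.2 10 rfl, hF₁.2 10 rfl]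
  split_ifs with hlt
  · simp only [Mem.writeReal_real_self, Function.update_self]
    refine ⟨⟨y, hy, rfl⟩, fun i hi => ?_⟩
    rcases Nat.lt_succ_iff_lt_or_eq.1 hi with h' | rfl
    · exact (hI₂.2 i h').trans hlt.le
    · exact le_rfl
  · refine ⟨hI₂.1, fun i hi => ?_⟩
    rcases Nat.lt_succ_iff_lt_or_eq.1 hi with h' | rfl
    · exact hI₂.2 i h'
    · exact not_lt.1 hlt

/-- Check that the entries outside the row minima are not smaller than the largest row minimum. -/
def checkMax : Cmd :=
  .seq (.setNat 5 (.lit 0) (.lit 1)) (forCmd 22 (.get 0 (.lit 0)) (forCmd 23 (.get 0 (.lit 0))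
    (.ite (.realLt (entry (nv 22) (nv 23)) (rv 11))
      (.ite (.natLt (nv 23) (.get 6 (nv 22))) (.setNat 5 (.lit 0) (.lit 0))
        (.ite (.natLt (.get 6 (nv 22)) (nv 23)) (.setNat 5 (.lit 0) (.lit 0)) .skip)) .skip)))

lemma spec_checkMax {m : Mem} {n : ℕ} (hn : m.nat 0 0 = n) (hn1 : 1 ≤ n) :
    Spec checkMax m (500 * n ^ 2) (fun m' => (m'.nat 5 0 = 0 ∨ m'.nat 5 0 = 1) ∧
      (m'.nat 5 0 = 1 ↔ ∀ r < n, ∀ k < n, k ≠ m.nat 6 r → m.real 11 0 ≤ m.real 10 (m.nat 11 r + k))) := by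
  have hT : 100 + (n * ((n * (100 + 40) + 40) + 40) + 40) ≤ 500 * n ^ 2 := by
    have h3 : n * 1 ≤ n * n := Nat.mul_le_mul_left n hn1
    have e : n * ((n * (100 + 40) + 40) + 40) = 140 * (n * n) + 80 * n := by ring
    rw [e, sq]
    omega
  refine Spec.seq (T₁ := 100) (Q₁ := fun m' => m'.nat 5 0 = 1)
    (spec_straight rfl (by decide) (by simp [Cmd.exec, NExp.eval])) (fun m₁ h₁ hF₁ => ?_) hT
  refine spec_for_const (N := n) (fun y m' => (m'.nat 5 0 = 0 ∨ m'.nat 5 0 = 1) ∧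
      (m'.nat 5 0 = 1 ↔ ∀ r < y, ∀ k < n, k ≠ m.nat 6 r → m.real 11 0 ≤ m.real 10 (m.nat 11 r + k)))
    rfl (by decide) (fun m' hF => ?_) le_rfl ⟨Or.inr h₁, by simp [h₁]⟩
    (fun k m' x h => by simpa using h) fun y m₂ hy hF₂ hv₂ hI₂ => ?_
  · simp only [NExp.eval, hF.1 0 rfl, hF₁.1 0 rfl, hn]
  refine (spec_for_const (N := n) (Tc := 100) (fun z m' => (m'.nat 5 0 = 0 ∨ m'.nat 5 0 = 1) ∧
      (m'.nat 5 0 = 1 ↔ (∀ r < y, ∀ k < n, k ≠ m.nat 6 r → m.real 11 0 ≤ m.real 10 (m.nat 11 r + k)) ∧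
        ∀ k < z, k ≠ m.nat 6 y → m.real 11 0 ≤ m.real 10 (m.nat 11 y + k)))
    rfl (by decide) (fun m' hF => ?_) le_rfl ⟨hI₂.1, by simp [hI₂.2]⟩
    (fun k m' x h => by simpa using h) fun z m₃ hz hF₃ hv₃ hI₃ => ?_).mono le_rfl fun m' h _ => ?_
  · simp only [NExp.eval, hF.1 0 rfl, hF₂.1 0 rfl, hF₁.1 0 rfl, hn]
  · refine spec_straight rfl (by decide) ?_
    have e22 : m₃.nat 22 0 = y := by rw [hF₃.1 22 rfl, hv₂]
    simp only [Cmd.exec, Test.Holds, RExp.eval, NExp.eval, hv₃, e22, hF₃.1 11 rfl, hF₂.1 11 rfl,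
      hF₁.1 11 rfl, hF₃.1 6 rfl, hF₂.1 6 rfl, hF₁.1 6 rfl, hF₃.2 10 rfl, hF₂.2 10 rfl, hF₁.2 10 rfl,
      hF₃.2 11 rfl, hF₂.2 11 rfl, hF₁.2 11 rfl]
    have key : (∀ k < z + 1, k ≠ m.nat 6 y → m.real 11 0 ≤ m.real 10 (m.nat 11 y + k)) ↔
        (∀ k < z, k ≠ m.nat 6 y → m.real 11 0 ≤ m.real 10 (m.nat 11 y + k)) ∧
          (z ≠ m.nat 6 y → m.real 11 0 ≤ m.real 10 (m.nat 11 y + z)) := by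
      refine ⟨fun h => ⟨fun k hk => h k (by omega), h z (by omega)⟩, fun h k hk => ?_⟩
      rcases Nat.lt_succ_iff_lt_or_eq.1 hk with h' | rfl
      · exact h.1 k h'
      · exact h.2
    rw [key]
    by_cases hlt : m.real 10 (m.nat 11 y + z) < m.real 11 0
    · rw [if_pos hlt]
      by_cases hz1 : z = m.nat 6 y
      · rw [if_neg (by omega), if_neg (by omega)]
        refine ⟨hI₃.1, ?_⟩
        rw [hI₃.2]
        tauto
      · have : ¬ (z ≠ m.nat 6 y → m.real 11 0 ≤ m.real 10 (m.nat 11 y + z)) :=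
          fun h => absurd (h hz1) (not_le.2 hlt)
        split_ifs with h1 h2
        · simp [this]
        · simp [this]
        · omega
    · rw [if_neg hlt]
      refine ⟨hI₃.1, ?_⟩
      rw [hI₃.2]
      have := not_lt.1 hlt
      tauto
  · refine ⟨h.1, h.2.trans ⟨fun h' r hr => ?_, fun h' => ⟨fun r hr => h' r (by omega), h' y (by omega)⟩⟩⟩
    rcases Nat.lt_succ_iff_lt_or_eq.1 hr with h'' | rfl
    · exact h'.1 r h''
    · exact h'.2

/-- Check that the row minima are in different columns. -/
def checkInj : Cmd :=
  .seq (forCmd 22 (.get 0 (.lit 0)) (.setNat 24 (nv 22) (.lit 0)))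
    (forCmd 22 (.get 0 (.lit 0)) (.ite (.natLt (.get 24 (.get 6 (nv 22))) (.lit 1))
      (.setNat 24 (.get 6 (nv 22)) (.lit 1)) (.setNat 5 (.lit 0) (.lit 0))))

lemma spec_checkInj {m : Mem} {n : ℕ} (hn : m.nat 0 0 = n) (hn1 : 1 ≤ n)
    (hlt : ∀ i < n, m.nat 6 i < n) (h5 : m.nat 5 0 = 0 ∨ m.nat 5 0 = 1) :
    Spec checkInj m (500 * n ^ 2) (fun m' => (m'.nat 5 0 = 0 ∨ m'.nat 5 0 = 1) ∧
      (m'.nat 5 0 = 1 ↔ m.nat 5 0 = 1 ∧ ∀ i < n, ∀ j < i, m.nat 6 j ≠ m.nat 6 i)) := by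
  refine Spec.seq (T₁ := 140 * n + 40) (T₂ := 140 * n + 40) (spec_for_const (N := n) (Tc := 100)
    (fun k m' => ∀ x < k, m'.nat 24 x = 0) rfl (by decide) (fun m' hF => ?_) (by omega)
    (by simp) (fun k m' x h => by simpa using h) fun k m' hk hF hv hI => ?_)
    (fun m₁ h₁ hF₁ => ?_) (by nlinarith)
  · simp only [NExp.eval, hF.1 0 rfl, hn]
  · refine spec_straight rfl (by decide) fun x hx => ?_
    simp only [Cmd.exec, NExp.eval, Mem.writeNat_nat_self, Function.update_apply, hv]
    split_ifs with h
    · rfl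
    · exact hI x (by omega)
  refine (spec_for_const (N := n) (Tc := 100) (fun k m' =>
      (∀ x < n, m'.nat 24 x = 0 ↔ ∀ i < k, m.nat 6 i ≠ x) ∧ (m'.nat 5 0 = 0 ∨ m'.nat 5 0 = 1) ∧
      (m'.nat 5 0 = 1 ↔ m.nat 5 0 = 1 ∧ ∀ i < k, ∀ j < i, m.nat 6 j ≠ m.nat 6 i))
    rfl (by decide) (fun m' hF => ?_) (by omega) ⟨fun x hx => by simp [h₁ x hx], ?_, ?_⟩
    (fun k m' x h => by simpa using h) fun k m' hk hF hv hI => ?_).mono le_rfl fun m' h _ => h.2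
  · simp only [NExp.eval, hF.1 0 rfl, hF₁.1 0 rfl, hn]
  · rwa [hF₁.1 5 rfl]
  · simp [hF₁.1 5 rfl]
  · refine spec_straight rfl (by decide) ?_
    have key : (∀ i < k + 1, ∀ j < i, m.nat 6 j ≠ m.nat 6 i) ↔
        (∀ i < k, ∀ j < i, m.nat 6 j ≠ m.nat 6 i) ∧ ∀ j < k, m.nat 6 j ≠ m.nat 6 k := by
      refine ⟨fun h => ⟨fun i hi => h i (by omega), h k (by omega)⟩, fun h i hi => ?_⟩
      rcases Nat.lt_succ_iff_lt_or_eq.1 hi with h' | rfl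
      · exact h.1 i h'
      · exact h.2
    have key2 : ∀ x, (∀ i < k + 1, m.nat 6 i ≠ x) ↔ (∀ i < k, m.nat 6 i ≠ x) ∧ m.nat 6 k ≠ x := by
      refine fun x => ⟨fun h => ⟨fun i hi => h i (by omega), h k (by omega)⟩, fun h i hi => ?_⟩
      rcases Nat.lt_succ_iff_lt_or_eq.1 hi with h' | rfl
      · exact h.1 i h'
      · exact h.2
    have hk6 := hI.1 _ (hlt k hk)
    simp only [Cmd.exec, Test.Holds, NExp.eval, hv, hF.1 6 rfl, hF₁.1 6 rfl, Nat.lt_one_iff, key, key2]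
    split_ifs with h
    · refine ⟨fun x hx => ?_, by simpa using hI.2.1, ?_⟩
      · simp only [Mem.writeNat_nat_self, Function.update_apply]
        split_ifs with hx'
        · simp [hx']
        · rw [hI.1 x hx]
          exact ⟨fun h => ⟨h, Ne.symm hx'⟩, fun h => h.1⟩
      · have h' := hk6.1 h
        rw [Mem.writeNat_nat_ne _ _ _ (by decide), hI.2.2]
        tauto
    · have h' := mt hk6.2 h
      refine ⟨fun x hx => ?_, by simp, by simp [h']⟩
      rw [Mem.writeNat_nat_ne _ _ _ (by decide), hI.1 x hx]
      refine ⟨fun h1 => ⟨h1, ?_⟩, fun h1 => h1.1⟩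
      rintro rfl
      exact h' h1

end RealRAM

/-! ### Sets of smallest entries -/

lemma exists_isSmallest {n : ℕ} (hn : 1 ≤ n) (Z : Fin n → Fin n → ℝ) : ∃ S, IsSmallest Z S := by
  classical
  have hne : (Finset.powersetCard n (Finset.univ : Finset (Fin n × Fin n))).Nonempty := by
    rw [Finset.powersetCard_nonempty, Finset.card_univ, Fintype.card_prod, Fintype.card_fin]
    exact Nat.le_mul_of_pos_left n hn
  obtain ⟨S, hS, hmin⟩ := Finset.exists_min_image _ (fun S => ∑ p ∈ S, Z p.1 p.2) hne
  have hcard := (Finset.mem_powersetCard.1 hS).2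
  refine ⟨S, hcard, fun p hp r hr => ?_⟩
  have hr' : r ∉ S.erase p := fun h => hr (Finset.mem_of_mem_erase h)
  have h1 := hmin (insert r (S.erase p)) (by
    rw [Finset.mem_powersetCard, Finset.card_insert_of_notMem hr', Finset.card_erase_of_mem hp, hcard]
    exact ⟨Finset.subset_univ _, by omega⟩)
  rw [Finset.sum_insert hr', ← Finset.add_sum_erase _ _ hp] at h1
  linarith

/-- If the row minima are in different columns and at most as large as all other entries, then they
are the smallest entries; otherwise, the smallest entries may be chosen such that they are not the
graph of a permutation. -/
lemma exists_isMatchingOutput {n : ℕ} (hn : 1 ≤ n) {A B : SimpleGraph (Fin n)} {L : ℕ}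
    {q : unitInterval} {c : Fin n → Fin n} (hc : ∀ i k, distStat A B L q i (c i) ≤ distStat A B L q i k) :
    (∀ ρ : Equiv.Perm (Fin n), (∀ i, c i = ρ i) →
      (∀ i r k, k ≠ c r → distStat A B L q i (c i) ≤ distStat A B L q r k) →
        IsMatchingOutput A B L q (some ρ)) ∧
    (¬ (Function.Injective c ∧
      ∀ i r k, k ≠ c r → distStat A B L q i (c i) ≤ distStat A B L q r k) →
        IsMatchingOutput A B L q none) := by
  classical
  set Z := distStat A B L q with hZ
  set S := Finset.univ.image fun i => (i, c i) with hS
  have hmem : ∀ i k, (i, k) ∈ S ↔ k = c i := fun i k => by simp [hS, eq_comm]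
  have hcard : S.card = n := by
    rw [hS, Finset.card_image_of_injective _ fun i j hij => (Prod.ext_iff.1 hij).1, Finset.card_fin]
  have hsmall : (∀ i r k, k ≠ c r → Z i (c i) ≤ Z r k) → IsSmallest Z S := by
    refine fun h => ⟨hcard, ?_⟩
    rintro ⟨i, k⟩ hp ⟨r, l⟩ hr
    rw [hmem] at hp hr
    subst hp
    exact h i r l hr
  refine ⟨fun ρ hρ h => ⟨S, hsmall h, fun ρ' => ?_⟩, fun h => ?_⟩
  · simp only [hmem, Option.some_inj, hρ]
    constructor
    · rintro rfl i k
      rfl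
    · exact fun h => Equiv.ext fun i => (h i (ρ i)).1 rfl
  · by_cases hmax : ∀ i r k, k ≠ c r → Z i (c i) ≤ Z r k
    · refine ⟨S, hsmall hmax, fun ρ => ⟨fun h => by simp at h, fun hρ => ?_⟩⟩
      refine absurd ⟨fun i j hij => ?_, hmax⟩ h
      have hcρ : ∀ i, c i = ρ i := fun i => (hρ i (c i)).1 ((hmem i _).2 rfl)
      rw [hcρ, hcρ] at hij
      exact ρ.injective hij
    · push Not at hmax
      obtain ⟨i, r, k, hk, hlt⟩ := hmax
      obtain ⟨S', hS'⟩ := exists_isSmallest hn Z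
      refine ⟨S', hS', fun ρ => ⟨fun h => by simp at h, fun hρ => ?_⟩⟩
      have hi : (i, ρ i) ∈ S' := (hρ i _).2 rfl
      have hout : ∀ l, Z r l < Z i (ρ i) → (r, l) ∈ S' := fun l hl => by
        by_contra hl'
        exact absurd (hS'.2 _ hi _ hl') (not_le.2 hl)
      have h1 := hlt.trans_le (hc i (ρ i))
      have h2 := (hρ r k).1 (hout k h1)
      have h3 := (hρ r (c r)).1 (hout (c r) ((hc r k).trans_lt h1))
      exact absurd (h2.trans h3.symm) hk

namespace RealRAM

/-! ### The input -/

lemma getElem?_flatten {α : Type*} (ls : List (List α)) (i d : ℕ) (hi : i < ls.length)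
    (hd : d < ls[i].length) :
    ls.flatten[(∑ x ∈ Finset.range i, (ls.getD x []).length) + d]? = some ls[i][d] := by
  induction ls generalizing i with
  | nil => simp at hi
  | cons l ls ih =>
    cases i with
    | zero =>
      simp only [List.getElem_cons_zero] at hd
      simp [List.getElem?_append_left hd, hd]
    | succ i =>
      simp only [List.getElem_cons_succ] at hd ⊢
      rw [← ih i (by simpa using hi) hd, Finset.sum_range_succ', List.flatten_cons,
        List.getElem?_append_right (by simp; omega)]
      simp only [List.getD_cons_succ, List.getD_cons_zero]
      congr 1
      omega

lemma isGraphData_of_isAdjList {n : ℕ} {G : SimpleGraph (Fin n)} {adj : Fin n → List (Fin n)}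
    (h : IsAdjList G adj) {dg aj : ℕ → ℕ} (hdg : ∀ i : Fin n, dg i = (adj i).length)
    (haj : ∀ x < n * n, aj x = ((List.ofFn adj).flatten.map Fin.val).getD x 0) :
    IsGraphData G dg aj (fun i => ∑ x ∈ Finset.range i, dg x) := by
  classical
  have hset : ∀ i, (adj i).toFinset = nbrs G i := fun i => by
    ext x; rw [List.mem_toFinset, mem_nbrs, (h i).2]
  have hlen : ∀ i, (adj i).length = deg G i := fun i => by
    rw [deg, ← hset, List.toFinset_card_of_nodup (h i).1]
  have hget : ∀ (i : Fin n) d (hd : d < (adj i).length),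
      aj ((∑ x ∈ Finset.range i, dg x) + d) = (adj i)[d] := fun i d hd => by
    have hi : (i : ℕ) < (List.ofFn adj).length := by simp
    have hle : (∑ x ∈ Finset.range i, dg x) + d < n * n := by
      have h1 : ∑ x ∈ Finset.range i, dg x ≤ i * n := by
        have := Finset.sum_le_card_nsmul (Finset.range i) dg n fun x hx => by
          have hx' : x < n := (Finset.mem_range.1 hx).trans i.2
          rw [hdg ⟨x, hx'⟩, hlen]
          exact (Nat.le_succ _).trans (deg_lt G _)
        simpa using this
      have h2 : (i + 1) * n ≤ n * n := Nat.mul_le_mul_right n i.2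
      have h3 := deg_lt G i
      rw [hlen] at hd
      linarith
    have h1 : ∑ x ∈ Finset.range i, dg x
        = ∑ x ∈ Finset.range i, ((List.ofFn adj).getD x []).length := by
      refine Finset.sum_congr rfl fun x hx => ?_
      have hx' : x < n := (Finset.mem_range.1 hx).trans i.2
      rw [hdg ⟨x, hx'⟩, List.getD_eq_getElem _ _ (by simpa using hx')]
      simp
    have h2 := getElem?_flatten (List.ofFn adj) i d hi (by simpa using hd)
    rw [haj _ hle, List.getD_eq_getElem?_getD, List.getElem?_map, h1, h2]
    simp
  refine ⟨fun i => by rw [hdg, hlen], fun i j => ?_, fun i d hd => ?_, fun i f => ?_⟩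
  · rw [← (h i).2, List.mem_iff_getElem]
    constructor
    · rintro ⟨d, hd, rfl⟩
      exact ⟨d, by rwa [hdg], hget i d hd⟩
    · rintro ⟨d, hd, hj⟩
      rw [hdg] at hd
      refine ⟨d, hd, Fin.ext ?_⟩
      rw [← hget i d hd, hj]
  · rw [hdg] at hd
    rw [hget i d hd]
    exact Fin.is_lt _
  · rw [← hset, List.sum_toFinset (fun j : Fin n => f j) (h i).1, hdg, Finset.sum_range,
      ← Fin.sum_univ_fun_getElem]
    exact Finset.sum_congr rfl fun d _ => by rw [hget i d d.2]

/-! ### The program -/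

/-- Compute the centered degree profiles of both graphs. -/
def bothProfiles : Cmd :=
  .seq tablesCmd (.seq profilesCmd (.seq copyProfiles (.seq copyDegrees (.seq copyNeighbours
    profilesCmd))))

/-- The degree-profile matching algorithm. -/
def matchingCmd : Cmd :=
  .seq bothProfiles (.seq distances (.seq argmins (.seq maxMin (.seq checkMax checkInj))))

lemma spec_bothProfiles {n L : ℕ} {q : unitInterval} {A B : SimpleGraph (Fin n)}
    {adjA adjB : Fin n → List (Fin n)} (hn1 : 1 ≤ n) (hL1 : 1 ≤ L) (hq : (q : ℝ) < 1)
    (hA : IsAdjList A adjA) (hB : IsAdjList B adjB) :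
    Spec bothProfiles (inputMem adjA adjB L q)
      (400 * (numEdges A * maxDeg A + numEdges B * maxDeg B) + 12000 * (n ^ 2 * L))
      (fun m' => (∀ i ≤ n, m'.nat 10 i = i * L ∧ m'.nat 11 i = i * n) ∧
        ∀ (i : Fin n) l (hl : l < L),
          m'.real 2 (i * L + l) = centeredProfile A q i (bin L ⟨l, hl⟩) ∧
          m'.real 1 (i * L + l) = centeredProfile B q i (bin L ⟨l, hl⟩)) := by
  set m := inputMem adjA adjB L q with hm
  have hT : 200 * (n + 1) + ((400 * (numEdges A * maxDeg A) + 5000 * (n ^ 2 * L)) +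
      ((140 * (n * L) + 40) + ((140 * n + 40) + ((140 * (n * n) + 40) +
      (400 * (numEdges B * maxDeg B) + 5000 * (n ^ 2 * L)))))) ≤
      400 * (numEdges A * maxDeg A + numEdges B * maxDeg B) + 12000 * (n ^ 2 * L) := by
    have h1 : n * 1 ≤ n * n := Nat.mul_le_mul_left n hn1
    have h2 : n * n * 1 ≤ n * n * L := Nat.mul_le_mul_left _ hL1
    have h3 : n * L * 1 ≤ n * L * n := Nat.mul_le_mul_left _ hn1
    have h4 : n * L * n = n * n * L := by ring
    rw [sq]
    omega
  have i0 : m.nat 0 0 = n := rfl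
  have i1 : m.nat 0 1 = L := rfl
  have iq : m.real 0 0 = q := by simp [hm, inputMem]
  have i3 : ∀ i : Fin n, m.nat 1 i = (adjA i).length := fun i => by simp [hm, inputMem]
  have i4 : ∀ i : Fin n, m.nat 3 i = (adjB i).length := fun i => by simp [hm, inputMem]
  refine Spec.seq (spec_tablesCmd i0 i1) (fun m₁ h₁ hF₁ => ?_) hT
  have a0 : m₁.nat 0 = m.nat 0 := hF₁.1 0 rfl
  refine Spec.seq (spec_profilesCmd (G := A) (L := L) (q := q) (by rw [a0, i0]) (by rw [a0, i1])
    (by rw [hF₁.2 0 rfl, iq]) ?_ (fun i hi => (h₁ i hi.le).1) hq hn1 hL1) (fun m₂ h₂ hF₂ => ?_) le_rfl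
  · rw [hF₁.1 1 rfl, hF₁.1 2 rfl]
    exact isGraphData_of_isAdjList hA i3 fun x _ => rfl
  have a2 : m₂.nat 0 = m.nat 0 := by rw [hF₂.1 0 rfl, a0]
  refine Spec.seq (spec_copyProfiles (N := n * L) (by
    rw [a2, i0, hF₂.1 10 rfl, (h₁ n le_rfl).1])) (fun m₃ h₃ hF₃ => ?_) le_rfl
  have a3 : m₃.nat 0 = m.nat 0 := by rw [hF₃.1 0 rfl, a2]
  refine Spec.seq (spec_copyDegrees (N := n) (by rw [a3, i0])) (fun m₄ h₄ hF₄ => ?_) le_rfl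
  have a4 : m₄.nat 0 = m.nat 0 := by rw [hF₄.1 0 rfl, a3]
  refine Spec.seq (spec_copyNeighbours (N := n * n) (by
    rw [a4, i0, hF₄.1 11 rfl, hF₃.1 11 rfl, hF₂.1 11 rfl, (h₁ n le_rfl).2])) (fun m₅ h₅ hF₅ => ?_) le_rfl
  have a5 : m₅.nat 0 = m.nat 0 := by rw [hF₅.1 0 rfl, a4]
  have a10 : m₅.nat 10 = m₁.nat 10 := by rw [hF₅.1 10 rfl, hF₄.1 10 rfl, hF₃.1 10 rfl, hF₂.1 10 rfl]
  have a11 : m₅.nat 11 = m₁.nat 11 := by rw [hF₅.1 11 rfl, hF₄.1 11 rfl, hF₃.1 11 rfl, hF₂.1 11 rfl]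
  refine (spec_profilesCmd (G := B) (L := L) (q := q) (by rw [a5, i0]) (by rw [a5, i1])
    (by rw [hF₅.2 0 rfl, hF₄.2 0 rfl, hF₃.2 0 rfl, hF₂.2 0 rfl, hF₁.2 0 rfl, iq])
    (isGraphData_of_isAdjList hB (fun i => ?_) fun x hx => ?_)
    (fun i hi => by rw [a10, (h₁ i hi.le).1]) hq hn1 hL1).mono le_rfl
    fun m₆ h₆ hF₆ => ⟨fun i hi => ?_, fun i l hl => ⟨?_, h₆ i l hl⟩⟩
  · rw [hF₅.1 1 rfl, h₄ i i.2, hF₃.1 3 rfl, hF₂.1 3 rfl, hF₁.1 3 rfl, i4]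
  · rw [h₅ x hx, hF₄.1 4 rfl, hF₃.1 4 rfl, hF₂.1 4 rfl, hF₁.1 4 rfl]
    rfl
  · rw [hF₆.1 10 rfl, hF₆.1 11 rfl, a10, a11]
    exact h₁ i hi
  · have hlt : i * L + l < n * L := by
      have := row_add_lt (k := 0) i.2 hl
      simpa using this
    rw [hF₆.2 2 rfl, hF₅.2 2 rfl, hF₄.2 2 rfl, h₃ _ hlt, h₂ i l hl]

lemma spec_matchingCmd {n L : ℕ} {q : unitInterval} {A B : SimpleGraph (Fin n)}
    {adjA adjB : Fin n → List (Fin n)} (hn1 : 1 ≤ n) (hL1 : 1 ≤ L) (hq : (q : ℝ) < 1)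
    (hA : IsAdjList A adjA) (hB : IsAdjList B adjB) :
    Spec matchingCmd (inputMem adjA adjB L q)
      (400 * (numEdges A * maxDeg A + numEdges B * maxDeg B) + 15000 * (n ^ 2 * L))
      (fun m' => ∃ o, IsMatchingOutput A B L q o ∧ HasOutput m' o) := by
  set m := inputMem adjA adjB L q with hm
  have hT : (400 * (numEdges A * maxDeg A + numEdges B * maxDeg B) + 12000 * (n ^ 2 * L)) +
      (600 * (n ^ 2 * L) + (500 * n ^ 2 + ((200 * n ^ 2 + 200) + (500 * n ^ 2 + 500 * n ^ 2)))) ≤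
      400 * (numEdges A * maxDeg A + numEdges B * maxDeg B) + 15000 * (n ^ 2 * L) := by
    have h1 : 1 * 1 ≤ n * n := Nat.mul_le_mul hn1 hn1
    have h2 : n * n * 1 ≤ n * n * L := Nat.mul_le_mul_left _ hL1
    rw [sq]
    omega
  have i0 : m.nat 0 0 = n := rfl
  have i1 : m.nat 0 1 = L := rfl
  refine Spec.seq (spec_bothProfiles hn1 hL1 hq hA hB) (fun m₁ h₁ hF₁ => ?_) hT
  have a1 : m₁.nat 0 = m.nat 0 := hF₁.1 0 rfl
  refine Spec.seq (spec_distances (by rw [a1, i0]) (by rw [a1, i1]) h₁.1 hL1 hn1)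
    (fun m₂ h₂ hF₂ => ?_) le_rfl
  have a2 : m₂.nat 0 = m.nat 0 := by rw [hF₂.1 0 rfl, a1]
  have hZ : ∀ i k : Fin n, m₂.real 10 (m₂.nat 11 i + k) = distStat A B L q i k := fun i k => by
    rw [hF₂.1 11 rfl, (h₁.1 i i.2.le).2, h₂ i i.2 k k.2, distStat, Finset.sum_range]
    refine Finset.sum_congr rfl fun l _ => ?_
    rw [(h₁.2 i l l.2).1, (h₁.2 k l l.2).2]
  refine Spec.seq (spec_argmins (n := n) (by rw [a2, i0]) hn1) (fun m₃ h₃ hF₃ => ?_) le_rfl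
  have a3 : m₃.nat 0 = m.nat 0 := by rw [hF₃.1 0 rfl, a2]
  refine Spec.seq (spec_maxMin (n := n) (by rw [a3, i0]) hn1) (fun m₄ h₄ hF₄ => ?_) le_rfl
  rw [hF₃.2 10 rfl, hF₃.1 11 rfl] at h₄
  have a4 : m₄.nat 0 = m.nat 0 := by rw [hF₄.1 0 rfl, a3]
  refine Spec.seq (spec_checkMax (n := n) (by rw [a4, i0]) hn1) (fun m₅ h₅ hF₅ => ?_) le_rfl
  rw [hF₄.2 10 rfl, hF₃.2 10 rfl, hF₄.1 11 rfl, hF₃.1 11 rfl, hF₄.1 6 rfl] at h₅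
  have a5 : m₅.nat 0 = m.nat 0 := by rw [hF₅.1 0 rfl, a4]
  have e6 : m₅.nat 6 = m₃.nat 6 := by rw [hF₅.1 6 rfl, hF₄.1 6 rfl]
  refine (spec_checkInj (n := n) (by rw [a5, i0]) hn1 (fun i hi => by rw [e6]; exact (h₃ i hi).1)
    h₅.1).mono le_rfl fun m₆ h₆ hF₆ => ?_
  set c : Fin n → Fin n := fun i => ⟨m₃.nat 6 i, (h₃ i i.2).1⟩ with hc
  have hcmin : ∀ i k, distStat A B L q i (c i) ≤ distStat A B L q i k := fun i k => by
    rw [← hZ, ← hZ]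
    exact (h₃ i i.2).2 k k.2
  obtain ⟨hsome, hnone⟩ := exists_isMatchingOutput hn1 hcmin
  have hmax : (∀ r < n, ∀ k < n, k ≠ m₃.nat 6 r → m₄.real 11 0 ≤ m₂.real 10 (m₂.nat 11 r + k)) ↔
      ∀ i r k, k ≠ c r → distStat A B L q i (c i) ≤ distStat A B L q r k := by
    constructor
    · intro h i r k hk
      rw [← hZ, ← hZ]
      exact (h₄.2 i i.2).trans (h r r.2 k k.2 fun h' => hk (Fin.ext h'))
    · intro h r hr k hk hne
      obtain ⟨i, hi, hM⟩ := h₄.1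
      rw [hM]
      have := h ⟨i, hi⟩ ⟨r, hr⟩ ⟨k, hk⟩ fun h' => hne (congrArg Fin.val h')
      rwa [← hZ, ← hZ] at this
  have hinj : (∀ i < n, ∀ j < i, m₃.nat 6 j ≠ m₃.nat 6 i) ↔ Function.Injective c := by
    constructor
    · intro h i j hij
      have hij' : m₃.nat 6 i = m₃.nat 6 j := congrArg Fin.val hij
      rcases lt_trichotomy i j with hlt | heq | hlt
      · exact absurd hij' (h j j.2 i hlt)
      · exact heq
      · exact absurd hij'.symm (h i i.2 j hlt)
    · intro h i hi j hj hij
      have := h (a₁ := ⟨j, hj.trans hi⟩) (a₂ := ⟨i, hi⟩) (Fin.ext hij)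
      exact hj.ne (congrArg Fin.val this)
  rw [e6, h₅.2, hmax, hinj] at h₆
  rcases h₆.1 with h0 | h1
  · refine ⟨none, hnone fun h => ?_, h0⟩
    rw [h₆.2.2 ⟨h.2, h.1⟩] at h0
    exact absurd h0 one_ne_zero
  · obtain ⟨hle, hinj'⟩ := h₆.2.1 h1
    refine ⟨some (Equiv.ofBijective c (Finite.injective_iff_bijective.1 hinj')),
      hsome _ (fun i => rfl) hle, h1, fun i => ?_⟩
    rw [hF₆.1 6 rfl, e6]
    rfl

end RealRAM

/-- A single program carries out the degree-profile matching algorithm on every input, within the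
required time. -/
theorem matchingCmd_computes {n L : ℕ} {q : unitInterval} {A B : SimpleGraph (Fin n)}
    {adjA adjB : Fin n → List (Fin n)} (hn1 : 1 ≤ n) (hL1 : 1 ≤ L) (hq : (q : ℝ) < 1)
    (hA : RealRAM.IsAdjList A adjA) (hB : RealRAM.IsAdjList B adjB) :
    ∃ o : Option (Equiv.Perm (Fin n)), IsMatchingOutput A B L q o ∧
      RealRAM.Computes RealRAM.matchingCmd (RealRAM.inputMem adjA adjB L q) o
        (15000 * ((numEdges A : ℝ) * maxDeg A + (numEdges B : ℝ) * maxDeg B + (n : ℝ) ^ 2) *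
          ((L : ℝ) + Real.log n) ^ 1) := by
  obtain ⟨m', t, hr, ht, ⟨o, ho, hm'⟩, -⟩ := RealRAM.spec_matchingCmd hn1 hL1 hq hA hB
  refine ⟨o, ho, m', t, hr, hm', ?_⟩
  have ht' : (t : ℝ) ≤ 400 * ((numEdges A : ℝ) * maxDeg A + numEdges B * maxDeg B)
      + 15000 * ((n : ℝ) ^ 2 * L) := by exact_mod_cast ht
  have hlog : 0 ≤ Real.log n := Real.log_natCast_nonneg n
  have hL : (1 : ℝ) ≤ L := by exact_mod_cast hL1
  set E := (numEdges A : ℝ) * maxDeg A + numEdges B * maxDeg B with hE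
  have hE0 : 0 ≤ E := by positivity
  calc (t : ℝ) ≤ 400 * E + 15000 * ((n : ℝ) ^ 2 * L) := ht'
    _ ≤ 15000 * (E + (n : ℝ) ^ 2) * L := by nlinarith
    _ ≤ 15000 * (E + (n : ℝ) ^ 2) * (L + Real.log n) ^ 1 := by
      rw [pow_one]
      gcongr
      linarith

/-- A single program `P` carries out the degree-profile matching algorithm on every input, in time
`O((|E(A)| d_max(A) + |E(B)| d_max(B) + n²) (L + log n)^κ)`; and in the correlated Erdős–Rényi
model, with probability `1 - O(1/n)`, the output of the algorithm is the latent permutation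
(however ties are broken) and `P` produces it within `O((n d² + n²) (log n)^κ)` steps, `d = n q`. -/
theorem mainTheorem1 :
    ∃ (P : RealRAM.Cmd) (κ : ℕ),
      (∃ K : ℝ, ∀ (n L : ℕ) (q : unitInterval) (A B : SimpleGraph (Fin n))
          (adjA adjB : Fin n → List (Fin n)),
        1 ≤ n → 1 ≤ L → 0 < (q : ℝ) → (q : ℝ) < 1 →
        RealRAM.IsAdjList A adjA → RealRAM.IsAdjList B adjB →
        ∃ o : Option (Equiv.Perm (Fin n)), IsMatchingOutput A B L q o ∧
          RealRAM.Computes P (RealRAM.inputMem adjA adjB L q) o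
            (K * ((numEdges A : ℝ) * maxDeg A + (numEdges B : ℝ) * maxDeg B + (n : ℝ) ^ 2) *
              ((L : ℝ) + Real.log n) ^ κ)) ∧
      (∃ q₀ : ℝ, 0 < q₀ ∧ ∃ Lmin : ℝ, 0 < Lmin ∧ ∀ L₀ : ℝ, Lmin ≤ L₀ →
        ∃ σ₀ : ℝ, 0 < σ₀ ∧ ∃ C₀ : ℝ, 0 < C₀ ∧ ∃ K : ℝ,
          ∀ (n : ℕ) (q s : unitInterval) (σ : ℝ) (π : Equiv.Perm (Fin n)),
            2 ≤ n → (q : ℝ) ≤ q₀ → 0 ≤ σ → (s : ℝ) = 1 - σ ^ 2 →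
            σ ≤ σ₀ / Real.log n → C₀ * Real.log n ^ 2 ≤ (n : ℝ) * q →
            1 - K / n ≤ (correlatedER n q s π).real
              {w | (∀ o, IsMatchingOutput w.1 w.2 ⌈L₀ * Real.log n⌉₊ q o → o = some π) ∧
                ∀ adjA adjB : Fin n → List (Fin n),
                  RealRAM.IsAdjList w.1 adjA → RealRAM.IsAdjList w.2 adjB →
                  RealRAM.Computes P (RealRAM.inputMem adjA adjB ⌈L₀ * Real.log n⌉₊ q) (some π)
                    (K * ((n : ℝ) * ((n : ℝ) * q) ^ 2 + (n : ℝ) ^ 2) * Real.log n ^ κ)}) := by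
  have hP : ∀ (n L : ℕ) (q : unitInterval) (A B : SimpleGraph (Fin n))
      (adjA adjB : Fin n → List (Fin n)), 1 ≤ n → 1 ≤ L → 0 < (q : ℝ) → (q : ℝ) < 1 →
      RealRAM.IsAdjList A adjA → RealRAM.IsAdjList B adjB → _ :=
    fun _ _ _ _ _ _ _ hn hL _ hq hA hB => matchingCmd_computes hn hL hq hA hB
  exact ⟨RealRAM.matchingCmd, 1, ⟨15000, hP⟩, recovery_of_running_time hP⟩
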